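/- Let $M$ be a (smooth, second countable, Hausdorff, finite dimensional) Riemannian manifold, possibly with boundary and corners, and let $m$ be its Lebesgue (Riemannian volume) measure on the Borel sets. Let $f:M\to M$ be a (Borel measurable) piecewise $C^{1+\eta}$ map, $0<\eta\le 1$: there are at most countably many pairwise disjoint open sets $M_1,M_2,\dots$ with $\bigcup_i\overline{M_i}=M$ such that $f|_{\bigcup_i M_i}$ is $C^1$ with locally $\eta$-Hölder derivative, and the singular set $S=M\setminus\bigcup_i M_i$ satisfies $m(S)=0$. Let $\Delta_0\subset M\setminus S$ be a Borel set with $m(\Delta_0)>0$, let $\mathcal P$ be a countable $m$ mod $0$ partition of $\Delta_0$ into sets that are open in $\Delta_0$, and let $R:\Delta_0\to\{1,2,\dots\}$ be constant on each $\omega\in\mathcal P$, with $f^j(\omega)\cap S=\emptyset$ for $1\le j\le R(\omega)$ and $f^{R(\omega)}(\omega)\subset\Delta_0$. Let $F=f^R:\Delta_0\to\Delta_0$ be the induced map, $F|_\omega=f^{R(\omega)}|_\omega$ for $\omega\in\mathcal P$. Assume that $F$ is Gibbs–Markov, that is: 1. $F$ maps each $\omega\in\mathcal P$ bijectively to $\Delta_0$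 mod $0$; 2. there is a measurable $J_F:\Delta_0\to(0,\infty)$ with $m(F(A))=\int_A J_F\,dm$ for every measurable $A\subset\omega\in\mathcal P$; 3. the partitions $\mathcal P_n=\bigvee_{i=0}^{n-1}F^{-i}\mathcal P$, $n\ge 1$, generate the Borel $\sigma$-algebra of $\Delta_0$ mod $0$; 4. $\bigvee_{i=0}^{\infty}F^{-i}\mathcal P$ is the partition of $\Delta_0$ into single points mod $0$; 5. there are $C>0$ and $0<\beta<1$ with $\log\frac{J_F(x)}{J_F(y)}\le C\beta^{s(F(x),F(y))}$ for all $x,y\in\omega\in\mathcal P$, where $s(x,y)$ is the least $n\ge 0$ such that $F^n(x)$ and $F^n(y)$ lie in distinct elements of $\mathcal P$ (and $s(x,y)=0$ if there is no such $n$). Assume moreover that $\int_{\Delta_0}R\,dm<\infty$, and let $\mu$ be an ergodic SRB measure for $f$ (an ergodic $f$-invariant probability measure with $\mu\ll m$) given by $f^R$, that is, $$\mu=\frac{1}{\sum_{j\ge 0}\nu_0(\{R>j\})}\sum_{j\ge 0}f^j_*\bigl(\nu_0|_{\{R>j\}}\bigr)$$ for an ergodic $F$-invariant probability measure $\nu_0\ll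 m$ on $\Delta_0$. If $|\det Df|$ is bounded on $M\setminus S$ and $\int_{\Delta_0}R^2\,dm<\infty$, then $|\det Df|>0$ holds $\mu$-almost everywhere, $\log|\det Df|$ is $\mu$-integrable, and the measure-theoretic (Kolmogorov–Sinai) entropy of $f$ with respect to $\mu$ is $$h_\mu(f)=\int_M\log|\det Df|\,d\mu<\infty .$$ -/

import Mathlib

open MeasureTheory Set Filter Topology Manifold Bundle
open scoped ENNReal NNReal ContDiff

noncomputable section

/-! ### Measure-theoretic (Kolmogorov–Sinai) entropy

A finite measurable partition of `X` is encoded by a measurable labelling `ξ : X → Fin k`, whose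
fibres are the atoms. -/

section Entropy

variable {X : Type*} [MeasurableSpace X]

/-- `H_μ(ξ) = - ∑ μ(A) log μ(A)`, the sum being over the atoms `A` of the finite partition into the
fibres of `ξ`. -/
def partitionEntropy {ι : Type*} [Fintype ι] (μ : Measure X) (ξ : X → ι) : ℝ :=
  ∑ a, Real.negMulLog (μ.real (ξ ⁻¹' {a}))

/-- The labelling of the refined partition `⋁_{i < n} f^{-i} ξ`. -/
def itinerary {ι : Type*} (f : X → X) (ξ : X → ι) (n : ℕ) : X → (Fin n → ι) :=
  fun x i => ξ (f^[i] x)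

/-- `h_μ(f, ξ) = inf_{n ≥ 1} (1/n) H_μ(⋁_{i < n} f^{-i} ξ)`. -/
def entropyOfPartition {k : ℕ} (f : X → X) (μ : Measure X) (ξ : X → Fin k) : ℝ :=
  ⨅ n : ℕ, partitionEntropy μ (itinerary f ξ (n + 1)) / ((n : ℝ) + 1)

/-- `h_μ(f)`: the supremum of `h_μ(f, ξ)` over all finite measurable partitions `ξ`. -/
def measureEntropy (f : X → X) (μ : Measure X) : EReal :=
  ⨆ (k : ℕ) (ξ : X → Fin k) (_ : Measurable ξ), (entropyOfPartition f μ ξ : EReal)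

/-- An SRB measure (relative to the reference measure `m`): an invariant probability measure that
is absolutely continuous with respect to `m`. -/
structure IsSRBMeasure (m : Measure X) (f : X → X) (μ : Measure X) : Prop where
  isProbabilityMeasure : IsProbabilityMeasure μ
  measurePreserving : MeasurePreserving f μ μ
  absolutelyContinuous : μ ≪ m

end Entropy

/-! ### Riemannian volume, Jacobian, piecewise `C^{1+η}` maps

The manifold may have boundary and corners; its dimension is `d`. -/

section Riemannian

variable {d : ℕ} {H : Type*} [TopologicalSpace H]
  (I : ModelWithCorners ℝ (EuclideanSpace ℝ (Fin d)) H)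
  {M : Type*} [TopologicalSpace M] [ChartedSpace H M]

/-- `|det Df(x)|`: the absolute value of the determinant of `Df(x) : T_x M → T_{f x} M` with respect
to orthonormal bases for the Riemannian metric. -/
def absDetDeriv [RiemannianBundle (fun x : M => TangentSpace I x)] (f : M → M) (x : M) : ℝ :=
  haveI : FiniteDimensional ℝ (TangentSpace I x) :=
    inferInstanceAs (FiniteDimensional ℝ (EuclideanSpace ℝ (Fin d)))
  LinearMap.normDet (mfderiv I I f x).toLinearMap

/-- The density `√det(g_ij)` of the Riemannian volume in the chart at `c`, at the point `z` of the
model space: the volume factor of the derivative at `z` of the inverse chart. -/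
def chartVolumeDensity [RiemannianBundle (fun x : M => TangentSpace I x)] (c : M)
    (z : EuclideanSpace ℝ (Fin d)) : ℝ :=
  LinearMap.normDet (U := EuclideanSpace ℝ (Fin d)) (V := TangentSpace I ((extChartAt I c).symm z))
    (mfderivWithin 𝓘(ℝ, EuclideanSpace ℝ (Fin d)) I (extChartAt I c).symm (range I) z).toLinearMap

/-- The Riemannian volume restricted to the domain of the chart at `c`: the measure
`√det(g_ij) dz` on the range of the chart, carried over to `M`. -/
def chartVolume [RiemannianBundle (fun x : M => TangentSpace I x)] [MeasurableSpace M]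
    (c : M) : Measure M :=
  ((volume.restrict (extChartAt I c).target).withDensity
    (fun z => ENNReal.ofReal (chartVolumeDensity I c z))).map (extChartAt I c).symm

variable (M) in
/-- The Lebesgue (Riemannian volume) measure of `M`: the least measure dominating the chart volumes.
These agree on overlaps of chart domains, so on each chart domain it is the chart volume. -/
def riemannianVolume [RiemannianBundle (fun x : M => TangentSpace I x)] [MeasurableSpace M] :
    Measure M :=
  ⨆ c : M, chartVolume I c

/-- `f` is of class `C^{1+η}` on the open set `U`: it is `C¹` there and, near every point of `U`, its
derivative read in charts is Hölder continuous with exponent `η`. -/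
def IsC1HolderOn (η : ℝ≥0) (f : M → M) (U : Set M) : Prop :=
  ContMDiffOn I I 1 f U ∧
    ∀ x ∈ U, ∃ V ∈ 𝓝[range I] (extChartAt I x x), ∃ C : ℝ≥0,
      HolderOnWith C η (fderivWithin ℝ (writtenInExtChartAt I I x f) (range I)) V

/-- The singular set: the complement of the union of the smoothness regions. -/
def singularSet {M : Type*} (N : ℕ → Set M) : Set M := (⋃ i, N i)ᶜ

/-- `f` is a piecewise `C^{1+η}` map with smoothness regions `N 0, N 1, …` (some of them may be
empty, so that finitely many regions are allowed) and Lebesgue-null singular set. -/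
structure IsPiecewiseC1Holder [RiemannianBundle (fun x : M => TangentSpace I x)]
    [MeasurableSpace M] (η : ℝ≥0) (f : M → M) (N : ℕ → Set M) : Prop where
  isOpen : ∀ i, IsOpen (N i)
  disjoint : Pairwise (fun i j => Disjoint (N i) (N j))
  iUnion_closure : ⋃ i, closure (N i) = univ
  isC1HolderOn : IsC1HolderOn I η f (⋃ i, N i)
  singularSet_null : riemannianVolume I M (singularSet N) = 0

end Riemannian

/-! ### Gibbs–Markov induced maps -/

section Induced

variable {M : Type*}

open Classical in
/-- The induced map `F = f^R`, equal to `f^{R(ω)}` on each `ω ∈ P`. On the negligible set of points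
of the base in no element of `P` (and off the base) it is the identity, so that it is defined
everywhere. -/
def inducedMap (f : M → M) (P : Set (Set M)) (R : M → ℕ) (x : M) : M :=
  if x ∈ ⋃₀ P then f^[R x] x else x

/-- The partition `P_n = ⋁_{i < n} F^{-i} P`. -/
def dynPartition (F : M → M) (P : Set (Set M)) (n : ℕ) : Set (Set M) :=
  {A | ∃ w : ℕ → Set M, (∀ i, w i ∈ P) ∧ A = {x | ∀ i < n, F^[i] x ∈ w i}}

/-- The partition `P_∞ = ⋁_{i ≥ 0} F^{-i} P`. -/
def dynPartitionInfty (F : M → M) (P : Set (Set M)) : Set (Set M) :=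
  {A | ∃ w : ℕ → Set M, (∀ i, w i ∈ P) ∧ A = {x | ∀ i, F^[i] x ∈ w i}}

/-- The separation time: the least `n ≥ 0` such that `F^n x` and `F^n y` lie in distinct elements of
`P`, and zero if there is none. -/
def separationTime (F : M → M) (P : Set (Set M)) (x y : M) : ℕ :=
  sInf {n | ∃ w ∈ P, ∃ w' ∈ P, w ≠ w' ∧ F^[n] x ∈ w ∧ F^[n] y ∈ w'}

/-- The data of an induced map for `f` with base `Δ₀`, countable `m` mod 0 partition `P` of `Δ₀` and
recurrence time `R` (only the values of `R` on `Δ₀` matter); `S` is the singular set of `f`. -/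
structure IsInducingScheme [TopologicalSpace M] [MeasurableSpace M] (m : Measure M) (f : M → M)
    (S Δ₀ : Set M) (P : Set (Set M)) (R : M → ℕ) : Prop where
  measurableSet_base : MeasurableSet Δ₀
  base_subset : Δ₀ ⊆ Sᶜ
  base_pos : 0 < m Δ₀
  countable : P.Countable
  relOpen : ∀ w ∈ P, ∃ U, IsOpen U ∧ w = Δ₀ ∩ U
  disjoint : P.PairwiseDisjoint id
  cover : m (Δ₀ \ ⋃₀ P) = 0
  time_pos : ∀ x ∈ Δ₀, 1 ≤ R x
  time_const : ∀ w ∈ P, ∀ x ∈ w, ∀ y ∈ w, R x = R y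
  avoids : ∀ w ∈ P, ∀ x ∈ w, ∀ j, 1 ≤ j → j ≤ R x → f^[j] x ∉ S
  returns : ∀ w ∈ P, ∀ x ∈ w, f^[R x] x ∈ Δ₀

/-- The map `F : Δ₀ → Δ₀` is Gibbs–Markov with respect to the measure `m` and the partition `P`. -/
structure IsGibbsMarkov [MeasurableSpace M] (m : Measure M) (F : M → M) (Δ₀ : Set M)
    (P : Set (Set M)) : Prop where
  /-- `F` maps each `ω ∈ P` bijectively to `Δ₀`, mod 0. -/
  markov : ∀ w ∈ P, ∃ A ⊆ w, MeasurableSet A ∧ m (w \ A) = 0 ∧ InjOn F A ∧ m (Δ₀ \ F '' A) = 0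
  /-- `P_1, P_2, …` generate the Borel `σ`-algebra of `Δ₀`, mod 0. -/
  generating :
    (∀ B ⊆ Δ₀, MeasurableSet B →
      ∃ B', MeasurableSet[MeasurableSpace.generateFrom (⋃ n ≥ 1, dynPartition F P n)] B' ∧
        B =ᵐ[m.restrict Δ₀] B') ∧
    (∀ B', MeasurableSet[MeasurableSpace.generateFrom (⋃ n ≥ 1, dynPartition F P n)] B' →
      ∃ B ⊆ Δ₀, MeasurableSet B ∧ B =ᵐ[m.restrict Δ₀] B')
  /-- `P_∞` is the partition into single points of `Δ₀`, mod 0. -/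
  separating : ∃ Z, m (Δ₀ \ Z) = 0 ∧ ∀ A ∈ dynPartitionInfty F P, (A ∩ Z).Subsingleton
  /-- `F` has a positive measurable Jacobian `J`, and `J` satisfies the Gibbs property. -/
  exists_jacobian : ∃ J : M → ℝ, Measurable J ∧ (∀ x ∈ Δ₀, 0 < J x) ∧
    (∀ w ∈ P, ∀ A ⊆ w, MeasurableSet A → m (F '' A) = ∫⁻ x in A, ENNReal.ofReal (J x) ∂m) ∧
    ∃ C > 0, ∃ β : ℝ, 0 < β ∧ β < 1 ∧ ∀ w ∈ P, ∀ x ∈ w, ∀ y ∈ w,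
      Real.log (J x / J y) ≤ C * β ^ separationTime F P (F x) (F y)

/-- The measure `(∑_j ν₀{R > j})⁻¹ ∑_j f^j_*(ν₀|{R > j})`. -/
def spreadMeasure [MeasurableSpace M] (f : M → M) (Δ₀ : Set M) (R : M → ℕ) (ν₀ : Measure M) :
    Measure M :=
  (∑' j : ℕ, ν₀ {x ∈ Δ₀ | j < R x})⁻¹ •
    Measure.sum (fun j : ℕ => (ν₀.restrict {x ∈ Δ₀ | j < R x}).map f^[j])

/-- The measure `μ` is an ergodic SRB measure for `f` given by the Gibbs–Markov induced map `f^R`: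
`f^R` is a Gibbs–Markov induced map with integrable recurrence times and `μ` is obtained by
spreading out an ergodic SRB measure `ν₀` of `f^R`. -/
structure IsErgodicSRBGivenBy [TopologicalSpace M] [MeasurableSpace M] (m : Measure M) (f : M → M)
    (S Δ₀ : Set M) (P : Set (Set M)) (R : M → ℕ) (μ : Measure M) : Prop where
  scheme : IsInducingScheme m f S Δ₀ P R
  gibbsMarkov : IsGibbsMarkov m (inducedMap f P R) Δ₀ P
  integrable_time : ∫⁻ x in Δ₀, (R x : ℝ≥0∞) ∂m < ⊤
  isSRB : IsSRBMeasure m f μ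
  ergodic : Ergodic f μ
  exists_base : ∃ ν₀ : Measure M, IsSRBMeasure (m.restrict Δ₀) (inducedMap f P R) ν₀ ∧
    Ergodic (inducedMap f P R) ν₀ ∧ μ = spreadMeasure f Δ₀ R ν₀

end Induced

end

/-! By Rokhlin's formula one expects `h_μ(f) = ∫ log |det Df| dμ` for an absolutely continuous `μ`.

Lower bound: cut the set where `|det Df| > 0` into countably many pieces on which `f` is injective.
The conditional probability `g (f x)` of the piece containing `x`, given `f x`, is found by the
change of variables formula: `-log g (f x) = log |det Df x| + u (f x) - u x` with `u = log (dμ/dm)`.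
The coboundary on the right has integral zero, and the conditional entropies of the finite
partitions made of the first pieces increase to the integral of the left side.

Upper bound: `(f, μ)` is a factor of the tower over `F = f^R`, whose label sequences under `P`
generate. By bounded distortion and full branches, `m` gives a cylinder of length `n` of `F` mass at
least `e^{-K} / ∏_{i < n} J_F ∘ F^i`. Averaging the delayed images of `m` over the entrance times
`t ≤ N` yields reference measures on label sequences whose weight on an `N`-cylinder of the tower is
the analogous quantity, up to a factor `N + 1`. By Gibbs' inequality the entropy is at most the mean
of the logarithmic Jacobian, which is `log |det Df|` summed along the tower. Both bounds need
`log |det Df|` to be integrable: it is bounded above, and its sum along an excursion is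
`log J_F ≥ -K`. -/

/-! ### Jacobians -/

section Jacobian

variable {X : Type*} [MeasurableSpace X] {m : Measure X} {f : X → X} {D D' : X → ℝ} {U A : Set X}

/-- `D` is a Jacobian of `f` with respect to `m` on `U`: the change of variables formula holds on
the measurable subsets of `U` on which `f` is injective. Negative values of `D` count as zero. -/
structure IsJacobianOn (m : Measure X) (f : X → X) (D : X → ℝ) (U : Set X) : Prop where
  measurableSet_image : ∀ A ⊆ U, MeasurableSet A → InjOn f A → MeasurableSet (f '' A)
  measure_image : ∀ A ⊆ U, MeasurableSet A → InjOn f A →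
    m (f '' A) = ∫⁻ x in A, ENNReal.ofReal (D x) ∂m
  aemeasurable : AEMeasurable D (m.restrict U)

namespace IsJacobianOn

lemma congr_ae (hJ : IsJacobianOn m f D U) (h : D =ᵐ[m.restrict U] D') :
    IsJacobianOn m f D' U where
  measurableSet_image := hJ.measurableSet_image
  measure_image A hAU hA hinj := by
    rw [hJ.measure_image A hAU hA hinj]
    refine lintegral_congr_ae ?_
    filter_upwards [ae_restrict_of_ae_restrict_of_subset hAU h] with x hx using by rw [hx]
  aemeasurable := hJ.aemeasurable.congr h

lemma measurableEmbedding_domRestrict (hJ : IsJacobianOn m f D U) (hf : Measurable f) (hAU : A ⊆ U)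
    (hA : MeasurableSet A) (hinj : InjOn f A) : MeasurableEmbedding (A.domRestrict f) where
  injective := injOn_iff_injective.1 hinj
  measurable := hf.comp measurable_subtype_coe
  measurableSet_image' B hB := by
    have hBA : (↑) '' B ⊆ A := Subtype.coe_image_subset A B
    have := hJ.measurableSet_image _ (hBA.trans hAU)
      ((MeasurableEmbedding.subtype_coe hA).measurableSet_image' hB) (hinj.mono hBA)
    rwa [← image_comp] at this

lemma map_restrict_withDensity (hJ : IsJacobianOn m f D U) (hf : Measurable f) (hAU : A ⊆ U)
    (hA : MeasurableSet A) (hinj : InjOn f A) :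
    ((m.withDensity fun x => ENNReal.ofReal (D x)).comap (↑)).map (A.domRestrict f) =
      m.restrict (f '' A) := by
  ext B hB
  have hAB : MeasurableSet (A ∩ f ⁻¹' B) := hA.inter (hf hB)
  have hpre : (↑) '' (A.domRestrict f ⁻¹' B) = A ∩ f ⁻¹' B := by
    rw [domRestrict_eq, preimage_comp, Subtype.image_preimage_coe]
  rw [(hJ.measurableEmbedding_domRestrict hf hAU hA hinj).map_apply, Measure.restrict_apply hB,
    inter_comm, ← image_inter_preimage,
    hJ.measure_image _ (inter_subset_left.trans hAU) hAB (hinj.mono inter_subset_left),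
    (MeasurableEmbedding.subtype_coe hA).comap_apply, hpre, withDensity_apply _ hAB]

lemma setLIntegral_image (hJ : IsJacobianOn m f D U) (hf : Measurable f) (hAU : A ⊆ U)
    (hA : MeasurableSet A) (hinj : InjOn f A) (G : X → ℝ≥0∞) :
    ∫⁻ y in f '' A, G y ∂m = ∫⁻ x in A, ENNReal.ofReal (D x) * G (f x) ∂m := by
  have hD : AEMeasurable (fun x => ENNReal.ofReal (D x)) (m.restrict A) :=
    (hJ.aemeasurable.mono_measure (Measure.restrict_mono hAU le_rfl)).ennreal_ofReal
  rw [← hJ.map_restrict_withDensity hf hAU hA hinj,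
    (hJ.measurableEmbedding_domRestrict hf hAU hA hinj).lintegral_map]
  simp only [domRestrict_apply]
  rw [lintegral_subtype_comap hA (fun x => G (f x)),
    setLIntegral_withDensity_eq_setLIntegral_mul_non_measurable₀ _ hD _ hA (by simp)]
  rfl

lemma measure_image_iterate (hJ : IsJacobianOn m f D U) (hf : Measurable f) (r : ℕ)
    (hA : MeasurableSet A) (hAU : ∀ x ∈ A, ∀ j < r, f^[j] x ∈ U) (hinj : InjOn f^[r] A) :
    m (f^[r] '' A) = ∫⁻ x in A, ∏ j ∈ Finset.range r, ENNReal.ofReal (D (f^[j] x)) ∂m := by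
  induction r generalizing A with
  | zero => simp
  | succ r ih =>
    rw [Function.iterate_succ] at hinj ⊢
    have hinj_f : InjOn f A := hinj.of_comp
    have hAU₀ : A ⊆ U := fun x hx => hAU x hx 0 r.succ_pos
    have hstay : ∀ y ∈ f '' A, ∀ j < r, f^[j] y ∈ U :=
      forall_mem_image.2 fun x hx j hj => hAU x hx (j + 1) (Nat.succ_lt_succ hj)
    rw [image_comp, ih (hJ.measurableSet_image A hAU₀ hA hinj_f) hstay hinj.image_of_comp,
      hJ.setLIntegral_image hf hAU₀ hA hinj_f]
    simp_rw [Finset.prod_range_succ', Function.iterate_succ_apply, Function.iterate_zero_apply,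
      mul_comm]

lemma ae_eq_prod_iterate [SigmaFinite m] (h : IsJacobianOn m f D U) (hf : Measurable f)
    (hD : Measurable D) (r : ℕ) (hA : MeasurableSet A) (hAU : ∀ x ∈ A, ∀ j < r, f^[j] x ∈ U)
    (hinj : InjOn f^[r] A) {j : X → ℝ≥0∞} (hj : Measurable j)
    (himage : ∀ B ⊆ A, MeasurableSet B → m (f^[r] '' B) = ∫⁻ x in B, j x ∂m) :
    j =ᵐ[m.restrict A] fun x => ∏ i ∈ Finset.range r, ENNReal.ofReal (D (f^[i] x)) := by
  have hprod : Measurable fun x => ∏ i ∈ Finset.range r, ENNReal.ofReal (D (f^[i] x)) :=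
    Finset.measurable_fun_prod _ fun i _ => (hD.comp (hf.iterate i)).ennreal_ofReal
  refine ae_eq_of_forall_setLIntegral_eq_of_sigmaFinite hj hprod fun s hs _ => ?_
  rw [Measure.restrict_restrict hs, ← himage _ inter_subset_right (hs.inter hA),
    h.measure_image_iterate hf r (hs.inter hA) (fun x hx => hAU x hx.2)
      (hinj.mono inter_subset_right)]

end IsJacobianOn

end Jacobian

section InjectiveCover

variable {E : Type*} [NormedAddCommGroup E] [NormedSpace ℝ E] [FiniteDimensional ℝ E]

lemma exists_approximatesLinearOn_injOn (L : E →L[ℝ] E) (hL : L.det ≠ 0) :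
    ∃ c : ℝ≥0, c ≠ 0 ∧ ∀ (f : E → E) (s : Set E), ApproximatesLinearOn f L s c → InjOn f s := by
  let e := L.toContinuousLinearEquivOfDetNeZero hL
  have he : (e : E →L[ℝ] E) = L := L.coe_toContinuousLinearEquivOfDetNeZero hL
  rcases subsingleton_or_nontrivial E with hE | hE
  · exact ⟨1, one_ne_zero, fun f s _ => (subsingleton_of_subsingleton (s := s)).injOn f⟩
  · have hpos : 0 < ‖(e.symm : E →L[ℝ] E)‖₊⁻¹ := inv_pos.2 e.nnnorm_symm_pos
    refine ⟨‖(e.symm : E →L[ℝ] E)‖₊⁻¹ / 2, (half_pos hpos).ne', fun f s hfs => ?_⟩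
    rw [← he] at hfs
    exact hfs.injOn (Or.inr (NNReal.half_lt_self hpos.ne'))

lemma exists_seq_cover_injOn_of_det_ne_zero [MeasurableSpace E] [BorelSpace E] {f : E → E}
    {f' : E → E →L[ℝ] E} {s : Set E}
    (hf : ∀ x ∈ s, HasFDerivWithinAt f (f' x) s x) (hdet : ∀ x ∈ s, (f' x).det ≠ 0) :
    ∃ t : ℕ → Set E, (∀ n, MeasurableSet (t n)) ∧ s ⊆ ⋃ n, t n ∧
      ∀ n, InjOn f (s ∩ t n) := by
  have hradius : ∀ L : E →L[ℝ] E, ∃ c : ℝ≥0, c ≠ 0 ∧ (L.det ≠ 0 →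
      ∀ u : Set E, ApproximatesLinearOn f L u c → InjOn f u) := fun L => by
    by_cases hL : L.det = 0
    · exact ⟨1, one_ne_zero, fun h => absurd hL h⟩
    · obtain ⟨c, hc, hinj⟩ := exists_approximatesLinearOn_injOn L hL
      exact ⟨c, hc, fun _ => hinj f⟩
  choose r hr hinj using hradius
  obtain ⟨t, L, -, ht, hcover, happrox, hL⟩ :=
    exists_partition_approximatesLinearOn_of_hasFDerivWithinAt f s f' hf r hr
  refine ⟨t, ht, hcover, fun n => ?_⟩
  rcases s.eq_empty_or_nonempty with rfl | hs
  · simp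
  · obtain ⟨x, hx, hLx⟩ := hL hs n
    exact hinj (L n) (hLx ▸ hdet x hx) _ (happrox n)

end InjectiveCover

/-! ### The Riemannian volume in charts -/

section Charts

variable {d : ℕ} {H : Type*} [TopologicalSpace H]
  (I : ModelWithCorners ℝ (EuclideanSpace ℝ (Fin d)) H)
  {M : Type*} [TopologicalSpace M] [ChartedSpace H M]

local notation "𝔼" => EuclideanSpace ℝ (Fin d)

/-- The image of `A` under the chart at `c`, as a subset of the model space. -/
noncomputable def chartImage (c : M) (A : Set M) : Set 𝔼 :=
  (extChartAt I c).target ∩ (extChartAt I c).symm ⁻¹' A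

/-- The inverse of the chart at `c` as a map on the range of the chart, so that it can be a
measurable embedding. -/
noncomputable def chartParam (c : M) : (extChartAt I c).target → M :=
  (extChartAt I c).target.domRestrict (extChartAt I c).symm

/-- The expression of `f` in the charts at `c` and `c'`. -/
noncomputable def chartRep (f : M → M) (c c' : M) : 𝔼 → 𝔼 :=
  fun z => extChartAt I c' (f ((extChartAt I c).symm z))

/-- The derivative at `z` of the inverse of the chart at `c`. Its values are tangent vectors at
`(extChartAt I c).symm z`; they are typed in the model space, to which every tangent space
unfolds, so that base points can be rewritten. -/
noncomputable def chartFrame (c : M) (z : 𝔼) : 𝔼 →L[ℝ] 𝔼 :=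
  mfderivWithin 𝓘(ℝ, 𝔼) I (extChartAt I c).symm (range I) z

variable {f : M → M} {c c' : M} {A : Set M}
  {z : EuclideanSpace ℝ (Fin d)}

lemma chartImage_subset_range : chartImage I c A ⊆ range I :=
  inter_subset_left.trans (extChartAt_target_subset_range c)

lemma source_inter_preimage_chartImage (hA : A ⊆ (extChartAt I c).source) :
    (extChartAt I c).source ∩ extChartAt I c ⁻¹' chartImage I c A = A := by
  rw [chartImage, PartialEquiv.source_inter_preimage_target_inter,
    PartialEquiv.source_inter_preimage_inv_preimage, inter_eq_right.2 hA]

lemma chartRep_image (hA : A ⊆ (extChartAt I c).source)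
    (hfA : MapsTo f A (extChartAt I c').source) :
    chartRep I f c c' '' chartImage I c A = chartImage I c' (f '' A) := by
  have hchart : ∀ B : Set M, B ⊆ (extChartAt I c').source →
      extChartAt I c' '' B = chartImage I c' B := fun B hB => by
    rw [PartialEquiv.image_eq_target_inter_inv_preimage _ hB]; rfl
  have hparam : (extChartAt I c).symm '' chartImage I c A = A := by
    have hsub : chartImage I c A ⊆ (extChartAt I c).target := inter_subset_left
    rw [PartialEquiv.symm_image_eq_source_inter_preimage _ hsub,
      source_inter_preimage_chartImage I hA]
  rw [← hchart _ hfA.image_subset]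
  nth_rw 2 [← hparam]
  rw [image_image, image_image]
  rfl

lemma injOn_chartRep (hfA : MapsTo f A (extChartAt I c').source) (hinj : InjOn f A) :
    InjOn (chartRep I f c c') (chartImage I c A) := fun _ hz _ hw hzw =>
  (extChartAt I c).symm.injOn hz.1 hw.1
    (hinj hz.2 hw.2 ((extChartAt I c').injOn (hfA hz.2) (hfA hw.2) hzw))

lemma injOn_of_injOn_chartRep (hA : A ⊆ (extChartAt I c).source)
    (hinj : InjOn (chartRep I f c c') (extChartAt I c '' A)) : InjOn f A := by
  intro x hx y hy hxy
  refine (extChartAt I c).injOn (hA hx) (hA hy)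
    (hinj (mem_image_of_mem _ hx) (mem_image_of_mem _ hy) ?_)
  simp only [chartRep, (extChartAt I c).left_inv (hA hx), (extChartAt I c).left_inv (hA hy), hxy]

section Derivative

variable [IsManifold I 1 M]

lemma isInvertible_chartFrame (hz : z ∈ (extChartAt I c).target) :
    (chartFrame I c z).IsInvertible :=
  isInvertible_mfderivWithin_extChartAt_symm hz

lemma hasFDerivWithinAt_chartRep (hz : z ∈ (extChartAt I c).target)
    (hfz : f ((extChartAt I c).symm z) ∈ (extChartAt I c').source)
    (hf : MDifferentiableAt I I f ((extChartAt I c).symm z)) :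
    HasFDerivWithinAt (chartRep I f c c') (fderivWithin ℝ (chartRep I f c c') (range I) z)
      (range I) z := by
  have hchart : MDifferentiableAt I 𝓘(ℝ, 𝔼) (extChartAt I c') (f ((extChartAt I c).symm z)) :=
    mdifferentiableAt_extChartAt (by rwa [extChartAt_source] at hfz)
  exact (mdifferentiableWithinAt_iff_differentiableWithinAt.1 ((hchart.comp _ hf
    ).comp_mdifferentiableWithinAt z (mdifferentiableWithinAt_extChartAt_symm hz))
    ).hasFDerivWithinAt

lemma hasFDerivWithinAt_chartRep_chartImage (hfA : MapsTo f A (extChartAt I c').source)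
    (hd : ∀ x ∈ A, MDifferentiableAt I I f x) (hz : z ∈ chartImage I c A) :
    HasFDerivWithinAt (chartRep I f c c') (fderivWithin ℝ (chartRep I f c c') (range I) z)
      (chartImage I c A) z :=
  (hasFDerivWithinAt_chartRep I hz.1 (hfA hz.2) (hd _ hz.2)).mono (chartImage_subset_range I)

lemma chartRep_eventuallyEq (hz : z ∈ (extChartAt I c).target)
    (hfz : f ((extChartAt I c).symm z) ∈ (extChartAt I c').source)
    (hf : ContinuousAt f ((extChartAt I c).symm z)) :
    (extChartAt I c').symm ∘ chartRep I f c c' =ᶠ[𝓝[range I] z] f ∘ (extChartAt I c).symm := by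
  have hcont : ContinuousWithinAt (f ∘ (extChartAt I c).symm) (range I) z :=
    hf.comp_continuousWithinAt
      (mdifferentiableWithinAt_extChartAt_symm (I := I) hz).continuousWithinAt
  filter_upwards [hcont.preimage_mem_nhdsWithin ((isOpen_extChartAt_source c').mem_nhds hfz)]
    with w hw using (extChartAt I c').left_inv hw

lemma chartFrame_comp_fderivWithin_chartRep (hz : z ∈ (extChartAt I c).target)
    (hfz : f ((extChartAt I c).symm z) ∈ (extChartAt I c').source)
    (hf : MDifferentiableAt I I f ((extChartAt I c).symm z)) :
    (chartFrame I c' (chartRep I f c c' z)).comp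
        (fderivWithin ℝ (chartRep I f c c') (range I) z) =
      (mfderiv I I f ((extChartAt I c).symm z) : 𝔼 →L[ℝ] 𝔼).comp (chartFrame I c z) := by
  have hzr : z ∈ range I := extChartAt_target_subset_range c hz
  have huniq : UniqueMDiffWithinAt 𝓘(ℝ, 𝔼) (range I) z :=
    (I.uniqueDiffOn z hzr).uniqueMDiffWithinAt
  have hmaps : MapsTo (chartRep I f c c') (range I) (range I) := fun w _ => by
    simp [chartRep, extChartAt]
  have hchart : mfderivWithin 𝓘(ℝ, 𝔼) I ((extChartAt I c').symm ∘ chartRep I f c c') (range I) z =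
      (chartFrame I c' (chartRep I f c c' z)).comp
        (mfderivWithin 𝓘(ℝ, 𝔼) 𝓘(ℝ, 𝔼) (chartRep I f c c') (range I) z) :=
    mfderivWithin_comp z
      (mdifferentiableWithinAt_extChartAt_symm ((extChartAt I c').map_source hfz))
      (hasFDerivWithinAt_chartRep I hz hfz hf).differentiableWithinAt.mdifferentiableWithinAt
      hmaps huniq
  have hmap : mfderivWithin 𝓘(ℝ, 𝔼) I (f ∘ (extChartAt I c).symm) (range I) z =
      (mfderiv I I f ((extChartAt I c).symm z)).comp (chartFrame I c z) :=
    mfderiv_comp_mfderivWithin z hf (mdifferentiableWithinAt_extChartAt_symm hz) huniq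
  have hev := chartRep_eventuallyEq I hz hfz hf.continuousAt
  rw [← mfderivWithin_eq_fderivWithin]
  exact hchart.symm.trans ((hev.mfderivWithin_eq (hev.eq_of_nhdsWithin hzr)).trans hmap)

lemma continuousOn_totalSpaceMk_chartFrame (c : M) (v : 𝔼) :
    ContinuousOn (fun z => (TotalSpace.mk' 𝔼 ((extChartAt I c).symm z) (chartFrame I c z v) :
      TotalSpace 𝔼 (TangentSpace I : M → Type _))) (extChartAt I c).target := by
  let e := trivializationAt 𝔼 (TangentSpace I) c
  have hsource : ∀ z ∈ (extChartAt I c).target, (extChartAt I c).symm z ∈ (chartAt H c).source :=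
    fun z hz => by simpa only [extChartAt_source] using (extChartAt I c).map_target hz
  have hconst : ContinuousOn (fun z => TotalSpace.mk' 𝔼 ((extChartAt I c).symm z)
      (e.symm ((extChartAt I c).symm z) v)) (extChartAt I c).target :=
    e.continuousOn_symm.comp ((continuousOn_extChartAt_symm c).prodMk continuousOn_const)
      fun z hz => ⟨by simpa [e] using hsource z hz, trivial⟩
  refine hconst.congr fun z hz => ?_
  have hsymmL := TangentBundle.symmL_trivializationAt (I := I) (𝕜 := ℝ) (hsource z hz)
  rw [(extChartAt I c).right_inv hz] at hsymmL
  have hframe : chartFrame I c z v = e.symm ((extChartAt I c).symm z) v := by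
    rw [chartFrame, ← hsymmL]
    exact e.symmL_apply (R := ℝ) (by simpa [e] using hsource z hz) v
  rw [hframe]

end Derivative

section Measurability

lemma continuous_chartParam (c : M) : Continuous (chartParam I c) :=
  (continuousOn_extChartAt_symm c).domRestrict

lemma preimage_chartParam (c : M) (A : Set M) :
    chartParam I c ⁻¹' A = (↑) ⁻¹' chartImage I c A := by
  ext z
  exact (and_iff_right z.2).symm

lemma measurableSet_extChartAt_target (c : M) : MeasurableSet (extChartAt I c).target := by
  rw [extChartAt_target]
  exact (((chartAt H c).open_target.preimage I.continuous_symm).measurableSet).inter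
    I.isClosed_range.measurableSet

variable [MeasurableSpace M] [BorelSpace M]

lemma measurableSet_extChartAt_source (c : M) : MeasurableSet (extChartAt I c).source :=
  (isOpen_extChartAt_source c).measurableSet

lemma measurableSet_source_inter_preimage (c : M) {t : Set 𝔼} (ht : MeasurableSet t) :
    MeasurableSet ((extChartAt I c).source ∩ extChartAt I c ⁻¹' t) := by
  rw [← Subtype.image_preimage_coe]
  exact (measurableSet_extChartAt_source I c).subtype_image
    ((continuousOn_extChartAt c).domRestrict.measurable ht)

lemma measurableEmbedding_chartParam (c : M) : MeasurableEmbedding (chartParam I c) where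
  injective := injOn_iff_injective.1 (extChartAt I c).symm.injOn
  measurable := (continuous_chartParam I c).measurable
  measurableSet_image' B hB := by
    have himage : chartParam I c '' B =
        (extChartAt I c).source ∩ extChartAt I c ⁻¹' ((↑) '' B) := by
      rw [← PartialEquiv.symm_image_eq_source_inter_preimage _ (Subtype.coe_image_subset _ _),
        image_image]
      rfl
    rw [himage]
    exact measurableSet_source_inter_preimage I c
      ((measurableSet_extChartAt_target I c).subtype_image hB)

lemma measurableSet_chartImage (c : M) (hA : MeasurableSet A) :
    MeasurableSet (chartImage I c A) := by
  rw [chartImage, ← Subtype.image_preimage_coe]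
  exact (measurableSet_extChartAt_target I c).subtype_image
    ((continuous_chartParam I c).measurable hA)

lemma measurableSet_image_of_mdifferentiableAt [IsManifold I 1 M] (hA : MeasurableSet A)
    (hAc : A ⊆ (extChartAt I c).source) (hfA : MapsTo f A (extChartAt I c').source)
    (hd : ∀ x ∈ A, MDifferentiableAt I I f x) (hinj : InjOn f A) : MeasurableSet (f '' A) := by
  have himage := measurable_image_of_fderivWithin (measurableSet_chartImage I c hA)
    (fun _ hz => hasFDerivWithinAt_chartRep_chartImage I hfA hd hz) (injOn_chartRep I hfA hinj)
  rw [chartRep_image I hAc hfA] at himage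
  rw [← source_inter_preimage_chartImage I hfA.image_subset]
  exact measurableSet_source_inter_preimage I c' himage

lemma exists_chart_partition [SecondCountableTopology M] [Nonempty M] :
    ∃ (c : ℕ → M) (D : ℕ → Set M), (∀ n, MeasurableSet (D n)) ∧
      Pairwise (Function.onFun Disjoint D) ∧ ⋃ n, D n = univ ∧
      ∀ n, D n ⊆ (extChartAt I (c n)).source := by
  obtain ⟨t, ht, hcover⟩ := TopologicalSpace.countable_cover_nhds
    (fun x : M => extChartAt_source_mem_nhds (I := I) x)
  have hne : t.Nonempty := by
    rcases t.eq_empty_or_nonempty with rfl | h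
    · simp [empty_ne_univ] at hcover
    · exact h
  obtain ⟨c, rfl⟩ := ht.exists_eq_range hne
  rw [biUnion_range] at hcover
  exact ⟨c, disjointed fun n => (extChartAt I (c n)).source,
    MeasurableSet.disjointed fun n => measurableSet_extChartAt_source I (c n),
    disjoint_disjointed _, (iUnion_disjointed).trans hcover, disjointed_subset _⟩

lemma exists_chart_cells [SecondCountableTopology M] [Nonempty M] (hf : Measurable f)
    (hA : MeasurableSet A) :
    ∃ (c c' : ℕ → M) (B : ℕ → Set M), (∀ n, MeasurableSet (B n)) ∧
      Pairwise (Function.onFun Disjoint B) ∧ ⋃ n, B n = A ∧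
      (∀ n, B n ⊆ (extChartAt I (c n)).source) ∧
      ∀ n, MapsTo f (B n) (extChartAt I (c' n)).source := by
  obtain ⟨c, D, hD, hdisj, hcover, hsub⟩ := exists_chart_partition I (M := M)
  refine ⟨fun n => c n.unpair.1, fun n => c n.unpair.2,
    fun n => A ∩ (D n.unpair.1 ∩ f ⁻¹' D n.unpair.2),
    fun n => hA.inter ((hD _).inter (hf (hD _))), fun m n hmn => ?_, ?_,
    fun n x hx => hsub _ hx.2.1, fun n x hx => hsub _ hx.2.2⟩
  · refine disjoint_left.2 fun x hx hx' => hmn (Nat.pairEquiv.symm.injective (Prod.ext ?_ ?_))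
    · exact hdisj.eq (not_disjoint_iff.2 ⟨x, hx.2.1, hx'.2.1⟩)
    · exact hdisj.eq (not_disjoint_iff.2 ⟨f x, hx.2.2, hx'.2.2⟩)
  · rw [← inter_iUnion, inter_eq_left]
    intro x _
    obtain ⟨i, hi⟩ := mem_iUnion.1 (hcover.symm ▸ mem_univ x)
    obtain ⟨j, hj⟩ := mem_iUnion.1 (hcover.symm ▸ mem_univ (f x))
    exact mem_iUnion.2 ⟨Nat.pair i j, by simpa using ⟨hi, hj⟩⟩

end Measurability

variable [RiemannianBundle (fun x : M => TangentSpace I x)]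

/-- The factor by which `L`, seen as a map into the tangent space at `y`, scales volumes. As in
`chartFrame`, tangent vectors are typed in the model space. -/
noncomputable def fiberNormDet (y : M) (L : 𝔼 →L[ℝ] 𝔼) : ℝ :=
  LinearMap.normDet (U := 𝔼) (V := TangentSpace I y) L.toLinearMap

lemma chartVolumeDensity_eq_fiberNormDet (c : M) (z : 𝔼) :
    chartVolumeDensity I c z = fiberNormDet I ((extChartAt I c).symm z) (chartFrame I c z) :=
  rfl

lemma fiberNormDet_comp (y : M) (L A : 𝔼 →L[ℝ] 𝔼) :
    fiberNormDet I y (L.comp A) = fiberNormDet I y L * |A.det| := by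
  have hcomp := LinearMap.normDet_comp_of_finrank_eq (U := 𝔼) (V := 𝔼) (W := TangentSpace I y)
    A.toLinearMap L.toLinearMap rfl
  rwa [LinearMap.normDet_eq_abs_det] at hcomp

lemma fiberNormDet_mfderiv_comp (f : M → M) (x : M) (L : 𝔼 →L[ℝ] 𝔼) :
    fiberNormDet I (f x) ((mfderiv I I f x : 𝔼 →L[ℝ] 𝔼).comp L) =
      absDetDeriv I f x * fiberNormDet I x L :=
  have : FiniteDimensional ℝ (TangentSpace I x) := inferInstanceAs (FiniteDimensional ℝ 𝔼)
  LinearMap.normDet_comp_of_finrank_eq (U := 𝔼) (V := TangentSpace I x) (W := TangentSpace I (f x))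
    L.toLinearMap (mfderiv I I f x).toLinearMap rfl

lemma absDetDeriv_id (x : M) : absDetDeriv I (id : M → M) x = 1 := by
  have : FiniteDimensional ℝ (TangentSpace I x) := inferInstanceAs (FiniteDimensional ℝ 𝔼)
  rw [absDetDeriv, mfderiv_id]
  exact LinearMap.normDet_id (𝕜 := ℝ) (U := TangentSpace I x)

lemma absDetDeriv_nonneg (f : M → M) (x : M) : 0 ≤ absDetDeriv I f x :=
  have : FiniteDimensional ℝ (TangentSpace I x) := inferInstanceAs (FiniteDimensional ℝ 𝔼)
  LinearMap.normDet_nonneg _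

lemma chartVolumeDensity_sq (c : M) (z : 𝔼) :
    chartVolumeDensity I c z ^ 2 = (Matrix.of fun i j : Fin d =>
      inner (E := TangentSpace I ((extChartAt I c).symm z)) ℝ
        (chartFrame I c z (EuclideanSpace.basisFun (Fin d) ℝ i))
        (chartFrame I c z (EuclideanSpace.basisFun (Fin d) ℝ j))).det :=
  LinearMap.normDet_sq_eq_det_gram (U := 𝔼) (V := TangentSpace I ((extChartAt I c).symm z))
    (chartFrame I c z).toLinearMap (EuclideanSpace.basisFun (Fin d) ℝ)

section Density

variable [IsManifold I 1 M]

lemma chartVolumeDensity_chartRep (hz : z ∈ (extChartAt I c).target)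
    (hfz : f ((extChartAt I c).symm z) ∈ (extChartAt I c').source)
    (hf : MDifferentiableAt I I f ((extChartAt I c).symm z)) :
    chartVolumeDensity I c' (chartRep I f c c' z) *
        |(fderivWithin ℝ (chartRep I f c c') (range I) z).det| =
      absDetDeriv I f ((extChartAt I c).symm z) * chartVolumeDensity I c z := by
  have hbase : (extChartAt I c').symm (chartRep I f c c' z) = f ((extChartAt I c).symm z) :=
    (extChartAt I c').left_inv hfz
  rw [chartVolumeDensity_eq_fiberNormDet, chartVolumeDensity_eq_fiberNormDet, hbase,
    ← fiberNormDet_comp, ← fiberNormDet_mfderiv_comp,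
    chartFrame_comp_fderivWithin_chartRep I hz hfz hf]

lemma chartVolumeDensity_pos (hz : z ∈ (extChartAt I c).target) :
    0 < chartVolumeDensity I c z := by
  obtain ⟨e, he⟩ := isInvertible_chartFrame I hz
  refine (LinearMap.normDet_nonneg _).lt_of_ne' fun h0 => ?_
  refine (LinearMap.normDet_eq_zero_iff_ker_ne_bot (U := 𝔼)
    (V := TangentSpace I ((extChartAt I c).symm z))).1 h0 (LinearMap.ker_eq_bot.2 ?_)
  intro a b (hab : chartFrame I c z a = chartFrame I c z b)
  exact e.injective (by rwa [← he] at hab)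

lemma det_fderivWithin_chartRep_ne_zero (hz : z ∈ (extChartAt I c).target)
    (hfz : f ((extChartAt I c).symm z) ∈ (extChartAt I c').source)
    (hf : MDifferentiableAt I I f ((extChartAt I c).symm z))
    (hpos : 0 < absDetDeriv I f ((extChartAt I c).symm z)) :
    (fderivWithin ℝ (chartRep I f c c') (range I) z).det ≠ 0 := by
  intro h0
  have htransform := chartVolumeDensity_chartRep I hz hfz hf
  rw [h0, abs_zero, mul_zero] at htransform
  exact (mul_pos hpos (chartVolumeDensity_pos I hz)).ne htransform

variable [IsContinuousRiemannianBundle (EuclideanSpace ℝ (Fin d))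
  (fun x : M => TangentSpace I x)]

lemma continuousOn_chartVolumeDensity (c : M) :
    ContinuousOn (chartVolumeDensity I c) (extChartAt I c).target := by
  have hsq : ContinuousOn (fun z => chartVolumeDensity I c z ^ 2) (extChartAt I c).target := by
    simp only [chartVolumeDensity_sq, Matrix.det_apply, Matrix.of_apply]
    exact continuousOn_finsetSum _ fun σ _ => .const_smul (continuousOn_finsetProd _ fun i _ =>
      (continuousOn_totalSpaceMk_chartFrame I c _).inner_bundle
        (continuousOn_totalSpaceMk_chartFrame I c _)) _
  exact hsq.sqrt.congr fun z hz => (Real.sqrt_sq (chartVolumeDensity_pos I hz).le).symm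

end Density

section ChartVolume

variable [MeasurableSpace M] [BorelSpace M]

lemma chartVolume_eq_map (c : M) :
    chartVolume I c = ((volume.withDensity fun z =>
      ENNReal.ofReal (chartVolumeDensity I c z)).comap (↑)).map (chartParam I c) := by
  have ht := measurableSet_extChartAt_target I c
  have hsymm : AEMeasurable (extChartAt I c).symm ((volume.withDensity fun z =>
      ENNReal.ofReal (chartVolumeDensity I c z)).restrict (extChartAt I c).target) := by
    rw [restrict_withDensity ht]
    exact ((continuousOn_extChartAt_symm c).aemeasurable ht).mono_ac
      (withDensity_absolutelyContinuous _ _)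
  rw [chartVolume, ← restrict_withDensity ht, ← map_comap_subtype_coe ht] at *
  exact AEMeasurable.map_map_of_aemeasurable hsymm measurable_subtype_coe.aemeasurable

lemma aemeasurable_restrict_chartVolume {β : Type*} [MeasurableSpace β] {g : M → β}
    (hg : AEMeasurable (g ∘ (extChartAt I c).symm) (volume.restrict (chartImage I c A))) :
    AEMeasurable g ((chartVolume I c).restrict A) := by
  have hparam := measurableEmbedding_chartParam I c
  have hval := MeasurableEmbedding.subtype_coe (measurableSet_extChartAt_target I c)
  rw [chartVolume_eq_map, hparam.restrict_map, hparam.aemeasurable_map_iff, preimage_chartParam]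
  refine AEMeasurable.comp_measurable (g := g ∘ (extChartAt I c).symm) ?_ measurable_subtype_coe
  rw [← hval.restrict_map, hval.map_comap]
  refine (hg.mono_ac ?_).mono_measure (Measure.restrict_mono_measure Measure.restrict_le_self _)
  exact (withDensity_absolutelyContinuous _ _).restrict _

variable [IsManifold I 1 M] [IsContinuousRiemannianBundle (EuclideanSpace ℝ (Fin d))
  (fun x : M => TangentSpace I x)]

lemma setLIntegral_chartVolume (c : M) (hA : MeasurableSet A) (g : M → ℝ≥0∞) :
    ∫⁻ x in A, g x ∂chartVolume I c =
      ∫⁻ z in chartImage I c A,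
        ENNReal.ofReal (chartVolumeDensity I c z) * g ((extChartAt I c).symm z) := by
  have hparam := measurableEmbedding_chartParam I c
  have hval := MeasurableEmbedding.subtype_coe (measurableSet_extChartAt_target I c)
  have hdensity : AEMeasurable (fun z => ENNReal.ofReal (chartVolumeDensity I c z))
      (volume.restrict (chartImage I c A)) :=
    (((continuousOn_chartVolumeDensity I c).mono inter_subset_left).aemeasurable
      (measurableSet_chartImage I c hA)).ennreal_ofReal
  rw [chartVolume_eq_map, hparam.restrict_map, hparam.lintegral_map, preimage_chartParam]
  change ∫⁻ a : (extChartAt I c).target, (g ∘ (extChartAt I c).symm) a ∂Measure.restrict _ _ = _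
  rw [← hval.lintegral_map, ← hval.restrict_map, hval.map_comap, Subtype.range_coe,
    Measure.restrict_restrict (measurableSet_chartImage I c hA),
    inter_eq_left.2 (show chartImage I c A ⊆ (extChartAt I c).target from inter_subset_left)]
  exact setLIntegral_withDensity_eq_setLIntegral_mul_non_measurable₀ _ hdensity _
    (measurableSet_chartImage I c hA) (by simp)

lemma chartVolume_apply (c : M) (hA : MeasurableSet A) :
    chartVolume I c A = ∫⁻ z in chartImage I c A, ENNReal.ofReal (chartVolumeDensity I c z) := by
  simpa using setLIntegral_chartVolume I c hA 1

lemma chartVolume_compl_source (c : M) : chartVolume I c (extChartAt I c).sourceᶜ = 0 := by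
  have hempty : chartImage I c (extChartAt I c).sourceᶜ = ∅ :=
    eq_empty_of_forall_notMem fun z hz => hz.2 ((extChartAt I c).map_target hz.1)
  rw [chartVolume_apply I c (measurableSet_extChartAt_source I c).compl, hempty,
    setLIntegral_empty]

lemma chartVolume_image (hA : MeasurableSet A) (hAc : A ⊆ (extChartAt I c).source)
    (hfA : MapsTo f A (extChartAt I c').source) (hd : ∀ x ∈ A, MDifferentiableAt I I f x)
    (hinj : InjOn f A) :
    chartVolume I c' (f '' A) = ∫⁻ x in A, ENNReal.ofReal (absDetDeriv I f x) ∂chartVolume I c := by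
  have hs := measurableSet_chartImage I c hA
  rw [chartVolume_apply I c' (measurableSet_image_of_mdifferentiableAt I hA hAc hfA hd hinj),
    ← chartRep_image I hAc hfA, lintegral_image_eq_lintegral_abs_det_fderiv_mul volume hs
      (fun _ hz => hasFDerivWithinAt_chartRep_chartImage I hfA hd hz) (injOn_chartRep I hfA hinj),
    setLIntegral_chartVolume I c hA]
  refine setLIntegral_congr_fun hs fun z hz => ?_
  rw [← ENNReal.ofReal_mul (abs_nonneg _),
    ← ENNReal.ofReal_mul (chartVolumeDensity_pos I hz.1).le, mul_comm,
    chartVolumeDensity_chartRep I hz.1 (hfA hz.2) (hd _ hz.2), mul_comm]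

lemma chartVolume_eq_of_subset (hA : MeasurableSet A) (hAc : A ⊆ (extChartAt I c).source)
    (hAc' : A ⊆ (extChartAt I c').source) : chartVolume I c' A = chartVolume I c A := by
  simpa [absDetDeriv_id] using chartVolume_image I (f := id) hA hAc hAc'
    (fun x _ => mdifferentiableAt_id) (injOn_id _)

lemma aemeasurable_absDetDeriv_chartVolume (hA : MeasurableSet A)
    (hfA : MapsTo f A (extChartAt I c').source) (hd : ∀ x ∈ A, MDifferentiableAt I I f x) :
    AEMeasurable (absDetDeriv I f) ((chartVolume I c).restrict A) := by
  have hs := measurableSet_chartImage I c hA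
  have hder := fun z hz => hasFDerivWithinAt_chartRep_chartImage I (c := c) hfA hd (z := z) hz
  have hdet : AEMeasurable (fun z => |(fderivWithin ℝ (chartRep I f c c') (range I) z).det|)
      (volume.restrict (chartImage I c A)) := by
    simpa [ENNReal.toReal_ofReal, abs_nonneg] using
      (aemeasurable_ofReal_abs_det_fderivWithin volume hs hder).ennreal_toReal
  have hsource : AEMeasurable (chartVolumeDensity I c) (volume.restrict (chartImage I c A)) :=
    ((continuousOn_chartVolumeDensity I c).mono inter_subset_left).aemeasurable hs
  have htarget : AEMeasurable (fun z => chartVolumeDensity I c' (chartRep I f c c' z))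
      (volume.restrict (chartImage I c A)) :=
    ((continuousOn_chartVolumeDensity I c').comp (fun z hz => (hder z hz).continuousWithinAt)
      fun z hz => (extChartAt I c').map_source (hfA hz.2)).aemeasurable hs
  refine aemeasurable_restrict_chartVolume I (((htarget.mul hdet).div hsource).congr ?_)
  filter_upwards [ae_restrict_mem hs] with z hz
  exact (div_eq_iff (chartVolumeDensity_pos I hz.1).ne').2
    (chartVolumeDensity_chartRep I hz.1 (hfA hz.2) (hd _ hz.2))

end ChartVolume

section RiemannianVolume

variable [MeasurableSpace M] [BorelSpace M] [IsManifold I 1 M]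

lemma exists_seq_cover_injOn_of_mapsTo_source (hA : MeasurableSet A)
    (hAc : A ⊆ (extChartAt I c).source) (hfA : MapsTo f A (extChartAt I c').source)
    (hd : ∀ x ∈ A, MDifferentiableAt I I f x) (hpos : ∀ x ∈ A, 0 < absDetDeriv I f x) :
    ∃ t : ℕ → Set M, (∀ n, MeasurableSet (t n)) ∧ ⋃ n, t n = A ∧ ∀ n, InjOn f (t n) := by
  let φ := extChartAt I c
  obtain ⟨t, ht, hcover, hinj⟩ := exists_seq_cover_injOn_of_det_ne_zero
    (fun _ hz => hasFDerivWithinAt_chartRep_chartImage I hfA hd hz)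
    (fun z hz => det_fderivWithin_chartRep_ne_zero I hz.1 (hfA hz.2) (hd _ hz.2) (hpos _ hz.2))
  have himage : ∀ x ∈ A, φ x ∈ chartImage I c A := fun x hx =>
    ⟨φ.map_source (hAc hx), by rwa [mem_preimage, φ.left_inv (hAc hx)]⟩
  refine ⟨fun n => A ∩ (φ.source ∩ φ ⁻¹' t n), fun n =>
    hA.inter (measurableSet_source_inter_preimage I c (ht n)), ?_, fun n => ?_⟩
  · rw [← inter_iUnion, ← inter_iUnion, ← preimage_iUnion]
    exact inter_eq_left.2 fun x hx => ⟨hAc hx, hcover (himage x hx)⟩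
  · refine injOn_of_injOn_chartRep I (inter_subset_left.trans hAc) ((hinj n).mono ?_)
    rintro _ ⟨x, ⟨hx, -, hxt⟩, rfl⟩
    exact ⟨himage x hx, hxt⟩

lemma exists_seq_cover_injOn_of_absDetDeriv_pos [SecondCountableTopology M] [Nonempty M]
    (hf : Measurable f) (hA : MeasurableSet A) (hd : ∀ x ∈ A, MDifferentiableAt I I f x)
    (hpos : ∀ x ∈ A, 0 < absDetDeriv I f x) :
    ∃ t : ℕ → Set M, (∀ n, MeasurableSet (t n)) ∧ ⋃ n, t n = A ∧ ∀ n, InjOn f (t n) := by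
  obtain ⟨c, c', B, hB, -, rfl, hBc, hfB⟩ := exists_chart_cells I hf hA
  have hcell : ∀ n, ∃ t : ℕ → Set M, (∀ k, MeasurableSet (t k)) ∧ ⋃ k, t k = B n ∧
      ∀ k, InjOn f (t k) := fun n =>
    exists_seq_cover_injOn_of_mapsTo_source I (hB n) (hBc n) (hfB n)
      (fun x hx => hd x (mem_iUnion_of_mem n hx)) (fun x hx => hpos x (mem_iUnion_of_mem n hx))
  choose t ht hcover hinj using hcell
  refine ⟨fun k => t k.unpair.1 k.unpair.2, fun k => ht _ _, ?_, fun k => hinj _ _⟩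
  rw [Set.iUnion_unpair t]
  exact iUnion_congr hcover

variable [IsContinuousRiemannianBundle (EuclideanSpace ℝ (Fin d))
  (fun x : M => TangentSpace I x)]

lemma riemannianVolume_le_sum {s : ℕ → M} {D : ℕ → Set M} (hD : ∀ n, MeasurableSet (D n))
    (hcover : ⋃ n, D n = univ) (hsub : ∀ n, D n ⊆ (extChartAt I (s n)).source) :
    riemannianVolume I M ≤ Measure.sum fun n => (chartVolume I (s n)).restrict (D n) := by
  refine iSup_le fun c => Measure.le_iff.2 fun B hB => ?_
  let B' := B ∩ (extChartAt I c).source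
  have hB' : MeasurableSet B' := hB.inter (measurableSet_extChartAt_source I c)
  calc chartVolume I c B = chartVolume I c B' :=
        (measure_inter_conull (chartVolume_compl_source I c)).symm
    _ = chartVolume I c (⋃ n, B' ∩ D n) := by rw [← inter_iUnion, hcover, inter_univ]
    _ ≤ ∑' n, chartVolume I c (B' ∩ D n) := measure_iUnion_le _
    _ = ∑' n, chartVolume I (s n) (B' ∩ D n) := tsum_congr fun n =>
        chartVolume_eq_of_subset I (hB'.inter (hD n)) (inter_subset_right.trans (hsub n))
          (inter_subset_left.trans inter_subset_right)
    _ ≤ ∑' n, chartVolume I (s n) (B ∩ D n) := ENNReal.tsum_le_tsum fun n =>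
        measure_mono (inter_subset_inter_left _ inter_subset_left)
    _ = Measure.sum (fun n => (chartVolume I (s n)).restrict (D n)) B := by
        simp_rw [Measure.sum_apply _ hB, Measure.restrict_apply hB]

lemma exists_mem_nhds_chartVolume_lt_top (x : M) :
    ∃ U ⊆ (extChartAt I x).source, IsOpen U ∧ x ∈ U ∧ chartVolume I x U < ⊤ := by
  let φ := extChartAt I x
  let r := chartVolumeDensity I x (φ x) + 1
  have hdensity : ContinuousOn (fun y => chartVolumeDensity I x (φ y)) φ.source :=
    (continuousOn_chartVolumeDensity I x).comp (continuousOn_extChartAt x) fun y => φ.map_source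
  let U := φ.source ∩ (fun y => (chartVolumeDensity I x (φ y), φ y)) ⁻¹'
    (Iio r ×ˢ Metric.ball (φ x) 1)
  have hU : IsOpen U := (hdensity.prodMk (continuousOn_extChartAt x)).isOpen_inter_preimage
    (isOpen_extChartAt_source x) (isOpen_Iio.prod Metric.isOpen_ball)
  have hUz : ∀ z ∈ chartImage I x U,
      chartVolumeDensity I x z < r ∧ z ∈ Metric.ball (φ x) 1 := fun z hz => by
    have hz' := hz.2.2
    rwa [mem_preimage, φ.right_inv hz.1] at hz'
  refine ⟨U, inter_subset_left, hU, ⟨mem_extChartAt_source x, mem_Iio.2 (lt_add_one _),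
    Metric.mem_ball_self one_pos⟩, ?_⟩
  have hs := measurableSet_chartImage I x hU.measurableSet
  calc chartVolume I x U
      = ∫⁻ z in chartImage I x U, ENNReal.ofReal (chartVolumeDensity I x z) :=
        chartVolume_apply I x hU.measurableSet
    _ ≤ ∫⁻ _ in chartImage I x U, ENNReal.ofReal r :=
        setLIntegral_mono' hs fun z hz => ENNReal.ofReal_le_ofReal (hUz z hz).1.le
    _ ≤ ENNReal.ofReal r * volume (Metric.ball (φ x) 1) := by
        rw [setLIntegral_const]
        gcongr
        exact fun z hz => (hUz z hz).2
    _ < ⊤ := ENNReal.mul_lt_top ENNReal.ofReal_lt_top measure_ball_lt_top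

variable [SecondCountableTopology M]

lemma riemannianVolume_apply_of_subset (hA : MeasurableSet A)
    (hAc : A ⊆ (extChartAt I c).source) : riemannianVolume I M A = chartVolume I c A := by
  have : Nonempty M := ⟨c⟩
  refine le_antisymm ?_ (Measure.le_iff'.1 (le_iSup (fun c => chartVolume I c) c) A)
  obtain ⟨s, D, hD, hdisj, hcover, hsub⟩ := exists_chart_partition I (M := M)
  calc riemannianVolume I M A
      ≤ Measure.sum (fun n => (chartVolume I (s n)).restrict (D n)) A :=
        Measure.le_iff'.1 (riemannianVolume_le_sum I hD hcover hsub) A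
    _ = ∑' n, chartVolume I (s n) (A ∩ D n) := by
        simp_rw [Measure.sum_apply _ hA, Measure.restrict_apply hA]
    _ = ∑' n, chartVolume I c (A ∩ D n) := tsum_congr fun n =>
        chartVolume_eq_of_subset I (hA.inter (hD n)) (inter_subset_left.trans hAc)
          (inter_subset_right.trans (hsub n))
    _ = chartVolume I c (⋃ n, A ∩ D n) := (measure_iUnion (fun i j hij =>
        (hdisj hij).mono inter_subset_right inter_subset_right) fun n => hA.inter (hD n)).symm
    _ = chartVolume I c A := by rw [← inter_iUnion, hcover, inter_univ]

lemma riemannianVolume_restrict_of_subset (hA : MeasurableSet A)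
    (hAc : A ⊆ (extChartAt I c).source) :
    (riemannianVolume I M).restrict A = (chartVolume I c).restrict A := by
  ext B hB
  rw [Measure.restrict_apply hB, Measure.restrict_apply hB]
  exact riemannianVolume_apply_of_subset I (hB.inter hA) (inter_subset_right.trans hAc)

lemma sigmaFinite_riemannianVolume : SigmaFinite (riemannianVolume I M) := by
  have : IsLocallyFiniteMeasure (riemannianVolume I M) := ⟨fun x => by
    obtain ⟨U, hsub, hU, hx, hfin⟩ := exists_mem_nhds_chartVolume_lt_top I x
    refine ⟨U, hU.mem_nhds hx, ?_⟩
    rwa [riemannianVolume_apply_of_subset I hU.measurableSet hsub]⟩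
  infer_instance

variable [Nonempty M] {U : Set M}

lemma aemeasurable_absDetDeriv (hf : Measurable f) (hA : MeasurableSet A)
    (hd : ∀ x ∈ A, MDifferentiableAt I I f x) :
    AEMeasurable (absDetDeriv I f) ((riemannianVolume I M).restrict A) := by
  obtain ⟨c, c', B, hB, -, rfl, hBc, hfB⟩ := exists_chart_cells I hf hA
  refine aemeasurable_iUnion_iff.2 fun n => ?_
  rw [riemannianVolume_restrict_of_subset I (hB n) (hBc n)]
  exact aemeasurable_absDetDeriv_chartVolume I (hB n) (hfB n)
    fun x hx => hd x (mem_iUnion_of_mem n hx)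

lemma isJacobianOn_absDetDeriv (hf : Measurable f) (hU : MeasurableSet U)
    (hd : ∀ x ∈ U, MDifferentiableAt I I f x) :
    IsJacobianOn (riemannianVolume I M) f (absDetDeriv I f) U := by
  have himage : ∀ A ⊆ U, MeasurableSet A → InjOn f A → MeasurableSet (f '' A) ∧
      riemannianVolume I M (f '' A) =
        ∫⁻ x in A, ENNReal.ofReal (absDetDeriv I f x) ∂riemannianVolume I M := by
    intro A hAU hA hinj
    obtain ⟨c, c', B, hB, hdisj, rfl, hBc, hfB⟩ := exists_chart_cells I hf hA
    have hsub : ∀ n, B n ⊆ ⋃ n, B n := subset_iUnion B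
    have hdB : ∀ n, ∀ x ∈ B n, MDifferentiableAt I I f x := fun n x hx => hd x (hAU (hsub n hx))
    have hmeas : ∀ n, MeasurableSet (f '' B n) := fun n =>
      measurableSet_image_of_mdifferentiableAt I (hB n) (hBc n) (hfB n) (hdB n)
        (hinj.mono (hsub n))
    rw [image_iUnion, lintegral_iUnion hB hdisj, measure_iUnion (fun i j hij =>
      (hdisj hij).image hinj (hsub i) (hsub j)) hmeas]
    refine ⟨.iUnion hmeas, tsum_congr fun n => ?_⟩
    rw [riemannianVolume_apply_of_subset I (hmeas n) (hfB n).image_subset,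
      riemannianVolume_restrict_of_subset I (hB n) (hBc n),
      chartVolume_image I (hB n) (hBc n) (hfB n) (hdB n) (hinj.mono (hsub n))]
  exact ⟨fun A hAU hA hinj => (himage A hAU hA hinj).1, fun A hAU hA hinj =>
    (himage A hAU hA hinj).2, aemeasurable_absDetDeriv I hf hU hd⟩

end RiemannianVolume

end Charts

/-! ### The lower bound in Rokhlin's formula -/

section PartitionEntropy

variable {X ι κ : Type*} [MeasurableSpace X] {μ : Measure X} {f : X → X}

lemma setIntegral_mul_neg_log_add_setIntegral_negMulLog_le {g : X → ℝ} {B : Set X}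
    [IsFiniteMeasure μ] (hg₀ : ∀ x, 0 ≤ g x) (hg : IntegrableOn g B μ)
    (hg' : IntegrableOn (fun x => Real.negMulLog (g x)) B μ) :
    (∫ x in B, g x ∂μ) * -Real.log (μ.real B) + ∫ x in B, Real.negMulLog (g x) ∂μ ≤
      Real.negMulLog (∫ x in B, g x ∂μ) := by
  by_cases hB : μ B = 0
  · simp [Measure.restrict_eq_zero.2 hB]
  have hq : 0 < μ.real B := ENNReal.toReal_pos hB (measure_ne_top _ _)
  have hjensen := Real.concaveOn_negMulLog.le_map_set_average
    Real.continuous_negMulLog.continuousOn isClosed_Ici hB (measure_ne_top _ _)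
    (ae_of_all _ hg₀) hg hg'
  rw [setAverage_eq, setAverage_eq, smul_eq_mul, smul_eq_mul, inv_mul_le_iff₀ hq] at hjensen
  set p := ∫ x in B, g x ∂μ
  set q := μ.real B
  calc p * -Real.log q + ∫ x in B, Real.negMulLog (g x) ∂μ
      ≤ p * -Real.log q + q * Real.negMulLog (q⁻¹ * p) := by gcongr
    _ = q⁻¹ * p * Real.negMulLog q + q * Real.negMulLog (q⁻¹ * p) := by
        have : p * -Real.log q = q⁻¹ * p * Real.negMulLog q := by
          rw [Real.negMulLog]
          field_simp
        rw [this]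
    _ = Real.negMulLog p := by
        rw [← Real.negMulLog_mul, mul_inv_cancel_left₀ hq.ne']

lemma integrable_negMulLog_of_mem_Icc [IsFiniteMeasure μ] {g : X → ℝ} (hg : Measurable g)
    (hg01 : ∀ x, g x ∈ Icc 0 1) : Integrable (fun x => Real.negMulLog (g x)) μ :=
  .of_bound (Real.continuous_negMulLog.measurable.comp hg).aestronglyMeasurable 1
    (ae_of_all _ fun x => by
      rw [Real.norm_of_nonneg (Real.negMulLog_nonneg (hg01 x).1 (hg01 x).2)]
      linarith [Real.negMulLog_le_one_sub_self (hg01 x).1, (hg01 x).1])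

lemma measureReal_preimage_inter_eq_setIntegral {g : X → ℝ} {A B : Set X} (hf : Measurable f)
    (hg₀ : ∀ x, 0 ≤ g x) (hg : Integrable g μ)
    (hmap : (μ.restrict A).map f = μ.withDensity fun x => ENNReal.ofReal (g x))
    (hB : MeasurableSet B) : μ.real (f ⁻¹' B ∩ A) = ∫ x in B, g x ∂μ := by
  rw [Measure.real, ← Measure.restrict_apply (hf hB), ← Measure.map_apply hf hB, hmap,
    withDensity_apply _ hB, ← ofReal_integral_eq_lintegral_ofReal hg.integrableOn
      (ae_of_all _ hg₀), ENNReal.toReal_ofReal (integral_nonneg hg₀)]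

lemma measurable_itinerary [MeasurableSpace ι] (hf : Measurable f)
    {ξ : X → ι} (hξ : Measurable ξ) (n : ℕ) : Measurable (itinerary f ξ n) :=
  measurable_pi_lambda _ fun i => hξ.comp (hf.iterate i)

variable [Fintype ι] [Fintype κ]

lemma partitionEntropy_equiv_comp (μ : Measure X) (ξ : X → ι) (e : ι ≃ κ) :
    partitionEntropy μ (fun x => e (ξ x)) = partitionEntropy μ ξ := by
  unfold partitionEntropy
  rw [← e.sum_comp]
  refine Finset.sum_congr rfl fun a _ => ?_
  congr 3
  ext x
  simp

lemma partitionEntropy_nonneg (μ : Measure X) [IsProbabilityMeasure μ] (ξ : X → ι) :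
    0 ≤ partitionEntropy μ ξ :=
  Finset.sum_nonneg fun _ _ => Real.negMulLog_nonneg measureReal_nonneg measureReal_le_one

variable [MeasurableSpace ι] [MeasurableSingletonClass ι]

lemma measureReal_eq_sum_inter_fiber [IsFiniteMeasure μ] {ξ : X → ι} (hξ : Measurable ξ)
    (A : Set X) : μ.real A = ∑ a, μ.real (A ∩ ξ ⁻¹' {a}) := by
  have hsum := sum_measureReal_preimage_singleton (μ := μ.restrict A) Finset.univ
    fun a _ => hξ (measurableSet_singleton a)
  rw [Finset.coe_univ, preimage_univ, measureReal_restrict_apply_univ] at hsum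
  rw [← hsum]
  exact Finset.sum_congr rfl fun a _ => by
    rw [measureReal_restrict_apply (hξ (measurableSet_singleton a)), inter_comm]

lemma integral_eq_sum_setIntegral_fiber {ξ : X → ι} (hξ : Measurable ξ) {g : X → ℝ}
    (hg : Integrable g μ) : ∫ x, g x ∂μ = ∑ a, ∫ x in ξ ⁻¹' {a}, g x ∂μ := by
  rw [← integral_iUnion_fintype (fun a => hξ (measurableSet_singleton a))
    (fun a b hab => (disjoint_singleton.2 hab).preimage ξ) fun a => hg.integrableOn,
    ← preimage_iUnion, iUnion_of_singleton, preimage_univ, setIntegral_univ]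

variable [MeasurableSpace κ] [MeasurableSingletonClass κ] [IsProbabilityMeasure μ]

lemma partitionEntropy_add_integral_negMulLog_le (hf : MeasurePreserving f μ μ) {ξ : X → ι}
    (hξ : Measurable ξ) {ζ : X → κ} (hζ : Measurable ζ) {g : ι → X → ℝ}
    (hg : ∀ a, Measurable (g a)) (hg01 : ∀ a x, g a x ∈ Icc 0 1)
    (hmap : ∀ a, (μ.restrict (ξ ⁻¹' {a})).map f =
      μ.withDensity fun x => ENNReal.ofReal (g a x)) :
    partitionEntropy μ ζ + ∑ a, ∫ x, Real.negMulLog (g a x) ∂μ ≤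
      partitionEntropy μ fun x => (ξ x, ζ (f x)) := by
  have hg₀ : ∀ a x, 0 ≤ g a x := fun a x => (hg01 a x).1
  have hgi : ∀ a, Integrable (g a) μ := fun a =>
    .of_mem_Icc 0 1 (hg a).aemeasurable (ae_of_all _ (hg01 a))
  have hgl : ∀ a, Integrable (fun x => Real.negMulLog (g a x)) μ := fun a =>
    integrable_negMulLog_of_mem_Icc (hg a) (hg01 a)
  have hfiber : ∀ b, MeasurableSet (ζ ⁻¹' {b}) := fun b => hζ (measurableSet_singleton b)
  have hjoint : ∀ a b, μ.real (f ⁻¹' (ζ ⁻¹' {b}) ∩ ξ ⁻¹' {a}) = ∫ x in ζ ⁻¹' {b}, g a x ∂μ :=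
    fun a b => measureReal_preimage_inter_eq_setIntegral hf.measurable (hg₀ a) (hgi a) (hmap a)
      (hfiber b)
  have hmarginal : ∀ b, μ.real (ζ ⁻¹' {b}) = ∑ a, ∫ x in ζ ⁻¹' {b}, g a x ∂μ := fun b => by
    rw [← hf.measureReal_preimage (hfiber b).nullMeasurableSet, measureReal_eq_sum_inter_fiber hξ]
    exact Finset.sum_congr rfl fun a _ => hjoint a b
  calc partitionEntropy μ ζ + ∑ a, ∫ x, Real.negMulLog (g a x) ∂μ
      = ∑ a, ∑ b, ((∫ x in ζ ⁻¹' {b}, g a x ∂μ) * -Real.log (μ.real (ζ ⁻¹' {b})) +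
          ∫ x in ζ ⁻¹' {b}, Real.negMulLog (g a x) ∂μ) := by
        simp_rw [Finset.sum_add_distrib, ← integral_eq_sum_setIntegral_fiber hζ (hgl _)]
        rw [Finset.sum_comm]
        simp_rw [← Finset.sum_mul, ← hmarginal, partitionEntropy, Real.negMulLog, neg_mul, mul_neg]
    _ ≤ ∑ a, ∑ b, Real.negMulLog (∫ x in ζ ⁻¹' {b}, g a x ∂μ) :=
        Finset.sum_le_sum fun a _ => Finset.sum_le_sum fun b _ =>
          setIntegral_mul_neg_log_add_setIntegral_negMulLog_le (hg₀ a) (hgi a).integrableOn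
            (hgl a).integrableOn
    _ = partitionEntropy μ fun x => (ξ x, ζ (f x)) := by
        rw [partitionEntropy, Fintype.sum_prod_type]
        refine Finset.sum_congr rfl fun a _ => Finset.sum_congr rfl fun b _ => ?_
        rw [← hjoint]
        congr 2
        ext x
        simp [and_comm]

lemma sum_integral_negMulLog_le_entropyOfPartition {k : ℕ} (hf : MeasurePreserving f μ μ)
    {ξ : X → Fin k} (hξ : Measurable ξ) {g : Fin k → X → ℝ} (hg : ∀ a, Measurable (g a))
    (hg01 : ∀ a x, g a x ∈ Icc 0 1)
    (hmap : ∀ a, (μ.restrict (ξ ⁻¹' {a})).map f =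
      μ.withDensity fun x => ENNReal.ofReal (g a x)) :
    ∑ a, ∫ x, Real.negMulLog (g a x) ∂μ ≤ entropyOfPartition f μ ξ := by
  set S := ∑ a, ∫ x, Real.negMulLog (g a x) ∂μ
  have hsplit : ∀ n, itinerary f ξ (n + 1) = fun x =>
      Fin.consEquiv (fun _ => Fin k) (ξ x, itinerary f ξ n (f x)) := fun n => by
    funext x i
    cases i using Fin.cases <;> simp [itinerary, Fin.consEquiv]
  have hlinear : ∀ n : ℕ, n * S ≤ partitionEntropy μ (itinerary f ξ n) := by
    intro n
    induction n with
    | zero => simpa using partitionEntropy_nonneg μ (itinerary f ξ 0)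
    | succ n ih =>
      rw [hsplit, partitionEntropy_equiv_comp, Nat.cast_add_one, add_one_mul]
      exact (add_le_add_left ih S).trans (partitionEntropy_add_integral_negMulLog_le hf hξ
        (measurable_itinerary hf.measurable hξ n) hg hg01 hmap)
  refine le_ciInf fun n => ?_
  rw [le_div_iff₀ (by positivity), mul_comm]
  exact_mod_cast hlinear (n + 1)

end PartitionEntropy

section Coboundary

/-- The truncation of `t` to the interval `[-K, K]`. It is applied to transfer functions that need
not be integrable. -/
noncomputable def clamp (K : ℕ) (t : ℝ) : ℝ :=
  projIcc (-(K : ℝ)) K (neg_le_self K.cast_nonneg) t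

lemma continuous_clamp (K : ℕ) : Continuous (clamp K) :=
  continuous_subtype_val.comp continuous_projIcc

lemma abs_clamp_le (K : ℕ) (t : ℝ) : |clamp K t| ≤ K :=
  abs_le.2 (projIcc (-(K : ℝ)) K (neg_le_self K.cast_nonneg) t).2

lemma abs_clamp_sub_clamp_le (K : ℕ) (s t : ℝ) : |clamp K s - clamp K t| ≤ |s - t| :=
  abs_projIcc_sub_projIcc _

lemma neg_abs_le_clamp_sub_clamp {s t c : ℝ} (K : ℕ) (h : -c ≤ s - t) :
    -|c| ≤ clamp K s - clamp K t := by
  rcases le_total t s with hts | hst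
  · have : clamp K t ≤ clamp K s := monotone_projIcc _ hts
    linarith [abs_nonneg c]
  · have hlip := abs_clamp_sub_clamp_le K s t
    rw [abs_of_nonpos (sub_nonpos.2 hst)] at hlip
    linarith [(abs_le.1 hlip).1, le_abs_self c]

lemma tendsto_clamp (t : ℝ) : Tendsto (fun K : ℕ => clamp K t) atTop (𝓝 t) := by
  refine tendsto_const_nhds.congr' ?_
  filter_upwards [tendsto_natCast_atTop_atTop.eventually_ge_atTop |t|] with K hK
  exact (congrArg Subtype.val (projIcc_of_mem _ (abs_le.1 hK))).symm

variable {X : Type*} [MeasurableSpace X] {μ : Measure X} {f : X → X} {u ψ : X → ℝ}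

lemma integral_comp_of_measurePreserving {Y : Type*} [MeasurableSpace Y] {ν : Measure Y} {g : X → Y}
    {v : Y → ℝ} (hg : MeasurePreserving g μ ν) (hv : AEStronglyMeasurable v ν) :
    ∫ x, v (g x) ∂μ = ∫ y, v y ∂ν := by
  rw [← hg.map_eq] at hv ⊢
  exact (integral_map hg.measurable.aemeasurable hv).symm

lemma integral_coboundary_eq_zero (hf : MeasurePreserving f μ μ) (hu : Integrable u μ) :
    ∫ x, (u (f x) - u x) ∂μ = 0 :=
  (integral_sub (hf.integrable_comp_of_integrable hu) hu).trans
    (sub_eq_zero.2 (integral_comp_of_measurePreserving hf hu.aestronglyMeasurable))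

variable [IsFiniteMeasure μ]

lemma integrable_clamp_comp (hu : Measurable u) (K : ℕ) :
    Integrable (fun x => clamp K (u x)) μ :=
  .of_bound ((continuous_clamp K).measurable.comp hu).aestronglyMeasurable K
    (ae_of_all _ fun x => abs_clamp_le K (u x))

-- By Fatou: the truncated coboundaries have integral zero, so their negative parts, which are
-- dominated by `|ψ|`, control their `L¹` norms.
lemma integrable_coboundary (hf : MeasurePreserving f μ μ) (hu : Measurable u)
    (hψ : Integrable ψ μ) (hle : ∀ᵐ x ∂μ, -ψ x ≤ u (f x) - u x) :
    Integrable (fun x => u (f x) - u x) μ := by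
  set v : ℕ → X → ℝ := fun K x => clamp K (u (f x)) - clamp K (u x)
  have hv : ∀ K, Integrable (v K) μ := fun K =>
    (integrable_clamp_comp (hu.comp hf.measurable) K).sub (integrable_clamp_comp hu K)
  have hnorm : ∀ K, eLpNorm (fun x => v K x + |ψ x|) 1 μ ≤ ENNReal.ofReal (∫ x, |ψ x| ∂μ) := by
    intro K
    have hpos : ∀ᵐ x ∂μ, 0 ≤ v K x + |ψ x| := by
      filter_upwards [hle] with x hx
      linarith [neg_abs_le_clamp_sub_clamp K hx]
    refine le_of_eq ?_
    calc eLpNorm (fun x => v K x + |ψ x|) 1 μ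
        = ∫⁻ x, ENNReal.ofReal (v K x + |ψ x|) ∂μ := by
          rw [eLpNorm_one_eq_lintegral_enorm]
          refine lintegral_congr_ae ?_
          filter_upwards [hpos] with x hx using Real.enorm_of_nonneg hx
      _ = ENNReal.ofReal (∫ x, (v K x + |ψ x|) ∂μ) :=
          (ofReal_integral_eq_lintegral_ofReal ((hv K).add hψ.abs) hpos).symm
      _ = ENNReal.ofReal (∫ x, |ψ x| ∂μ) := by
          rw [integral_add (hv K) hψ.abs, integral_coboundary_eq_zero
            (u := fun x => clamp K (u x)) hf (integrable_clamp_comp hu K), zero_add]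
  have hlim : MemLp (fun x => u (f x) - u x + |ψ x|) 1 μ := by
    refine ⟨(((hu.comp hf.measurable).sub hu).aestronglyMeasurable).add
      hψ.abs.aestronglyMeasurable, (Lp.eLpNorm_le_of_ae_tendsto (u := atTop) (.of_forall hnorm)
        (fun K => ((hv K).add hψ.abs).aestronglyMeasurable) (ae_of_all _ fun x => ?_)).trans_lt
        ENNReal.ofReal_lt_top⟩
    exact ((tendsto_clamp (u (f x))).sub (tendsto_clamp (u x))).add_const _
  exact ((memLp_one_iff_integrable.1 hlim).sub hψ.abs).congr (ae_of_all _ fun x => by simp)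

lemma integral_coboundary_eq_zero_of_integrable (hf : MeasurePreserving f μ μ) (hu : Measurable u)
    (hint : Integrable (fun x => u (f x) - u x) μ) : ∫ x, (u (f x) - u x) ∂μ = 0 := by
  have hlim := tendsto_integral_of_dominated_convergence (fun x => |u (f x) - u x|)
    (fun K => ((integrable_clamp_comp (hu.comp hf.measurable) K).sub
      (integrable_clamp_comp hu K)).aestronglyMeasurable) hint.abs
    (fun K => ae_of_all _ fun x => abs_clamp_sub_clamp_le K (u (f x)) (u x))
    (ae_of_all _ fun x => (tendsto_clamp (u (f x))).sub (tendsto_clamp (u x)))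
  have hzero : ∀ K, ∫ x, (clamp K (u (f x)) - clamp K (u x)) ∂μ = 0 := fun K =>
    integral_coboundary_eq_zero (u := fun x => clamp K (u x)) hf (integrable_clamp_comp hu K)
  exact tendsto_nhds_unique hlim (by simp [hzero])

end Coboundary

section LowerBound

variable {X : Type*} [MeasurableSpace X] {m μ : Measure X} {f : X → X} {E : Set X} {g : X → ℝ}

lemma exists_density_map_restrict [IsFiniteMeasure μ] (hf : MeasurePreserving f μ μ) (E : Set X) :
    ∃ g : X → ℝ, Measurable g ∧ (∀ x, g x ∈ Icc 0 1) ∧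
      (μ.restrict E).map f = μ.withDensity fun x => ENNReal.ofReal (g x) := by
  have hle : (μ.restrict E).map f ≤ μ := by
    conv_rhs => rw [← hf.map_eq]
    exact Measure.map_mono Measure.restrict_le_self hf.measurable
  set r := ((μ.restrict E).map f).rnDeriv μ
  have hr : Measurable r := Measure.measurable_rnDeriv _ _
  refine ⟨fun x => min 1 (r x).toReal, measurable_const.min hr.ennreal_toReal,
    fun x => ⟨le_min zero_le_one ENNReal.toReal_nonneg, min_le_left _ _⟩, ?_⟩
  rw [← Measure.withDensity_rnDeriv_eq _ _ (Measure.absolutelyContinuous_of_le hle)]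
  refine withDensity_congr_ae ?_
  filter_upwards [Measure.rnDeriv_le_one_of_le hle] with x hx
  have hr1 : (r x).toReal ≤ 1 := ENNReal.toReal_le_of_le_ofReal zero_le_one (by simpa using hx)
  rw [min_eq_right hr1, ENNReal.ofReal_toReal (ne_top_of_le_ne_top ENNReal.one_ne_top hx)]

lemma integral_negMulLog_density (hf : Measurable f) (hg : Measurable g) (hg₀ : ∀ x, 0 ≤ g x)
    (hmap : (μ.restrict E).map f = μ.withDensity fun x => ENNReal.ofReal (g x)) :
    ∫ x, Real.negMulLog (g x) ∂μ = ∫ x in E, -Real.log (g (f x)) ∂μ := by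
  have hlog : Measurable fun x => -Real.log (g x) := (Real.measurable_log.comp hg).neg
  rw [← integral_map hf.aemeasurable hlog.aestronglyMeasurable, hmap,
    integral_withDensity_eq_integral_toReal_smul hg.ennreal_ofReal
      (ae_of_all _ fun x => ENNReal.ofReal_lt_top)]
  refine integral_congr_ae (ae_of_all _ fun x => ?_)
  simp only [ENNReal.toReal_ofReal (hg₀ x), smul_eq_mul, Real.negMulLog]
  ring

variable [SigmaFinite m] {D : X → ℝ} {U : Set X}

lemma jacobian_mul_density_ae_eq [SigmaFinite μ] (hμm : μ ≪ m) (hf : Measurable f)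
    (hJ : IsJacobianOn m f D U) (hEU : E ⊆ U) (hE : MeasurableSet E) (hinj : InjOn f E)
    (hg : Measurable g)
    (hmap : (μ.restrict E).map f = μ.withDensity fun x => ENNReal.ofReal (g x)) :
    ∀ᵐ x ∂m.restrict E,
      ENNReal.ofReal (D x) * (ENNReal.ofReal (g (f x)) * μ.rnDeriv m (f x)) = μ.rnDeriv m x := by
  set h := μ.rnDeriv m
  have hh : Measurable h := Measure.measurable_rnDeriv _ _
  have hwd : m.withDensity h = μ := Measure.withDensity_rnDeriv_eq _ _ hμm
  set G : X → ℝ≥0∞ := fun y => ENNReal.ofReal (g y) * h y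
  have hG : Measurable G := hg.ennreal_ofReal.mul hh
  have hDG : AEMeasurable (fun x => ENNReal.ofReal (D x) * G (f x)) (m.restrict E) :=
    (hJ.aemeasurable.mono_measure (Measure.restrict_mono hEU le_rfl)).ennreal_ofReal.mul
      (hG.comp hf).aemeasurable
  have hsub : ∀ A ⊆ E, MeasurableSet A → ∫⁻ x in A, ENNReal.ofReal (D x) * G (f x) ∂m = μ A := by
    intro A hAE hA
    have hinjA := hinj.mono hAE
    have hfA := hJ.measurableSet_image A (hAE.trans hEU) hA hinjA
    calc ∫⁻ x in A, ENNReal.ofReal (D x) * G (f x) ∂m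
        = ∫⁻ y in f '' A, G y ∂m :=
          (hJ.setLIntegral_image hf (hAE.trans hEU) hA hinjA G).symm
      _ = ∫⁻ y in f '' A, ENNReal.ofReal (g y) ∂μ := by
          rw [← hwd, setLIntegral_withDensity_eq_setLIntegral_mul _ hh hg.ennreal_ofReal hfA]
          simp only [G, Pi.mul_apply, mul_comm]
      _ = μ (f ⁻¹' (f '' A) ∩ E) := by
          rw [← withDensity_apply _ hfA, ← hmap, Measure.map_apply hf hfA,
            Measure.restrict_apply (hf hfA)]
      _ = μ A := by rw [hinj.preimage_image_inter hAE]
  refine ae_eq_of_forall_setLIntegral_eq_of_sigmaFinite₀ hDG hh.aemeasurable fun A hA _ => ?_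
  rw [Measure.restrict_restrict hA, hsub _ inter_subset_right (hA.inter hE),
    ← withDensity_apply _ (hA.inter hE), hwd]

lemma neg_log_density_ae_eq [SigmaFinite μ] (hμm : μ ≪ m) (hf : MeasurePreserving f μ μ)
    (hJ : IsJacobianOn m f D U) (hEU : E ⊆ U) (hE : MeasurableSet E) (hinj : InjOn f E)
    (hpos : ∀ x ∈ E, 0 < D x) (hg : Measurable g) (hg₀ : ∀ x, 0 ≤ g x)
    (hmap : (μ.restrict E).map f = μ.withDensity fun x => ENNReal.ofReal (g x)) :
    ∀ᵐ x ∂μ.restrict E, -Real.log (g (f x)) = Real.log (D x) +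
      (Real.log (μ.rnDeriv m (f x)).toReal - Real.log (μ.rnDeriv m x).toReal) := by
  have hdensity : ∀ᵐ x ∂μ, 0 < (μ.rnDeriv m x).toReal := by
    filter_upwards [Measure.rnDeriv_pos hμm, hμm.ae_le (Measure.rnDeriv_lt_top μ m)] with x hx₀ hx
      using ENNReal.toReal_pos hx₀.ne' hx.ne
  filter_upwards [(hμm.restrict E).ae_le
      (jacobian_mul_density_ae_eq hμm hf.measurable hJ hEU hE hinj hg hmap),
    ae_restrict_of_ae hdensity, ae_restrict_of_ae (hf.quasiMeasurePreserving.ae hdensity),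
    ae_restrict_mem hE] with x hx hhx hhfx hxE
  have hDx := hpos x hxE
  replace hx := congrArg ENNReal.toReal hx
  rw [ENNReal.toReal_mul, ENNReal.toReal_mul, ENNReal.toReal_ofReal hDx.le,
    ENNReal.toReal_ofReal (hg₀ _)] at hx
  have hgx : 0 < g (f x) := (hg₀ _).lt_of_ne' fun h0 => by simp [h0, hhx.ne] at hx
  rw [← hx, Real.log_mul hDx.ne' (mul_pos hgx hhfx).ne', Real.log_mul hgx.ne' hhfx.ne']
  ring

variable {L : X → ℕ}

lemma sum_integral_negMulLog_le_measureEntropy [IsProbabilityMeasure μ]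
    (hf : MeasurePreserving f μ μ) (hL : Measurable L) {g : ℕ → X → ℝ}
    (hg : ∀ n, Measurable (g n)) (hg01 : ∀ n x, g n x ∈ Icc 0 1)
    (hmap : ∀ n, (μ.restrict (L ⁻¹' {n})).map f = μ.withDensity fun x => ENNReal.ofReal (g n x))
    (K : ℕ) :
    ((∑ n ∈ Finset.range K, ∫ x, Real.negMulLog (g n x) ∂μ : ℝ) : EReal) ≤
      measureEntropy f μ := by
  let ξ : X → Fin (K + 1) := fun x => ⟨min (L x) K, by omega⟩
  have hξ : Measurable ξ :=
    (measurable_of_countable fun n => (⟨min n K, by omega⟩ : Fin (K + 1))).comp hL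
  have hfiber : ∀ n : Fin K, ξ ⁻¹' {n.castSucc} = L ⁻¹' {(n : ℕ)} := fun n => by
    ext x
    simp only [ξ, mem_preimage, mem_singleton_iff, Fin.ext_iff, Fin.val_castSucc]
    omega
  obtain ⟨gK, hgK, hgK01, hmapK⟩ := exists_density_map_restrict hf (ξ ⁻¹' {Fin.last K})
  let G : Fin (K + 1) → X → ℝ := Fin.snoc (α := fun _ => X → ℝ) (fun n : Fin K => g n) gK
  have hG : ∀ a, Measurable (G a) ∧ (∀ x, G a x ∈ Icc 0 1) ∧
      (μ.restrict (ξ ⁻¹' {a})).map f = μ.withDensity fun x => ENNReal.ofReal (G a x) := fun a => by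
    cases a using Fin.lastCases with
    | last => simpa only [G, Fin.snoc_last] using ⟨hgK, hgK01, hmapK⟩
    | cast n => simpa only [G, Fin.snoc_castSucc, hfiber] using ⟨hg n, hg01 n, hmap n⟩
  have hlast : 0 ≤ ∫ x, Real.negMulLog (gK x) ∂μ :=
    integral_nonneg fun x => Real.negMulLog_nonneg (hgK01 x).1 (hgK01 x).2
  calc ((∑ n ∈ Finset.range K, ∫ x, Real.negMulLog (g n x) ∂μ : ℝ) : EReal)
      ≤ ((∑ a, ∫ x, Real.negMulLog (G a x) ∂μ : ℝ) : EReal) := by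
        rw [EReal.coe_le_coe_iff, Fin.sum_univ_castSucc,
          ← Fin.sum_univ_eq_sum_range fun n => ∫ x, Real.negMulLog (g n x) ∂μ]
        simpa only [G, Fin.snoc_castSucc, Fin.snoc_last, le_add_iff_nonneg_right] using hlast
    _ ≤ entropyOfPartition f μ ξ :=
        EReal.coe_le_coe_iff.2 (sum_integral_negMulLog_le_entropyOfPartition hf hξ
          (fun a => (hG a).1) (fun a => (hG a).2.1) fun a => (hG a).2.2)
    _ ≤ measureEntropy f μ := le_iSup₂_of_le (K + 1) ξ (le_iSup_of_le hξ le_rfl)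

theorem integral_log_jacobian_le_measureEntropy [IsProbabilityMeasure μ] {A : Set X} (hμm : μ ≪ m)
    (hf : MeasurePreserving f μ μ) (hJ : IsJacobianOn m f D U) (hAU : A ⊆ U)
    (hA : MeasurableSet A) (hμA : ∀ᵐ x ∂μ, x ∈ A) (hpos : ∀ x ∈ A, 0 < D x) (hL : Measurable L)
    (hinj : ∀ n, InjOn f (A ∩ L ⁻¹' {n})) (hint : Integrable (fun x => Real.log (D x)) μ) :
    ((∫ x, Real.log (D x) ∂μ : ℝ) : EReal) ≤ measureEntropy f μ := by
  let u : X → ℝ := fun x => Real.log (μ.rnDeriv m x).toReal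
  have hu : Measurable u := Real.measurable_log.comp (Measure.measurable_rnDeriv _ _).ennreal_toReal
  let W : X → ℝ := fun x => Real.log (D x) + (u (f x) - u x)
  have hfiber : ∀ n, MeasurableSet (L ⁻¹' {n}) := fun n => hL (measurableSet_singleton n)
  choose g hg hg01 hmap using fun n => exists_density_map_restrict hf (L ⁻¹' {n})
  have hgW : ∀ n, ∀ᵐ x ∂μ.restrict (L ⁻¹' {n}), -Real.log (g n (f x)) = W x := fun n => by
    have hAn : μ.restrict (A ∩ L ⁻¹' {n}) = μ.restrict (L ⁻¹' {n}) :=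
      Measure.restrict_congr_set (inter_ae_eq_right_of_ae_eq_univ (eventuallyEq_univ.2 hμA))
    rw [← hAn]
    exact neg_log_density_ae_eq hμm hf hJ (inter_subset_left.trans hAU) (hA.inter (hfiber n))
      (hinj n) (fun x hx => hpos x hx.1) (hg n) (fun x => (hg01 n x).1) (hAn ▸ hmap n)
  have hcover : ⋃ n, L ⁻¹' {n} = univ := by
    rw [← preimage_iUnion, iUnion_of_singleton, preimage_univ]
  have hW₀ : ∀ᵐ x ∂μ, 0 ≤ W x := by
    rw [← Measure.restrict_univ (μ := μ), ← hcover, ae_restrict_iUnion_iff]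
    intro n
    filter_upwards [hgW n] with x hx
    rw [← hx]
    exact neg_nonneg.2 (Real.log_nonpos (hg01 n _).1 (hg01 n _).2)
  have hcob : Integrable (fun x => u (f x) - u x) μ := integrable_coboundary hf hu hint <| by
    filter_upwards [hW₀] with x hx using neg_le_iff_add_nonneg'.2 hx
  have hW : ∫ x, W x ∂μ = ∫ x, Real.log (D x) ∂μ := by
    rw [integral_add hint hcob, integral_coboundary_eq_zero_of_integrable hf hu hcob, add_zero]
  have hsum := (hasSum_integral_iUnion hfiber
    (fun i j hij => (disjoint_singleton.2 hij).preimage L)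
    (hint.add hcob).integrableOn).tendsto_sum_nat
  rw [hcover, setIntegral_univ] at hsum
  rw [← hW]
  refine le_of_tendsto ((continuous_coe_real_ereal.tendsto _).comp hsum) (.of_forall fun K => ?_)
  refine le_trans (le_of_eq ?_) (sum_integral_negMulLog_le_measureEntropy hf hL hg hg01 hmap K)
  refine congrArg _ (Finset.sum_congr rfl fun n _ => ?_)
  rw [integral_negMulLog_density hf.measurable (hg n) (fun x => (hg01 n x).1) (hmap n)]
  exact integral_congr_ae ((hgW n).mono fun x hx => hx.symm)

end LowerBound

/-! ### Towers over induced maps -/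

section Tower

variable {M : Type*}

/-- The tower map over `F` with roof function `R`: it climbs one level at a time below the roof, and
returns to the base through `F`. The points `(x, l)` with `R x ≤ l` do not belong to the tower. -/
def towerMap (F : M → M) (R : M → ℕ) (z : M × ℕ) : M × ℕ :=
  if z.2 + 1 < R z.1 then (z.1, z.2 + 1) else (F z.1, 0)

/-- The partition of the tower into the cells of the base, indexed by `idx`, and one cell (label
zero) for all the points above the base. -/
def towerLabel (idx : M → ℕ) (z : M × ℕ) : ℕ := if z.2 = 0 then idx z.1 + 1 else 0

/-- The function on the tower equal to `ψ` on the base and to zero above it. -/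
noncomputable def towerLift (ψ : M → ℝ) (z : M × ℕ) : ℝ := if z.2 = 0 then ψ z.1 else 0

variable {F : M → M} {R : M → ℕ} {x y : M} {i l : ℕ}

lemma towerMap_of_lt (h : l + 1 < R x) : towerMap F R (x, l) = (x, l + 1) :=
  if_pos h

lemma towerMap_of_le (h : R x ≤ l + 1) : towerMap F R (x, l) = (F x, 0) :=
  if_neg (not_lt.2 h)

lemma towerMap_iterate_of_lt (h : l + i < R x) : (towerMap F R)^[i] (x, l) = (x, l + i) := by
  induction i with
  | zero => rfl
  | succ i ih =>
    rw [Function.iterate_succ_apply', ih (by lia), towerMap_of_lt (by lia), add_assoc]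

lemma towerMap_iterate_base (h : i < R x) : (towerMap F R)^[i] (x, 0) = (x, i) := by
  rw [towerMap_iterate_of_lt (by lia), zero_add]

lemma towerMap_iterate_roof (h : l < R x) : (towerMap F R)^[R x - l] (x, l) = (F x, 0) := by
  obtain ⟨i, hi⟩ : ∃ i, R x - l = i + 1 := ⟨R x - l - 1, by lia⟩
  rw [hi, Function.iterate_succ_apply', towerMap_iterate_of_lt (by lia), towerMap_of_le (by lia)]

lemma towerMap_iterate_roof_add (h : 0 < R x) (i : ℕ) :
    (towerMap F R)^[R x + i] (x, 0) = (towerMap F R)^[i] (F x, 0) := by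
  rw [add_comm, Function.iterate_add_apply]
  exact congrArg _ (towerMap_iterate_roof h)

lemma eq_base_of_towerMap_iterate {z : M × ℕ} (h : (towerMap F R)^[l] z = (x, l)) :
    z = (x, 0) := by
  induction l with
  | zero => exact h
  | succ l ih =>
    refine ih ?_
    rw [Function.iterate_succ_apply', towerMap] at h
    split_ifs at h
    · simp only [Prod.mk.injEq, Nat.add_right_cancel_iff] at h
      exact Prod.ext h.1 h.2
    · simp at h

lemma towerMap_iterate_mem_level_iff {z : M × ℕ} {B : Set M} :
    (towerMap F R)^[l] z ∈ {w : M × ℕ | w.2 = l ∧ w.1 ∈ B ∧ l < R w.1} ↔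
      z ∈ {w : M × ℕ | w.2 = 0 ∧ w.1 ∈ B ∧ l < R w.1} := by
  constructor
  · rintro ⟨hlevel, hB, hR⟩
    rw [eq_base_of_towerMap_iterate (l := l) (x := ((towerMap F R)^[l] z).1) (Prod.ext rfl hlevel)]
    exact ⟨rfl, hB, hR⟩
  · obtain ⟨x, k⟩ := z
    rintro ⟨rfl, hB, hR⟩
    rw [towerMap_iterate_base hR]
    exact ⟨rfl, hB, hR⟩

lemma sum_towerMap_level {α : Type*} [AddCommMonoid α] (g : M × ℕ → α) (h : 0 < R x) :
    ∑ l ∈ Finset.range (R x), g (towerMap F R (x, l)) =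
      ∑ l ∈ Finset.range (R x - 1), g (x, l + 1) + g (F x, 0) := by
  obtain ⟨r, hr⟩ : ∃ r, R x = r + 1 := ⟨R x - 1, by lia⟩
  rw [hr, Finset.sum_range_succ, Nat.add_sub_cancel, towerMap_of_le hr.le]
  congr 1
  refine Finset.sum_congr rfl fun l hl => ?_
  rw [towerMap_of_lt (by rw [Finset.mem_range] at hl; lia)]

section Labels

variable {idx : M → ℕ}

lemma towerLabel_iterate_eq (hR : R.FactorsThrough idx) (h : idx y = idx x) (hi : i < R x) :
    towerLabel idx ((towerMap F R)^[i] (y, 0)) = towerLabel idx ((towerMap F R)^[i] (x, 0)) := by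
  rw [towerMap_iterate_base hi, towerMap_iterate_base (hi.trans_eq (hR h).symm)]
  simp only [towerLabel, h]

lemma sum_towerLift_of_le_roof (ψ : M → ℝ) {s : ℕ} (hs : 0 < s) (hsR : s ≤ R x) :
    ∑ i ∈ Finset.range s, towerLift ψ ((towerMap F R)^[i] (x, 0)) = ψ x := by
  rw [Finset.sum_eq_single_of_mem 0 (Finset.mem_range.2 hs)]
  · exact if_pos rfl
  · intro i hi hi0
    rw [towerMap_iterate_base ((Finset.mem_range.1 hi).trans_le hsR)]
    exact if_neg hi0

/-- The number `j` is that of the visits to the base before time `s`. -/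
lemma exists_returns_determine_labels (hR : R.FactorsThrough idx) (hR₀ : ∀ x, 0 < R x)
    (ψ : M → ℝ) (s : ℕ) (x : M) :
    ∃ j, ∑ i ∈ Finset.range s, towerLift ψ ((towerMap F R)^[i] (x, 0)) =
        ∑ i ∈ Finset.range j, ψ (F^[i] x) ∧
      ∀ y, (∀ i < j, idx (F^[i] y) = idx (F^[i] x)) → ∀ i < s,
        towerLabel idx ((towerMap F R)^[i] (y, 0)) =
          towerLabel idx ((towerMap F R)^[i] (x, 0)) := by
  induction s using Nat.strong_induction_on generalizing x with
  | _ s ih =>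
  rcases Nat.eq_zero_or_pos s with rfl | hs
  · exact ⟨0, by simp, by simp⟩
  rcases le_total s (R x) with hsR | hsR
  · refine ⟨1, by simp [sum_towerLift_of_le_roof ψ hs hsR], fun y hy i hi => ?_⟩
    exact towerLabel_iterate_eq hR (hy 0 one_pos) (hi.trans_le hsR)
  obtain ⟨s', rfl⟩ := Nat.exists_eq_add_of_le hsR
  obtain ⟨j, hsum, hlabel⟩ := ih s' (Nat.lt_add_of_pos_left (hR₀ x)) (F x)
  refine ⟨j + 1, ?_, fun y hy i hi => ?_⟩
  · rw [Finset.sum_range_add, sum_towerLift_of_le_roof ψ (hR₀ x) le_rfl, Finset.sum_range_succ',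
      add_comm]
    simp only [towerMap_iterate_roof_add (hR₀ x), hsum, Function.iterate_succ_apply,
      Function.iterate_zero, id]
  have hidx : idx y = idx x := hy 0 j.succ_pos
  rcases lt_or_ge i (R x) with hiR | hiR
  · exact towerLabel_iterate_eq hR hidx hiR
  obtain ⟨i', rfl⟩ := Nat.exists_eq_add_of_le hiR
  rw [towerMap_iterate_roof_add (hR₀ x), ← hR hidx, towerMap_iterate_roof_add (hR₀ y)]
  exact hlabel (F y) (fun k hk => hy (k + 1) (by lia)) i' (by lia)

lemma exists_first_visit {z : M × ℕ} (hz : z.2 < R z.1) (N : ℕ) (ψ : M → ℝ) :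
    ∃ t ≤ N, ∃ y, (y = z.1 ∨ y = F z.1) ∧
      (∀ i < t, towerLabel idx ((towerMap F R)^[i] z) = 0 ∧
        towerLift ψ ((towerMap F R)^[i] z) = 0) ∧
      ∀ i, t + i < N → (towerMap F R)^[t + i] z = (towerMap F R)^[i] (y, 0) := by
  obtain ⟨x, l⟩ := z
  rcases Nat.eq_zero_or_pos l with rfl | hl
  · exact ⟨0, Nat.zero_le _, x, Or.inl rfl, by simp, fun i _ => by rw [zero_add]⟩
  refine ⟨min (R x - l) N, min_le_right _ _, F x, Or.inr rfl, fun i hi => ?_, fun i hi => ?_⟩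
  · rw [towerMap_iterate_of_lt (by lia)]
    exact ⟨if_neg (by lia), if_neg (by lia)⟩
  · rw [show min (R x - l) N = R x - l by lia, add_comm, Function.iterate_add_apply,
      towerMap_iterate_roof hz]

end Labels

variable [MeasurableSpace M] {ν : Measure M}

/-- The measure on the tower over `(M, ν)` with roof function `R`, of total mass `∫ R dν`. -/
noncomputable def towerMeasure (R : M → ℕ) (ν : Measure M) : Measure (M × ℕ) :=
  Measure.sum fun l : ℕ => (ν.restrict {x | l < R x}).map fun x => (x, l)

lemma lintegral_towerMeasure (hR : Measurable R) {g : M × ℕ → ℝ≥0∞} (hg : Measurable g) :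
    ∫⁻ z, g z ∂towerMeasure R ν = ∫⁻ x, ∑ l ∈ Finset.range (R x), g (x, l) ∂ν := by
  have hlevel (l : ℕ) : MeasurableSet {x | l < R x} := measurableSet_lt measurable_const hR
  have hgl (l : ℕ) : Measurable fun x => g (x, l) := hg.comp measurable_prodMk_right
  calc ∫⁻ z, g z ∂towerMeasure R ν
      = ∑' l, ∫⁻ x, {x | l < R x}.indicator (fun x => g (x, l)) x ∂ν := by
        rw [towerMeasure, lintegral_sum_measure]
        refine tsum_congr fun l => ?_
        rw [lintegral_map hg measurable_prodMk_right, lintegral_indicator (hlevel l)]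
    _ = ∫⁻ x, ∑' l, {x | l < R x}.indicator (fun x => g (x, l)) x ∂ν :=
        (lintegral_tsum fun l => ((hgl l).indicator (hlevel l)).aemeasurable).symm
    _ = ∫⁻ x, ∑ l ∈ Finset.range (R x), g (x, l) ∂ν := by
        refine lintegral_congr fun x => ?_
        rw [tsum_eq_sum (s := Finset.range (R x))
          fun l hl => indicator_of_notMem (by simpa using hl) _]
        exact Finset.sum_congr rfl fun l hl => indicator_of_mem (by simpa using hl) _

lemma measurable_towerMap (hF : Measurable F) (hR : Measurable R) :
    Measurable (towerMap F R) := by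
  refine measurable_from_prod_countable_left fun l => ?_
  refine Measurable.ite ?_ (measurable_prodMk_right (y := l + 1)) (hF.prodMk measurable_const)
  exact measurableSet_lt (measurable_const (a := l + 1)) hR

lemma measurePreserving_towerMap (hF : MeasurePreserving F ν ν) (hR : Measurable R)
    (hR₀ : ∀ x, 0 < R x) :
    MeasurePreserving (towerMap F R) (towerMeasure R ν) (towerMeasure R ν) := by
  have hT := measurable_towerMap hF.measurable hR
  refine ⟨hT, Measure.ext_of_lintegral _ fun g hg => ?_⟩
  have hbase : Measurable fun x => g (x, 0) := hg.comp measurable_prodMk_right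
  calc ∫⁻ z, g z ∂(towerMeasure R ν).map (towerMap F R)
      = ∫⁻ x, ∑ l ∈ Finset.range (R x), g (towerMap F R (x, l)) ∂ν := by
        rw [lintegral_map hg hT, lintegral_towerMeasure (g := fun z => g (towerMap F R z)) hR
          (hg.comp hT)]
    _ = ∫⁻ x, ∑ l ∈ Finset.range (R x - 1), g (x, l + 1) ∂ν + ∫⁻ x, g (F x, 0) ∂ν := by
        rw [← lintegral_add_right (g := fun x => g (F x, 0)) _ (hbase.comp hF.measurable)]
        exact lintegral_congr fun x => sum_towerMap_level g (hR₀ x)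
    _ = ∫⁻ x, ∑ l ∈ Finset.range (R x - 1), g (x, l + 1) ∂ν + ∫⁻ x, g (x, 0) ∂ν := by
        rw [hF.lintegral_comp hbase]
    _ = ∫⁻ z, g z ∂towerMeasure R ν := by
        rw [lintegral_towerMeasure hR hg, ← lintegral_add_right _ hbase]
        refine lintegral_congr fun x => ?_
        rw [← Finset.sum_range_succ' (fun l => g (x, l)), Nat.sub_add_cancel (hR₀ x)]

lemma ae_towerMeasure_iff (hR : Measurable R) {p : M × ℕ → Prop} (hp : MeasurableSet {z | p z}) :
    (∀ᵐ z ∂towerMeasure R ν, p z) ↔ ∀ᵐ x ∂ν, ∀ l < R x, p (x, l) := by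
  rw [towerMeasure, Measure.ae_sum_iff, ae_all_iff]
  refine forall_congr' fun l => ?_
  rw [ae_map_iff measurable_prodMk_right.aemeasurable hp,
    ae_restrict_iff' (measurableSet_lt measurable_const hR)]
  rfl

lemma ae_towerMeasure_of_ae (hR : Measurable R) {p : M → Prop} (hp : ∀ᵐ x ∂ν, p x) :
    ∀ᵐ z ∂towerMeasure R ν, p z.1 ∧ z.2 < R z.1 := by
  obtain ⟨N, hpN, hN, hνN⟩ := exists_measurable_superset_of_null hp
  have hmeas : MeasurableSet {z : M × ℕ | z.1 ∉ N ∧ z.2 < R z.1} :=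
    (measurable_fst hN.compl).inter (measurableSet_lt measurable_snd (hR.comp measurable_fst))
  have hae : ∀ᵐ z ∂towerMeasure R ν, z.1 ∉ N ∧ z.2 < R z.1 := by
    rw [ae_towerMeasure_iff hR hmeas]
    filter_upwards [measure_eq_zero_iff_ae_notMem.1 hνN] with x hx l hl
    exact ⟨hx, hl⟩
  filter_upwards [hae] with z hz
  exact ⟨not_not.1 fun hpz => hz.1 (hpN hpz), hz.2⟩

end Tower

/-! ### Approximation by windows of a label process -/

section Window

variable {X : Type*}

lemma measurable_of_dependsOn_finite {ι α β : Type*} [Countable α] [MeasurableSpace α]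
    [MeasurableSingletonClass α] [MeasurableSpace β] {s : Set ι} [Finite s] {Φ : (ι → α) → β}
    (hΦ : DependsOn Φ s) : Measurable Φ := by
  rcases isEmpty_or_nonempty β with _ | _
  · have := Function.isEmpty Φ
    exact measurable_of_empty Φ
  obtain ⟨g, rfl⟩ := dependsOn_iff_exists_comp.1 hΦ
  exact (measurable_of_countable g).comp (measurable_pi_lambda _ fun i => measurable_pi_apply i.1)

/-- The sequence of labels along the orbit of a point. -/
def labelSeq (T : X → X) (ζ : X → ℕ) (z : X) : ℕ → ℕ := fun i => ζ (T^[i] z)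

lemma labelSeq_iterate (T : X → X) (ζ : X → ℕ) (z : X) (j : ℕ) :
    labelSeq T ζ (T^[j] z) = fun i => labelSeq T ζ z (i + j) := by
  funext i
  simp only [labelSeq, Function.iterate_add_apply]

variable [MeasurableSpace X] {T : X → X} {ζ : X → ℕ} {ν : Measure X}

lemma measurable_labelSeq (hT : Measurable T) (hζ : Measurable ζ) : Measurable (labelSeq T ζ) :=
  measurable_pi_lambda _ fun i => hζ.comp (hT.iterate i)

/-- The set of label sequences `S` predicts the event `T^k z ∈ E` from the first `L` labels of the
orbit of `z`, up to an error of measure at most `δ`. -/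
structure IsWindowPrediction (T : X → X) (ζ : X → ℕ) (ν : Measure X) (E : Set X) (δ : ℝ≥0∞)
    (k L : ℕ) (S : Set (ℕ → ℕ)) : Prop where
  dependsOn : DependsOn (· ∈ S) (Iio L)
  measure_symmDiff_le : ν (symmDiff (T^[k] ⁻¹' E) (labelSeq T ζ ⁻¹' S)) ≤ δ

/-- After some iterate of `T`, the set `E` can be read off a finite window of labels, up to
arbitrarily small measure. Since `T` preserves `ν` in the applications, this is insensitive to
replacing `E` by `T⁻¹ E`. -/
structure IsWindowApproximable (T : X → X) (ζ : X → ℕ) (ν : Measure X) (E : Set X) : Prop where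
  measurableSet : MeasurableSet E
  exists_prediction : ∀ δ : ℝ≥0∞, 0 < δ → ∃ k L S, IsWindowPrediction T ζ ν E δ k L S

variable {E E' : Set X}

lemma IsWindowPrediction.shift {δ : ℝ≥0∞} {k L : ℕ} {S : Set (ℕ → ℕ)}
    (h : IsWindowPrediction T ζ ν E δ k L S) (hT : MeasurePreserving T ν ν) (hζ : Measurable ζ)
    (hE : MeasurableSet E) (j : ℕ) :
    IsWindowPrediction T ζ ν E δ (k + j) (L + j) {a | (fun i => a (i + j)) ∈ S} where
  dependsOn a b hab := h.dependsOn fun i hi => hab _ (Nat.add_lt_add_right hi j)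
  measure_symmDiff_le := by
    have hS : MeasurableSet S :=
      measurableSet_setOfPred.2 (measurable_of_dependsOn_finite h.dependsOn)
    have hshift : symmDiff (T^[k + j] ⁻¹' E) (labelSeq T ζ ⁻¹' {a | (fun i => a (i + j)) ∈ S}) =
        T^[j] ⁻¹' symmDiff (T^[k] ⁻¹' E) (labelSeq T ζ ⁻¹' S) := by
      ext z
      simp only [mem_symmDiff, mem_preimage, mem_ofPred_eq, labelSeq_iterate,
        Function.iterate_add_apply]
    have hmeas : MeasurableSet (symmDiff (T^[k] ⁻¹' E) (labelSeq T ζ ⁻¹' S)) :=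
      (hT.measurable.iterate k hE).symmDiff (measurable_labelSeq hT.measurable hζ hS)
    rw [hshift, (hT.iterate j).measure_preimage hmeas.nullMeasurableSet]
    exact h.measure_symmDiff_le

namespace IsWindowApproximable

lemma exists_common_window {ι : Type*} [Finite ι] {E : ι → Set X}
    (hE : ∀ c, IsWindowApproximable T ζ ν (E c)) (hT : MeasurePreserving T ν ν)
    (hζ : Measurable ζ) {δ : ℝ≥0∞} (hδ : 0 < δ) :
    ∃ (k L : ℕ) (S : ι → Set (ℕ → ℕ)), ∀ c, IsWindowPrediction T ζ ν (E c) δ k L (S c) := by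
  have := Fintype.ofFinite ι
  choose k L S hS using fun c => (hE c).exists_prediction δ hδ
  have hkK (c : ι) : k c ≤ ∑ c, k c :=
    Finset.single_le_sum (fun _ _ => Nat.zero_le _) (Finset.mem_univ c)
  have hLN (c : ι) : L c ≤ ∑ c, L c :=
    Finset.single_le_sum (fun _ _ => Nat.zero_le _) (Finset.mem_univ c)
  refine ⟨∑ c, k c, ∑ c, L c + ∑ c, k c,
    fun c => {a | (fun i => a (i + (∑ c, k c - k c))) ∈ S c}, fun c => ?_⟩
  have hshift := (hS c).shift hT hζ (hE c).measurableSet (∑ c, k c - k c)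
  rw [Nat.add_sub_cancel' (hkK c)] at hshift
  exact ⟨hshift.dependsOn.mono (Iio_subset_Iio (add_le_add (hLN c) (Nat.sub_le _ _))),
    hshift.measure_symmDiff_le⟩

lemma congr_ae (hE : IsWindowApproximable T ζ ν E) (hT : MeasurePreserving T ν ν)
    (hE' : MeasurableSet E') (h : E =ᵐ[ν] E') : IsWindowApproximable T ζ ν E' := by
  refine ⟨hE', fun δ hδ => ?_⟩
  obtain ⟨k, L, S, hS⟩ := hE.exists_prediction δ hδ
  refine ⟨k, L, S, hS.dependsOn, le_of_eq_of_le (measure_congr ?_) hS.measure_symmDiff_le⟩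
  exact ((hT.iterate k).quasiMeasurePreserving.preimage_ae_eq h).symm.symmDiff (ae_eq_refl _)

lemma compl (hE : IsWindowApproximable T ζ ν E) : IsWindowApproximable T ζ ν Eᶜ := by
  refine ⟨hE.measurableSet.compl, fun δ hδ => ?_⟩
  obtain ⟨k, L, S, hS⟩ := hE.exists_prediction δ hδ
  refine ⟨k, L, Sᶜ, fun a b hab => congrArg Not (hS.dependsOn hab), ?_⟩
  rw [preimage_compl, preimage_compl, compl_symmDiff_compl]
  exact hS.measure_symmDiff_le

lemma union (hE : IsWindowApproximable T ζ ν E) (hE' : IsWindowApproximable T ζ ν E')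
    (hT : MeasurePreserving T ν ν) (hζ : Measurable ζ) :
    IsWindowApproximable T ζ ν (E ∪ E') := by
  refine ⟨hE.measurableSet.union hE'.measurableSet, fun δ hδ => ?_⟩
  obtain ⟨k, L, S, hS⟩ := exists_common_window (E := fun b => cond b E E')
    (Bool.forall_bool.2 ⟨hE', hE⟩) hT hζ (ENNReal.half_pos hδ.ne')
  refine ⟨k, L, S true ∪ S false, fun a b hab =>
    congrArg₂ Or ((hS true).dependsOn hab) ((hS false).dependsOn hab), ?_⟩
  calc ν (symmDiff (T^[k] ⁻¹' (E ∪ E')) (labelSeq T ζ ⁻¹' (S true ∪ S false)))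
      ≤ ν (symmDiff (T^[k] ⁻¹' E) (labelSeq T ζ ⁻¹' S true) ∪
          symmDiff (T^[k] ⁻¹' E') (labelSeq T ζ ⁻¹' S false)) := by
        refine measure_mono fun z hz => ?_
        simp only [mem_symmDiff, mem_preimage, mem_union] at hz ⊢
        tauto
    _ ≤ δ / 2 + δ / 2 := (measure_union_le _ _).trans
        (add_le_add (hS true).measure_symmDiff_le (hS false).measure_symmDiff_le)
    _ = δ := ENNReal.add_halves δ

lemma inter (hE : IsWindowApproximable T ζ ν E) (hE' : IsWindowApproximable T ζ ν E')
    (hT : MeasurePreserving T ν ν) (hζ : Measurable ζ) :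
    IsWindowApproximable T ζ ν (E ∩ E') := by
  simpa only [← compl_inter, compl_compl] using (hE.compl.union hE'.compl hT hζ).compl

lemma accumulate {E : ℕ → Set X} (hE : ∀ n, IsWindowApproximable T ζ ν (E n))
    (hT : MeasurePreserving T ν ν) (hζ : Measurable ζ) (n : ℕ) :
    IsWindowApproximable T ζ ν (Set.accumulate E n) := by
  induction n with
  | zero => simpa only [Set.accumulate_zero_nat] using hE 0
  | succ n ih =>
    rw [Set.accumulate_succ]
    exact ih.union (hE _) hT hζ

lemma iUnion [IsFiniteMeasure ν] {E : ℕ → Set X} (hE : ∀ n, IsWindowApproximable T ζ ν (E n))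
    (hT : MeasurePreserving T ν ν) (hζ : Measurable ζ) :
    IsWindowApproximable T ζ ν (⋃ n, E n) := by
  have hacc := accumulate hE hT hζ
  have hunion : MeasurableSet (⋃ n, E n) := MeasurableSet.iUnion fun n => (hE n).measurableSet
  have hrest (n : ℕ) : NullMeasurableSet ((⋃ n, E n) \ Set.accumulate E n) ν :=
    (hunion.diff (hacc n).measurableSet).nullMeasurableSet
  refine ⟨hunion, fun δ hδ => ?_⟩
  have hlim : Tendsto (fun n => ν ((⋃ n, E n) \ Set.accumulate E n)) atTop (𝓝 0) := by
    have hempty : ⋂ n, ((⋃ n, E n) \ Set.accumulate E n) = ∅ := by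
      rw [← sdiff_iUnion, Set.iUnion_accumulate, sdiff_self]
    rw [← measure_empty (μ := ν), ← hempty]
    exact tendsto_measure_iInter_atTop hrest
      (fun i j hij => sdiff_subset_sdiff_right (Set.monotone_accumulate hij))
      ⟨0, measure_ne_top _ _⟩
  obtain ⟨n, hn⟩ := ((tendsto_order.1 hlim).2 _ (ENNReal.half_pos hδ.ne')).exists
  obtain ⟨k, L, S, hS⟩ := (hacc n).exists_prediction (δ / 2) (ENNReal.half_pos hδ.ne')
  refine ⟨k, L, S, hS.dependsOn, ?_⟩
  have hrestle : ν (T^[k] ⁻¹' ((⋃ n, E n) \ Set.accumulate E n)) ≤ δ / 2 := by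
    rw [(hT.iterate k).measure_preimage (hrest n)]
    exact hn.le
  calc ν (symmDiff (T^[k] ⁻¹' (⋃ n, E n)) (labelSeq T ζ ⁻¹' S))
      ≤ ν (symmDiff (T^[k] ⁻¹' Set.accumulate E n) (labelSeq T ζ ⁻¹' S) ∪
          T^[k] ⁻¹' ((⋃ n, E n) \ Set.accumulate E n)) := by
        refine measure_mono fun z hz => ?_
        have hsub : T^[k] z ∈ Set.accumulate E n → T^[k] z ∈ ⋃ n, E n := fun h =>
          Set.accumulate_subset_iUnion n h
        simp only [mem_symmDiff, mem_preimage, mem_union, Set.mem_sdiff] at hz ⊢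
        tauto
    _ ≤ δ / 2 + δ / 2 := (measure_union_le _ _).trans (add_le_add hS.measure_symmDiff_le hrestle)
    _ = δ := ENNReal.add_halves δ

lemma preimage (hE : IsWindowApproximable T ζ ν E) (hT : MeasurePreserving T ν ν)
    (hζ : Measurable ζ) (j : ℕ) : IsWindowApproximable T ζ ν (T^[j] ⁻¹' E) := by
  refine ⟨hT.measurable.iterate j hE.measurableSet, fun δ hδ => ?_⟩
  obtain ⟨k, L, S, hS⟩ := hE.exists_prediction δ hδ
  obtain ⟨hdep, hle⟩ := hS.shift hT hζ hE.measurableSet j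
  refine ⟨k, L + j, _, hdep, ?_⟩
  rwa [← preimage_comp, ← Function.iterate_add, add_comm]

lemma of_preimage (hE : MeasurableSet E) {j : ℕ}
    (h : IsWindowApproximable T ζ ν (T^[j] ⁻¹' E)) : IsWindowApproximable T ζ ν E := by
  refine ⟨hE, fun δ hδ => ?_⟩
  obtain ⟨k, L, S, hdep, hle⟩ := h.exists_prediction δ hδ
  refine ⟨j + k, L, S, hdep, ?_⟩
  rwa [← preimage_comp, ← Function.iterate_add] at hle

lemma label (hζ : Measurable ζ) (n : ℕ) : IsWindowApproximable T ζ ν (ζ ⁻¹' {n}) := by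
  refine ⟨hζ (measurableSet_singleton n), fun δ _ => ⟨0, 1, {a | a 0 = n}, fun a b hab => ?_, ?_⟩⟩
  · simp only [mem_ofPred_eq, hab 0 (mem_Iio.2 one_pos)]
  · have hsame : symmDiff (T^[0] ⁻¹' (ζ ⁻¹' {n})) (labelSeq T ζ ⁻¹' {a | a 0 = n}) = ∅ :=
      symmDiff_eq_bot.2 rfl
    rw [hsame, measure_empty]
    exact zero_le

end IsWindowApproximable

lemma exists_windowFunction {ι : Type*} [Finite ι] [Nonempty ι] (hT : MeasurePreserving T ν ν)
    (hζ : Measurable ζ) {ξ : X → ι} (hξ : ∀ c, IsWindowApproximable T ζ ν (ξ ⁻¹' {c})) {ε : ℝ≥0∞}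
    (hε : 0 < ε) :
    ∃ (k L : ℕ) (Φ : (ℕ → ℕ) → ι), DependsOn Φ (Iio L) ∧
      ν {z | ξ (T^[k] z) ≠ Φ (labelSeq T ζ z)} ≤ ε := by
  have := Fintype.ofFinite ι
  obtain ⟨k, L, S, hS⟩ := IsWindowApproximable.exists_common_window hξ hT hζ
    (ENNReal.div_pos hε.ne' (ENNReal.natCast_ne_top (Fintype.card ι)))
  refine ⟨k, L, fun a => Classical.epsilon fun c => a ∈ S c, fun a b hab => ?_, ?_⟩
  · exact congrArg Classical.epsilon (funext fun c => (hS c).dependsOn hab)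
  have hsub : {z | ξ (T^[k] z) ≠ Classical.epsilon fun c => labelSeq T ζ z ∈ S c} ⊆
      ⋃ c, symmDiff (T^[k] ⁻¹' (ξ ⁻¹' {c})) (labelSeq T ζ ⁻¹' S c) := by
    intro z hz
    by_contra hcon
    simp only [mem_iUnion, not_exists, mem_symmDiff, mem_preimage, mem_singleton_iff] at hcon
    have hmem (c : ι) : labelSeq T ζ z ∈ S c ↔ ξ (T^[k] z) = c := by
      have := hcon c
      tauto
    exact hz ((hmem _).1 (Classical.epsilon_spec (p := fun c => labelSeq T ζ z ∈ S c)
      ⟨ξ (T^[k] z), (hmem _).2 rfl⟩))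
  calc ν {z | ξ (T^[k] z) ≠ Classical.epsilon fun c => labelSeq T ζ z ∈ S c}
      ≤ ∑ c, ν (symmDiff (T^[k] ⁻¹' (ξ ⁻¹' {c})) (labelSeq T ζ ⁻¹' S c)) :=
        (measure_mono hsub).trans (measure_iUnion_fintype_le _ _)
    _ ≤ ∑ _c : ι, ε / Fintype.card ι := Finset.sum_le_sum fun c _ => (hS c).measure_symmDiff_le
    _ = ε := by
        rw [Finset.sum_const, Finset.card_univ, nsmul_eq_mul, ENNReal.mul_div_cancel
          (Nat.cast_ne_zero.2 Fintype.card_ne_zero) (ENNReal.natCast_ne_top _)]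

end Window

/-! ### An upper bound for the entropy from a reference measure on label sequences -/

section GibbsInequality

variable {ι : Type*} [Fintype ι]

lemma negMulLog_le_mul_neg_log_add_sub {p q : ℝ} (hp : 0 ≤ p) (hq : 0 < q) :
    Real.negMulLog p ≤ p * -Real.log q + (q - p) := by
  rcases hp.eq_or_lt with rfl | hp
  · simpa using hq.le
  have hlog := mul_le_mul_of_nonneg_left (Real.log_le_sub_one_of_pos (div_pos hq hp)) hp.le
  rw [Real.log_div hq.ne' hp.ne', mul_sub, mul_sub, mul_div_cancel₀ _ hp.ne'] at hlog
  rw [Real.negMulLog]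
  linarith

lemma sum_negMulLog_le_sum_mul_neg_log {p q : ι → ℝ} (hp : ∀ a, 0 ≤ p a)
    (hq : ∀ a, 0 < q a) (hqp : ∑ a, q a ≤ ∑ a, p a) :
    ∑ a, Real.negMulLog (p a) ≤ ∑ a, p a * -Real.log (q a) := by
  have hle := Finset.sum_le_sum fun a (_ : a ∈ Finset.univ) =>
    negMulLog_le_mul_neg_log_add_sub (hp a) (hq a)
  rw [Finset.sum_add_distrib, Finset.sum_sub_distrib] at hle
  linarith

lemma partitionEntropy_le_integral_neg_log {X : Type*} [MeasurableSpace X] {ν : Measure X}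
    [IsProbabilityMeasure ν] [MeasurableSpace ι] [MeasurableSingletonClass ι] {Y : X → ι}
    (hY : Measurable Y) {q : ι → ℝ} (hq : ∀ a, 0 < q a) (hqle : ∑ a, q a ≤ 1) :
    partitionEntropy ν Y ≤ ∫ z, -Real.log (q (Y z)) ∂ν := by
  have hreal (a : ι) : (ν.map Y).real {a} = ν.real (Y ⁻¹' {a}) :=
    map_measureReal_apply hY (measurableSet_singleton a)
  have : IsProbabilityMeasure (ν.map Y) := Measure.isProbabilityMeasure_map hY.aemeasurable
  have hsum : ∑ a, ν.real (Y ⁻¹' {a}) = 1 := by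
    simp_rw [← hreal, sum_measureReal_singleton, Finset.coe_univ, probReal_univ]
  calc partitionEntropy ν Y
      ≤ ∑ a, ν.real (Y ⁻¹' {a}) * -Real.log (q a) :=
        sum_negMulLog_le_sum_mul_neg_log (fun _ => measureReal_nonneg) hq (hqle.trans_eq hsum.symm)
    _ = ∫ a, -Real.log (q a) ∂(ν.map Y) := by
        simp only [integral_fintype Integrable.of_finite, hreal, smul_eq_mul]
    _ = ∫ z, -Real.log (q (Y z)) ∂ν :=
        integral_map hY.aemeasurable (measurable_of_finite _).aestronglyMeasurable

end GibbsInequality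

section WindowWeight

variable {ι : Type*} [Fintype ι] [DecidableEq ι] {δ : ℝ}

/-- The weight given to the symbol `a` when `b` is predicted: the prediction fails with probability
at most `δ`, and then all symbols are equally likely. -/
noncomputable def errorWeight (δ : ℝ) (a b : ι) : ℝ :=
  if a = b then 1 - δ else δ / Fintype.card ι

lemma errorWeight_pos (hδ₀ : 0 < δ) (hδ₁ : δ < 1) (a b : ι) : 0 < errorWeight δ a b := by
  have : Nonempty ι := ⟨a⟩
  unfold errorWeight
  split_ifs
  · linarith
  · positivity

lemma sum_errorWeight_le_one (hδ₀ : 0 ≤ δ) (b : ι) : ∑ a, errorWeight δ a b ≤ 1 := by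
  have : Nonempty ι := ⟨b⟩
  have hcard : (Fintype.card ι : ℝ) ≠ 0 := Nat.cast_ne_zero.2 Fintype.card_ne_zero
  have hle (a : ι) : errorWeight δ a b ≤ δ / Fintype.card ι + if a = b then 1 - δ else 0 := by
    unfold errorWeight
    split_ifs
    · exact le_add_of_nonneg_left (by positivity)
    · rw [add_zero]
  calc ∑ a, errorWeight δ a b ≤ ∑ a, (δ / Fintype.card ι + if a = b then 1 - δ else 0) :=
        Finset.sum_le_sum fun a _ => hle a
    _ = 1 := by
        rw [Finset.sum_add_distrib, Finset.sum_const, Finset.sum_ite_eq' Finset.univ b,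
          if_pos (Finset.mem_univ b), Finset.card_univ, nsmul_eq_mul, mul_div_cancel₀ _ hcard]
        ring

lemma neg_log_errorWeight_le (hδ₀ : 0 ≤ δ) (hδ₁ : δ < 1) (a b : ι) :
    -Real.log (errorWeight δ a b) ≤
      -Real.log (1 - δ) + if a = b then 0 else Real.log (Fintype.card ι / δ) := by
  unfold errorWeight
  split_ifs
  · rw [add_zero]
  · rw [← Real.log_inv, inv_div]
    exact le_add_of_nonneg_left
      (neg_nonneg.2 (Real.log_nonpos (by linarith) (by linarith)))

variable {n : ℕ} {Φ : (ℕ → ℕ) → ι}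

/-- The weight given to the word `x` when its letters are predicted by the windows of the label
sequence `a`. -/
noncomputable def windowWeight (δ : ℝ) (Φ : (ℕ → ℕ) → ι) (x : Fin n → ι) (a : ℕ → ℕ) : ℝ :=
  ∏ i : Fin n, errorWeight δ (x i) (Φ fun j => a (j + i))

lemma windowWeight_pos (hδ₀ : 0 < δ) (hδ₁ : δ < 1) (x : Fin n → ι) (a : ℕ → ℕ) :
    0 < windowWeight δ Φ x a :=
  Finset.prod_pos fun _ _ => errorWeight_pos hδ₀ hδ₁ _ _

lemma sum_windowWeight_le_one (hδ₀ : 0 < δ) (hδ₁ : δ < 1) (a : ℕ → ℕ) :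
    ∑ x : Fin n → ι, windowWeight δ Φ x a ≤ 1 := by
  have hprod : ∑ x : Fin n → ι, windowWeight δ Φ x a =
      ∏ i : Fin n, ∑ c, errorWeight δ c (Φ fun j => a (j + i)) := by
    rw [Finset.prod_univ_sum, Fintype.piFinset_univ]
    rfl
  rw [hprod]
  exact Finset.prod_le_one
    (fun i _ => Finset.sum_nonneg fun c _ => (errorWeight_pos hδ₀ hδ₁ _ _).le)
    fun i _ => sum_errorWeight_le_one hδ₀.le _

lemma windowWeight_le_one (hδ₀ : 0 < δ) (hδ₁ : δ < 1) (x : Fin n → ι) (a : ℕ → ℕ) :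
    windowWeight δ Φ x a ≤ 1 :=
  (Finset.single_le_sum (fun y _ => (windowWeight_pos hδ₀ hδ₁ y a).le) (Finset.mem_univ x)).trans
    (sum_windowWeight_le_one hδ₀ hδ₁ a)

lemma dependsOn_windowWeight {L : ℕ} (hΦ : DependsOn Φ (Iio L)) (x : Fin n → ι) :
    DependsOn (windowWeight δ Φ x) (Iio (n + L)) := by
  refine fun a b hab => Finset.prod_congr rfl fun i _ => congrArg _ (hΦ fun j hj => hab _ ?_)
  rw [mem_Iio] at hj ⊢
  lia

variable {κ : Measure (ℕ → ℕ)} [IsProbabilityMeasure κ] {L : ℕ}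

lemma integrable_windowWeight (hδ₀ : 0 < δ) (hδ₁ : δ < 1) (hΦ : DependsOn Φ (Iio L))
    (x : Fin n → ι) : Integrable (windowWeight δ Φ x) κ :=
  .of_bound (measurable_of_dependsOn_finite (dependsOn_windowWeight hΦ x)).aestronglyMeasurable 1
    (ae_of_all _ fun a => by
      rw [Real.norm_of_nonneg (windowWeight_pos hδ₀ hδ₁ x a).le]
      exact windowWeight_le_one hδ₀ hδ₁ x a)

lemma integral_windowWeight_pos (hδ₀ : 0 < δ) (hδ₁ : δ < 1) (hΦ : DependsOn Φ (Iio L))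
    (x : Fin n → ι) : 0 < ∫ a, windowWeight δ Φ x a ∂κ := by
  refine (integral_pos_iff_support_of_nonneg (fun a => (windowWeight_pos hδ₀ hδ₁ x a).le)
    (integrable_windowWeight hδ₀ hδ₁ hΦ x)).2 ?_
  have hsupport : Function.support (windowWeight δ Φ x) = univ :=
    eq_univ_of_forall fun a => (windowWeight_pos hδ₀ hδ₁ x a).ne'
  rw [hsupport, measure_univ]
  exact one_pos

lemma sum_integral_windowWeight_le_one (hδ₀ : 0 < δ) (hδ₁ : δ < 1) (hΦ : DependsOn Φ (Iio L)) :
    ∑ x : Fin n → ι, ∫ a, windowWeight δ Φ x a ∂κ ≤ 1 := by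
  have hint (x : Fin n → ι) := integrable_windowWeight (κ := κ) hδ₀ hδ₁ hΦ x
  calc ∑ x : Fin n → ι, ∫ a, windowWeight δ Φ x a ∂κ
      = ∫ a, ∑ x : Fin n → ι, windowWeight δ Φ x a ∂κ :=
        (integral_finsetSum _ fun x _ => hint x).symm
    _ ≤ ∫ _, (1 : ℝ) ∂κ := integral_mono (integrable_finsetSum _ fun x _ => hint x)
        (integrable_const _) (sum_windowWeight_le_one hδ₀ hδ₁)
    _ = 1 := by rw [integral_const, probReal_univ, one_smul]

lemma cylinder_mul_windowWeight_le_integral (hδ₀ : 0 < δ) (hδ₁ : δ < 1)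
    (hΦ : DependsOn Φ (Iio L)) {N : ℕ} (hN : n + L ≤ N) (x : Fin n → ι) (b : ℕ → ℕ) :
    κ.real (PiNat.cylinder b N) * windowWeight δ Φ x b ≤ ∫ a, windowWeight δ Φ x a ∂κ := by
  have hcyl : MeasurableSet (PiNat.cylinder b N) := (PiNat.isOpen_cylinder _ b N).measurableSet
  calc κ.real (PiNat.cylinder b N) * windowWeight δ Φ x b
      = ∫ a in PiNat.cylinder b N, windowWeight δ Φ x a ∂κ := by
        rw [setIntegral_congr_fun (g := fun _ => windowWeight δ Φ x b) hcyl
          fun a ha => dependsOn_windowWeight hΦ x fun i hi => ha i (lt_of_lt_of_le hi hN),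
          setIntegral_const, smul_eq_mul]
    _ ≤ ∫ a, windowWeight δ Φ x a ∂κ :=
        setIntegral_le_integral (integrable_windowWeight hδ₀ hδ₁ hΦ x)
          (ae_of_all _ fun a => (windowWeight_pos hδ₀ hδ₁ x a).le)

lemma neg_log_windowWeight_labelSeq_le (hδ₀ : 0 < δ) (hδ₁ : δ < 1) {X : Type*} (T : X → X)
    (ζ : X → ℕ) (ξ : X → ι) (k : ℕ) (z : X) :
    -Real.log (windowWeight δ Φ (itinerary T ξ n (T^[k] z)) (labelSeq T ζ z)) ≤
      ∑ i ∈ Finset.range n, (-Real.log (1 - δ) +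
        {z | ξ (T^[k] z) ≠ Φ (labelSeq T ζ z)}.indicator
          (fun _ => Real.log (Fintype.card ι / δ)) (T^[i] z)) := by
  rw [windowWeight, Real.log_prod fun _ _ => (errorWeight_pos hδ₀ hδ₁ _ _).ne',
    ← Finset.sum_neg_distrib, Finset.sum_range]
  refine Finset.sum_le_sum fun i _ => ?_
  rw [← labelSeq_iterate, itinerary, (Function.Commute.iterate_iterate_self T i k).eq]
  refine (neg_log_errorWeight_le hδ₀.le hδ₁ _ _).trans_eq ?_
  simp only [indicator_apply, mem_ofPred_eq, ne_eq, ite_not]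

end WindowWeight

section WindowEntropy

variable {X ι : Type*} [MeasurableSpace X] {ν : Measure X} [IsProbabilityMeasure ν] {T : X → X}

lemma integrable_sum_const_add_indicator_iterate (hT : MeasurePreserving T ν ν) {B : Set X}
    (hB : MeasurableSet B) (n : ℕ) (c d : ℝ) :
    Integrable (fun z => ∑ i ∈ Finset.range n, (c + B.indicator (fun _ => d) (T^[i] z))) ν :=
  integrable_finsetSum _ fun i _ => (integrable_const _).add
    ((hT.iterate i).integrable_comp_of_integrable ((integrable_const _).indicator hB))

lemma integral_sum_const_add_indicator_iterate (hT : MeasurePreserving T ν ν) {B : Set X}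
    (hB : MeasurableSet B) (n : ℕ) (c d : ℝ) :
    ∫ z, ∑ i ∈ Finset.range n, (c + B.indicator (fun _ => d) (T^[i] z)) ∂ν =
      n * (c + ν.real B * d) := by
  have hint (i : ℕ) : Integrable (fun z => B.indicator (fun _ => d) (T^[i] z)) ν :=
    (hT.iterate i).integrable_comp_of_integrable ((integrable_const _).indicator hB)
  have hsummand (i : ℕ) : Integrable (fun z => c + B.indicator (fun _ => d) (T^[i] z)) ν :=
    (integrable_const _).add (hint i)
  rw [integral_finsetSum _ fun i _ => hsummand i]
  have hterm (i : ℕ) : ∫ z, (c + B.indicator (fun _ => d) (T^[i] z)) ∂ν = c + ν.real B * d := by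
    rw [integral_add (integrable_const _) (hint i), integral_const, probReal_univ, one_smul,
      integral_comp_of_measurePreserving (hT.iterate i)
        (stronglyMeasurable_const.indicator hB).aestronglyMeasurable,
      integral_indicator hB, setIntegral_const, smul_eq_mul]
  simp only [hterm, Finset.sum_const, Finset.card_range, nsmul_eq_mul]

-- Gibbs' inequality, the reference weight of a word being the `κ`-average of its window weights.
lemma partitionEntropy_le_of_window [Fintype ι] [MeasurableSpace ι] [MeasurableSingletonClass ι]
    (hT : MeasurePreserving T ν ν) {ζ : X → ℕ} (hζ : Measurable ζ) {ξ : X → ι} (hξ : Measurable ξ)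
    {κ : Measure (ℕ → ℕ)} [IsProbabilityMeasure κ] {N n k L : ℕ} (hN : n + L ≤ N) {G : X → ℝ}
    (hG : Integrable G ν)
    (hκ : ∀ᵐ z ∂ν, Real.exp (-G z) ≤ κ.real (PiNat.cylinder (labelSeq T ζ z) N))
    {Φ : (ℕ → ℕ) → ι} (hΦ : DependsOn Φ (Iio L)) {δ : ℝ} (hδ₀ : 0 < δ) (hδ₁ : δ < 1) :
    partitionEntropy ν (fun z => itinerary T ξ n (T^[k] z)) ≤
      ∫ z, G z ∂ν + n * (-Real.log (1 - δ) +
        ν.real {z | ξ (T^[k] z) ≠ Φ (labelSeq T ζ z)} * Real.log (Fintype.card ι / δ)) := by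
  classical
  set bad : Set X := {z | ξ (T^[k] z) ≠ Φ (labelSeq T ζ z)}
  have hbad : MeasurableSet bad := (measurableSet_eq_fun (hξ.comp (hT.measurable.iterate k))
    ((measurable_of_dependsOn_finite hΦ).comp (measurable_labelSeq hT.measurable hζ))).compl
  let q : (Fin n → ι) → ℝ := fun x => ∫ a, windowWeight δ Φ x a ∂κ
  have hq : ∀ x, 0 < q x := integral_windowWeight_pos hδ₀ hδ₁ hΦ
  let Y : X → Fin n → ι := fun z => itinerary T ξ n (T^[k] z)
  have hY : Measurable Y :=
    (measurable_itinerary hT.measurable hξ n).comp (hT.measurable.iterate k)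
  have hle : ∀ᵐ z ∂ν, -Real.log (q (Y z)) ≤ G z + ∑ i ∈ Finset.range n,
      (-Real.log (1 - δ) + bad.indicator (fun _ => Real.log (Fintype.card ι / δ)) (T^[i] z)) := by
    filter_upwards [hκ] with z hz
    have hweight : 0 < windowWeight δ Φ (Y z) (labelSeq T ζ z) := windowWeight_pos hδ₀ hδ₁ _ _
    have hqle : Real.exp (-G z) * windowWeight δ Φ (Y z) (labelSeq T ζ z) ≤ q (Y z) :=
      (mul_le_mul_of_nonneg_right hz hweight.le).trans
        (cylinder_mul_windowWeight_le_integral hδ₀ hδ₁ hΦ hN _ _)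
    have hlog := Real.log_le_log (mul_pos (Real.exp_pos _) hweight) hqle
    rw [Real.log_mul (Real.exp_pos _).ne' hweight.ne', Real.log_exp] at hlog
    have hwindow := neg_log_windowWeight_labelSeq_le (n := n) (Φ := Φ) hδ₀ hδ₁ T ζ ξ k z
    linarith
  have hlogint : Integrable (fun z => -Real.log (q (Y z))) ν := by
    have : IsProbabilityMeasure (ν.map Y) := Measure.isProbabilityMeasure_map hY.aemeasurable
    exact (Integrable.of_finite (μ := ν.map Y) (f := fun x => -Real.log (q x))).comp_measurable hY
  have hsumint := integrable_sum_const_add_indicator_iterate hT hbad n (-Real.log (1 - δ))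
    (Real.log (Fintype.card ι / δ))
  calc partitionEntropy ν Y ≤ ∫ z, -Real.log (q (Y z)) ∂ν :=
        partitionEntropy_le_integral_neg_log hY hq (sum_integral_windowWeight_le_one hδ₀ hδ₁ hΦ)
    _ ≤ ∫ z, (G z + ∑ i ∈ Finset.range n, (-Real.log (1 - δ) +
          bad.indicator (fun _ => Real.log (Fintype.card ι / δ)) (T^[i] z))) ∂ν :=
        integral_mono_ae hlogint (hG.add hsumint) hle
    _ = _ := by
        rw [integral_add hG hsumint, integral_sum_const_add_indicator_iterate hT hbad]

end WindowEntropy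

/-! ### Label sequences on towers -/

section TowerIntegral

variable {M : Type*} {R : M → ℕ}

lemma sum_comp_towerLift {α : Type*} [AddCommMonoid α] (hR₀ : ∀ x, 0 < R x) (ψ : M → ℝ)
    {φ : ℝ → α} (hφ : φ 0 = 0) (x : M) :
    ∑ l ∈ Finset.range (R x), φ (towerLift ψ (x, l)) = φ (ψ x) := by
  rw [Finset.sum_eq_single_of_mem 0 (Finset.mem_range.2 (hR₀ x))]
  · exact congrArg φ (if_pos rfl)
  · intro l _ hl
    exact (congrArg φ (if_neg hl)).trans hφ

variable [MeasurableSpace M] {ν : Measure M}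

lemma integral_towerMeasure (hR : Measurable R) {g : M × ℕ → ℝ} (hg : Measurable g)
    (hgi : Integrable g (towerMeasure R ν)) :
    ∫ z, g z ∂towerMeasure R ν = ∫ x, ∑ l ∈ Finset.range (R x), g (x, l) ∂ν := by
  have hlevel (l : ℕ) : MeasurableSet {x | l < R x} := measurableSet_lt measurable_const hR
  have hmap (l : ℕ) {h : M × ℕ → ℝ} (hh : Measurable h) :
      ∫ z, h z ∂(ν.restrict {x | l < R x}).map (fun x => (x, l)) =
        ∫ x, {x | l < R x}.indicator (fun x => h (x, l)) x ∂ν := by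
    rw [integral_map measurable_prodMk_right.aemeasurable hh.aestronglyMeasurable,
      integral_indicator (hlevel l)]
  have hint (l : ℕ) : Integrable ({x | l < R x}.indicator fun x => g (x, l)) ν := by
    rw [integrable_indicator_iff (hlevel l)]
    exact (hgi.mono_measure (Measure.le_sum _ l)).comp_measurable measurable_prodMk_right
  have hnorm : Summable fun l => ∫ x, ‖{x | l < R x}.indicator (fun x => g (x, l)) x‖ ∂ν := by
    simp only [norm_indicator_eq_indicator_norm, ← hmap _ hg.norm]
    exact (hasSum_integral_measure hgi.norm).summable
  calc ∫ z, g z ∂towerMeasure R ν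
      = ∑' l, ∫ x, {x | l < R x}.indicator (fun x => g (x, l)) x ∂ν := by
        rw [towerMeasure, ← (hasSum_integral_measure hgi).tsum_eq]
        exact tsum_congr fun l => hmap l hg
    _ = ∫ x, ∑' l, {x | l < R x}.indicator (fun x => g (x, l)) x ∂ν :=
        integral_tsum_of_summable_integral_norm hint hnorm
    _ = ∫ x, ∑ l ∈ Finset.range (R x), g (x, l) ∂ν := by
        refine integral_congr_ae (ae_of_all _ fun x => ?_)
        dsimp only
        rw [tsum_eq_sum (s := Finset.range (R x))
          fun l hl => indicator_of_notMem (by simpa using hl) _]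
        exact Finset.sum_congr rfl fun l hl => indicator_of_mem (by simpa using hl) _

lemma integrable_towerMeasure_iff (hR : Measurable R) {g : M × ℕ → ℝ} (hg : Measurable g) :
    Integrable g (towerMeasure R ν) ↔
      ∫⁻ x, ∑ l ∈ Finset.range (R x), ‖g (x, l)‖ₑ ∂ν < ⊤ := by
  rw [← lintegral_towerMeasure hR (g := fun z => ‖g z‖ₑ) hg.enorm]
  exact ⟨fun h => h.2, fun h => ⟨hg.aestronglyMeasurable, h⟩⟩

lemma integrable_sum_towerMeasure (hR : Measurable R) {g : M × ℕ → ℝ} (hg : Measurable g)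
    (hgi : Integrable g (towerMeasure R ν)) :
    Integrable (fun x => ∑ l ∈ Finset.range (R x), g (x, l)) ν := by
  have hsum : Measurable fun z : M × ℕ => ∑ l ∈ Finset.range z.2, g (z.1, l) :=
    measurable_from_prod_countable_left fun n =>
      Finset.measurable_fun_sum (Finset.range n) fun _ _ => hg.comp measurable_prodMk_right
  refine ⟨(hsum.comp (measurable_id.prodMk hR)).aestronglyMeasurable, ?_⟩
  exact (lintegral_mono fun x => enorm_sum_le _ _).trans_lt
    ((integrable_towerMeasure_iff hR hg).1 hgi)

lemma integrable_towerMeasure_of_le_of_le_sum [IsFiniteMeasure ν]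
    [IsFiniteMeasure (towerMeasure R ν)] (hR : Measurable R) {g : M × ℕ → ℝ} (hg : Measurable g)
    {K L : ℝ} (hL : ∀ᵐ x ∂ν, ∀ l < R x, g (x, l) ≤ L)
    (hK : ∀ᵐ x ∂ν, K ≤ ∑ l ∈ Finset.range (R x), g (x, l)) :
    Integrable g (towerMeasure R ν) := by
  suffices hsub : Integrable (fun z => L - g z) (towerMeasure R ν) by
    simpa only [Pi.sub_def, sub_sub_cancel] using (integrable_const L).sub hsub
  have hbound : Integrable (fun x => (∑ _l ∈ Finset.range (R x), L) - K) ν :=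
    (integrable_sum_towerMeasure hR measurable_const (integrable_const L)).sub (integrable_const K)
  rw [integrable_towerMeasure_iff hR (hg.const_sub L)]
  refine (lintegral_mono_ae ?_).trans_lt hbound.lintegral_lt_top
  filter_upwards [hL, hK] with x hxL hxK
  have hnonneg : ∀ l ∈ Finset.range (R x), 0 ≤ L - g (x, l) := fun l hl =>
    sub_nonneg.2 (hxL l (Finset.mem_range.1 hl))
  calc ∑ l ∈ Finset.range (R x), ‖L - g (x, l)‖ₑ
      = ENNReal.ofReal (∑ l ∈ Finset.range (R x), (L - g (x, l))) := by
        rw [ENNReal.ofReal_sum_of_nonneg hnonneg]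
        exact Finset.sum_congr rfl fun l hl => Real.enorm_of_nonneg (hnonneg l hl)
    _ ≤ ENNReal.ofReal ((∑ _l ∈ Finset.range (R x), L) - K) := by
        rw [Finset.sum_sub_distrib]
        gcongr

lemma measurable_towerLift {ψ : M → ℝ} (hψ : Measurable ψ) : Measurable (towerLift ψ) :=
  Measurable.ite (measurable_snd (measurableSet_singleton 0)) (hψ.comp measurable_fst)
    measurable_const

variable {ψ : M → ℝ}

lemma integrable_towerLift (hR : Measurable R) (hR₀ : ∀ x, 0 < R x) (hψ : Measurable ψ)
    (hψi : Integrable ψ ν) : Integrable (towerLift ψ) (towerMeasure R ν) := by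
  rw [integrable_towerMeasure_iff hR (measurable_towerLift hψ)]
  simp only [sum_comp_towerLift hR₀ ψ (φ := fun t => ‖t‖ₑ) enorm_zero]
  exact hψi.2

lemma integral_towerLift (hR : Measurable R) (hR₀ : ∀ x, 0 < R x) (hψ : Measurable ψ)
    (hψi : Integrable ψ ν) : ∫ z, towerLift ψ z ∂towerMeasure R ν = ∫ x, ψ x ∂ν := by
  rw [integral_towerMeasure hR (measurable_towerLift hψ) (integrable_towerLift hR hR₀ hψ hψi)]
  exact integral_congr_ae (ae_of_all _ fun x => sum_comp_towerLift hR₀ ψ (φ := id) rfl x)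

end TowerIntegral

section TowerLabels

variable {M : Type*} {F : M → M} {idx : M → ℕ} {R : M → ℕ}

lemma base_index_eq_iUnion_returns {r : ℕ → ℕ} (hR₀ : ∀ x, 0 < r (idx x)) (i c : ℕ) :
    {z : M × ℕ | z.2 = 0 ∧ labelSeq F idx z.1 (i + 1) = c} =
      ⋃ b, towerLabel idx ⁻¹' {b + 1} ∩ (towerMap F (r ∘ idx))^[r b] ⁻¹'
        {z | z.2 = 0 ∧ labelSeq F idx z.1 i = c} := by
  have hroof (x : M) : (towerMap F (r ∘ idx))^[r (idx x)] (x, 0) = (F x, 0) :=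
    towerMap_iterate_roof (R := r ∘ idx) (hR₀ x)
  ext ⟨x, l⟩
  simp only [mem_ofPred_eq, mem_iUnion, mem_inter_iff, mem_preimage, mem_singleton_iff]
  constructor
  · rintro ⟨rfl, h⟩
    refine ⟨idx x, if_pos rfl, ?_⟩
    rw [hroof]
    exact ⟨rfl, h⟩
  · rintro ⟨b, hlabel, hreturn⟩
    rcases eq_or_ne l 0 with rfl | hl
    · obtain rfl : idx x = b := by simpa [towerLabel] using hlabel
      rw [hroof] at hreturn
      exact ⟨rfl, hreturn.2⟩
    · simp [towerLabel, hl] at hlabel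

variable [MeasurableSpace M] {ν : Measure (M × ℕ)}

lemma measurable_towerLabel (hidx : Measurable idx) : Measurable (towerLabel idx) :=
  Measurable.ite (measurable_snd (measurableSet_singleton 0))
    ((hidx.comp measurable_fst).add_const 1) measurable_const

lemma isWindowApproximable_base (hidx : Measurable idx) :
    IsWindowApproximable (towerMap F R) (towerLabel idx) ν {z | z.2 = 0} := by
  have hcompl : {z : M × ℕ | z.2 = 0} = (towerLabel idx ⁻¹' {0})ᶜ := by
    ext z
    by_cases h : z.2 = 0 <;> simp [towerLabel, h]
  rw [hcompl]
  exact (IsWindowApproximable.label (measurable_towerLabel hidx) 0).compl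

variable [IsFiniteMeasure ν]

lemma isWindowApproximable_base_index (hR : R.FactorsThrough idx) (hR₀ : ∀ x, 0 < R x)
    (hidx : Measurable idx) (hT : MeasurePreserving (towerMap F R) ν ν) (i c : ℕ) :
    IsWindowApproximable (towerMap F R) (towerLabel idx) ν
      {z | z.2 = 0 ∧ labelSeq F idx z.1 i = c} := by
  have hζ := measurable_towerLabel hidx
  obtain ⟨r, rfl⟩ := (Function.factorsThrough_iff R).1 hR
  induction i with
  | zero =>
    have hlabel : {z : M × ℕ | z.2 = 0 ∧ labelSeq F idx z.1 0 = c} =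
        towerLabel idx ⁻¹' {c + 1} := by
      ext z
      by_cases h : z.2 = 0 <;> simp [towerLabel, labelSeq, h]
    rw [hlabel]
    exact .label hζ _
  | succ i ih =>
    rw [base_index_eq_iUnion_returns hR₀]
    exact .iUnion (fun b => (IsWindowApproximable.label hζ _).inter (ih.preimage hT hζ _) hT hζ)
      hT hζ

lemma isWindowApproximable_base_inter (hR : R.FactorsThrough idx) (hR₀ : ∀ x, 0 < R x)
    (hidx : Measurable idx) (hT : MeasurePreserving (towerMap F R) ν ν) {S : Set (ℕ → ℕ)}
    (hS : MeasurableSet S) :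
    IsWindowApproximable (towerMap F R) (towerLabel idx) ν
      {z | z.2 = 0 ∧ labelSeq F idx z.1 ∈ S} := by
  have hζ := measurable_towerLabel hidx
  have hbase : IsWindowApproximable (towerMap F R) (towerLabel idx) ν {z | z.2 = 0} :=
    isWindowApproximable_base hidx
  let approx : MeasurableSpace (ℕ → ℕ) :=
    { MeasurableSet' S := IsWindowApproximable (towerMap F R) (towerLabel idx) ν
        {z | z.2 = 0 ∧ labelSeq F idx z.1 ∈ S}
      measurableSet_empty := by
        simpa only [inter_compl_self, mem_empty_iff_false, and_false, ofPred_false] using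
          hbase.inter hbase.compl hT hζ
      measurableSet_compl S hS := by
        convert hbase.inter hS.compl hT hζ using 1
        ext z
        simp only [mem_ofPred_eq, mem_inter_iff, mem_compl_iff]
        tauto
      measurableSet_iUnion S hS := by
        convert IsWindowApproximable.iUnion hS hT hζ using 1
        ext z
        simp only [mem_ofPred_eq, mem_iUnion, exists_and_left] }
  have hle : MeasurableSpace.pi ≤ approx := iSup_le fun i => measurable_iff_comap_le.1 <|
    measurable_to_countable' fun c => isWindowApproximable_base_index hR hR₀ hidx hT i c
  exact hle S hS

lemma isWindowApproximable_tower {ν₀ : Measure M} (hRm : Measurable R) (hR : R.FactorsThrough idx)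
    (hR₀ : ∀ x, 0 < R x) (hidx : Measurable idx) (hT : MeasurePreserving (towerMap F R) ν ν)
    (hν : ν ≪ towerMeasure R ν₀)
    (hgen : ∀ B, MeasurableSet B → ∃ S, MeasurableSet S ∧ B =ᵐ[ν₀] labelSeq F idx ⁻¹' S)
    {E : Set (M × ℕ)} (hE : MeasurableSet E) :
    IsWindowApproximable (towerMap F R) (towerLabel idx) ν E := by
  have hζ := measurable_towerLabel hidx
  have hlevel (l : ℕ) {B : Set M} (hB : MeasurableSet B) :
      MeasurableSet {z : M × ℕ | z.2 = l ∧ z.1 ∈ B} :=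
    (measurable_snd (measurableSet_singleton l)).inter (measurable_fst hB)
  have hbase {B : Set M} (hB : MeasurableSet B) :
      IsWindowApproximable (towerMap F R) (towerLabel idx) ν {z | z.2 = 0 ∧ z.1 ∈ B} := by
    obtain ⟨S, hS, hBS⟩ := hgen B hB
    refine (isWindowApproximable_base_inter hR hR₀ hidx hT hS).congr_ae hT (hlevel 0 hB) ?_
    filter_upwards [hν.ae_le (ae_towerMeasure_of_ae hRm hBS)] with z hz
    exact congrArg (z.2 = 0 ∧ ·) hz.1.symm
  have hslice (l : ℕ) : IsWindowApproximable (towerMap F R) (towerLabel idx) ν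
      {w : M × ℕ | w.2 = l ∧ w.1 ∈ {x | (x, l) ∈ E} ∧ l < R w.1} := by
    have hB : MeasurableSet ({x | (x, l) ∈ E} ∩ {x | l < R x}) :=
      (measurable_prodMk_right hE).inter (measurableSet_lt measurable_const hRm)
    refine .of_preimage (hlevel l hB) (j := l) ?_
    convert hbase hB using 1
    ext z
    exact towerMap_iterate_mem_level_iff
  refine (IsWindowApproximable.iUnion hslice hT hζ).congr_ae hT hE ?_
  filter_upwards [hν.ae_le (ae_towerMeasure_of_ae hRm (ae_of_all ν₀ fun _ => trivial))] with z hz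
  refine propext (mem_iUnion.trans ⟨?_, fun h => ⟨z.2, rfl, h, hz.2⟩⟩)
  rintro ⟨l, rfl, h, _⟩
  exact h

end TowerLabels

section DelayedLabels

variable {M : Type*} {F : M → M} {R idx : M → ℕ}

/-- The labels along the orbit of a point of the tower which enters the base at time `t`, in `y`. -/
def delayedLabelSeq (F : M → M) (R idx : M → ℕ) (t : ℕ) (y : M) : ℕ → ℕ := fun i =>
  if i < t then 0 else labelSeq (towerMap F R) (towerLabel idx) (y, 0) (i - t)

lemma exists_delayed_cylinder (hR : R.FactorsThrough idx) (hR₀ : ∀ x, 0 < R x) {z : M × ℕ}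
    (hz : z.2 < R z.1) (N : ℕ) (ψ : M → ℝ) :
    ∃ t ≤ N, ∃ y, (y = z.1 ∨ y = F z.1) ∧ ∃ j,
      ∑ i ∈ Finset.range N, towerLift ψ ((towerMap F R)^[i] z) =
        ∑ i ∈ Finset.range j, ψ (F^[i] y) ∧
      labelSeq F idx ⁻¹' PiNat.cylinder (labelSeq F idx y) j ⊆ delayedLabelSeq F R idx t ⁻¹'
        PiNat.cylinder (labelSeq (towerMap F R) (towerLabel idx) z) N := by
  obtain ⟨t, htN, y, hy, hpre, hpost⟩ := exists_first_visit (F := F) (idx := idx) hz N ψ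
  obtain ⟨j, hsum, hlabel⟩ := exists_returns_determine_labels (F := F) hR hR₀ ψ (N - t) y
  refine ⟨t, htN, y, hy, j, ?_, fun y' hy' i hi => ?_⟩
  · rw [← hsum, ← Finset.sum_range_add_sum_Ico _ htN,
      Finset.sum_eq_zero fun i hi => (hpre i (Finset.mem_range.1 hi)).2, zero_add,
      Finset.sum_Ico_eq_sum_range]
    refine Finset.sum_congr rfl fun i hi => ?_
    rw [hpost i (by rw [Finset.mem_range] at hi; lia)]
  · rcases lt_or_ge i t with hit | hit
    · exact (if_pos hit).trans (hpre i hit).1.symm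
    · obtain ⟨i, rfl⟩ := Nat.exists_eq_add_of_le hit
      refine (if_neg (not_lt.2 hit)).trans ?_
      simp only [labelSeq, Nat.add_sub_cancel_left, hpost i hi]
      exact hlabel y' hy' i (by lia)

variable [MeasurableSpace M] {m : Measure M}

lemma measurable_delayedLabelSeq (hF : Measurable F) (hR : Measurable R) (hidx : Measurable idx)
    (t : ℕ) : Measurable (delayedLabelSeq F R idx t) := by
  refine measurable_pi_lambda _ fun i => ?_
  by_cases hit : i < t
  · simp only [delayedLabelSeq, if_pos hit, measurable_const]
  · simp only [delayedLabelSeq, if_neg hit]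
    exact (measurable_pi_iff.1 (measurable_labelSeq (measurable_towerMap hF hR)
      (measurable_towerLabel hidx)) _).comp measurable_prodMk_right

/-- The law of the label sequence of a point of the tower which enters the base at a uniformly
distributed time `t ≤ N`, in a point with law `m`. -/
noncomputable def delayedLabelMeasure (F : M → M) (R idx : M → ℕ) (m : Measure M) (N : ℕ) :
    Measure (ℕ → ℕ) :=
  (N + 1 : ℝ≥0∞)⁻¹ • ∑ t ∈ Finset.range (N + 1), m.map (delayedLabelSeq F R idx t)

variable [IsProbabilityMeasure m]

lemma isProbabilityMeasure_delayedLabelMeasure (hF : Measurable F) (hR : Measurable R)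
    (hidx : Measurable idx) (N : ℕ) :
    IsProbabilityMeasure (delayedLabelMeasure F R idx m N) := by
  have hprob (t : ℕ) : m.map (delayedLabelSeq F R idx t) univ = 1 := by
    rw [Measure.map_apply (measurable_delayedLabelSeq hF hR hidx t) .univ, preimage_univ,
      measure_univ]
  constructor
  simp only [delayedLabelMeasure, Measure.smul_apply, Measure.finsetSum_apply, hprob,
    Finset.sum_const, Finset.card_range, smul_eq_mul, nsmul_eq_mul, mul_one, Nat.cast_add,
    Nat.cast_one]
  exact ENNReal.inv_mul_cancel (by simp) (by finiteness)

lemma mul_measureReal_preimage_le_delayedLabelMeasure (hF : Measurable F) (hR : Measurable R)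
    (hidx : Measurable idx) {t N : ℕ} (ht : t ≤ N) {A : Set (ℕ → ℕ)} (hA : MeasurableSet A) :
    (N + 1 : ℝ)⁻¹ * m.real (delayedLabelSeq F R idx t ⁻¹' A) ≤
      (delayedLabelMeasure F R idx m N).real A := by
  have := isProbabilityMeasure_delayedLabelMeasure (m := m) hF hR hidx N
  have hcast : ((N + 1 : ℝ≥0∞)⁻¹).toReal = (N + 1 : ℝ)⁻¹ := by
    rw [ENNReal.toReal_inv, ← Nat.cast_add_one, ENNReal.toReal_natCast, Nat.cast_add_one]
  rw [← map_measureReal_apply (measurable_delayedLabelSeq hF hR hidx t) hA, ← hcast,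
    ← measureReal_ennreal_smul_apply]
  refine ENNReal.toReal_mono (measure_ne_top _ _) ?_
  rw [delayedLabelMeasure, Measure.smul_apply, Measure.smul_apply, Measure.finsetSum_apply]
  gcongr
  exact Finset.single_le_sum (f := fun t => m.map (delayedLabelSeq F R idx t) A)
    (fun _ _ => zero_le) (Finset.mem_range_succ_iff.2 ht)

lemma ae_exp_neg_le_delayedLabelMeasure (hRm : Measurable R) (hR : R.FactorsThrough idx)
    (hR₀ : ∀ x, 0 < R x) (hidx : Measurable idx) {ν : Measure M} (hF : MeasurePreserving F ν ν)
    {ψ : M → ℝ} {K : ℝ}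
    (hcyl : ∀ᵐ x ∂ν, ∀ j : ℕ, Real.exp (-K - ∑ i ∈ Finset.range j, ψ (F^[i] x)) ≤
      m.real (labelSeq F idx ⁻¹' PiNat.cylinder (labelSeq F idx x) j)) (N : ℕ) :
    ∀ᵐ z ∂towerMeasure R ν,
      Real.exp (-(Real.log (N + 1) + K +
        ∑ i ∈ Finset.range N, towerLift ψ ((towerMap F R)^[i] z))) ≤
      (delayedLabelMeasure F R idx m N).real
        (PiNat.cylinder (labelSeq (towerMap F R) (towerLabel idx) z) N) := by
  filter_upwards [ae_towerMeasure_of_ae hRm (hcyl.and (hF.quasiMeasurePreserving.ae hcyl))]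
    with z ⟨⟨hcylz, hcylFz⟩, hz⟩
  obtain ⟨t, htN, y, hy, j, hsum, hsub⟩ := exists_delayed_cylinder (F := F) hR hR₀ hz N ψ
  have hcyly : Real.exp (-K - ∑ i ∈ Finset.range j, ψ (F^[i] y)) ≤
      m.real (labelSeq F idx ⁻¹' PiNat.cylinder (labelSeq F idx y) j) := by
    rcases hy with rfl | rfl
    exacts [hcylz j, hcylFz j]
  have hexp (s : ℝ) : Real.exp (-(Real.log (N + 1) + K + s)) =
      (N + 1 : ℝ)⁻¹ * Real.exp (-K - s) := by
    rw [add_assoc, neg_add, Real.exp_add, Real.exp_neg, Real.exp_log (by positivity), neg_add']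
  rw [hsum, hexp]
  refine le_trans ?_ (mul_measureReal_preimage_le_delayedLabelMeasure hF.measurable hRm hidx htN
    (PiNat.isOpen_cylinder _ _ N).measurableSet)
  gcongr
  exact hcyly.trans (measureReal_mono hsub)

end DelayedLabels

/-! ### The entropy of a factor -/

section FactorEntropy

variable {X Y ι : Type*} [MeasurableSpace X] {ν : Measure X} {T : X → X} {f : Y → Y} {g : X → Y}

lemma ae_forall_iterate_of_ae (hT : MeasurePreserving T ν ν) (hg : ∀ᵐ z ∂ν, g (T z) = f (g z)) :
    ∀ᵐ z ∂ν, ∀ n, g (T^[n] z) = f^[n] (g z) := by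
  filter_upwards [ae_all_iff.2 fun n => (hT.iterate n).quasiMeasurePreserving.ae hg] with z hz n
  induction n with
  | zero => rfl
  | succ n ih => rw [Function.iterate_succ_apply', Function.iterate_succ_apply', hz, ih]

lemma partitionEntropy_congr_ae [Fintype ι] {ξ ξ' : X → ι} (h : ξ =ᵐ[ν] ξ') :
    partitionEntropy ν ξ = partitionEntropy ν ξ' :=
  Finset.sum_congr rfl fun a _ => congrArg _ <| measureReal_congr <| by
    filter_upwards [h] with z hz
    exact congrArg (· = a) hz

variable [MeasurableSpace Y] {μ : Measure Y}

section PartitionEntropy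

variable [Fintype ι] [MeasurableSpace ι] [MeasurableSingletonClass ι]

lemma partitionEntropy_comp (hg : MeasurePreserving g ν μ) {ξ : Y → ι} (hξ : Measurable ξ) :
    partitionEntropy ν (fun z => ξ (g z)) = partitionEntropy μ ξ :=
  Finset.sum_congr rfl fun a _ => congrArg _ <|
    hg.measureReal_preimage (hξ (measurableSet_singleton a)).nullMeasurableSet

lemma partitionEntropy_itinerary_of_factor (hT : MeasurePreserving T ν ν)
    (hg : MeasurePreserving g ν μ) (hgT : ∀ᵐ z ∂ν, g (T z) = f (g z)) (hf : Measurable f)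
    {ξ : Y → ι} (hξ : Measurable ξ) (n k : ℕ) :
    partitionEntropy ν (fun z => itinerary T (fun z => ξ (g z)) n (T^[k] z)) =
      partitionEntropy μ (itinerary f ξ n) := by
  have hξg : Measurable fun z => ξ (g z) := hξ.comp hg.measurable
  rw [partitionEntropy_comp (hT.iterate k) (measurable_itinerary hT.measurable hξg n),
    ← partitionEntropy_comp hg (measurable_itinerary hf hξ n)]
  refine partitionEntropy_congr_ae ?_
  filter_upwards [ae_forall_iterate_of_ae hT hgT] with z hz
  funext i
  simp only [itinerary, hz]

end PartitionEntropy

lemma mul_entropyOfPartition_le [IsProbabilityMeasure μ] {r : ℕ} (f : Y → Y) (ξ : Y → Fin r)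
    {n : ℕ} (hn : 0 < n) :
    n * entropyOfPartition f μ ξ ≤ partitionEntropy μ (itinerary f ξ n) := by
  obtain ⟨n, rfl⟩ := Nat.exists_eq_succ_of_ne_zero hn.ne'
  have hbdd : BddBelow (range fun n : ℕ =>
      partitionEntropy μ (itinerary f ξ (n + 1)) / ((n : ℝ) + 1)) := by
    refine ⟨0, ?_⟩
    rintro _ ⟨q, rfl⟩
    have := partitionEntropy_nonneg μ (itinerary f ξ (q + 1))
    positivity
  rw [mul_comm, ← le_div_iff₀ (by positivity), Nat.cast_succ]
  exact ciInf_le hbdd n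

lemma le_of_forall_nat_mul_le_log {a b c L : ℝ}
    (h : ∀ n : ℕ, 0 < n → n * a ≤ Real.log (n + L) + c + n * b) : a ≤ b := by
  have hlog : Tendsto (fun n : ℕ => Real.log (n + L) / n) atTop (𝓝 0) := by
    simpa [Function.comp_def] using
      (Real.tendsto_pow_log_div_mul_add_atTop 1 (-L) 1 one_ne_zero).comp
      (tendsto_atTop_add_const_right _ L tendsto_natCast_atTop_atTop)
  have hlim := (hlog.add (tendsto_const_div_atTop_nhds_zero_nat c)).add_const b
  rw [zero_add, zero_add] at hlim
  refine ge_of_tendsto hlim ?_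
  filter_upwards [eventually_gt_atTop 0] with n hn
  have hn' : (0 : ℝ) < n := by exact_mod_cast hn
  rw [← add_div, ← sub_le_iff_le_add, le_div_iff₀ hn']
  linarith [h n hn]

variable {ψ : X → ℝ}

lemma integral_sum_iterate (hT : MeasurePreserving T ν ν) (hψ : Integrable ψ ν) (N : ℕ) :
    ∫ z, ∑ i ∈ Finset.range N, ψ (T^[i] z) ∂ν = N * ∫ z, ψ z ∂ν := by
  have hint (i : ℕ) : Integrable (fun z => ψ (T^[i] z)) ν :=
    (hT.iterate i).integrable_comp_of_integrable hψ
  rw [integral_finsetSum _ fun i _ => hint i]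
  simp only [integral_comp_of_measurePreserving (hT.iterate _) hψ.aestronglyMeasurable,
    Finset.sum_const, Finset.card_range, nsmul_eq_mul]

variable [IsProbabilityMeasure ν] {ζ : X → ℕ} {K : ℝ}

lemma entropyOfPartition_le_of_window [IsProbabilityMeasure μ] {r : ℕ} {ξ : Y → Fin r}
    (hT : MeasurePreserving T ν ν) (hζ : Measurable ζ) (hf : Measurable f)
    (hg : MeasurePreserving g ν μ) (hgT : ∀ᵐ z ∂ν, g (T z) = f (g z)) (hξ : Measurable ξ)
    (hψ : Integrable ψ ν)
    (href : ∀ N : ℕ, ∃ κ : Measure (ℕ → ℕ), IsProbabilityMeasure κ ∧ ∀ᵐ z ∂ν,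
      Real.exp (-(Real.log (N + 1) + K + ∑ i ∈ Finset.range N, ψ (T^[i] z))) ≤
        κ.real (PiNat.cylinder (labelSeq T ζ z) N))
    {k L : ℕ} {Φ : (ℕ → ℕ) → Fin r} (hΦ : DependsOn Φ (Iio L)) {δ : ℝ} (hδ₀ : 0 < δ)
    (hδ₁ : δ < 1) :
    entropyOfPartition f μ ξ ≤ ∫ z, ψ z ∂ν + (-Real.log (1 - δ) +
      ν.real {z | ξ (g (T^[k] z)) ≠ Φ (labelSeq T ζ z)} * Real.log (r / δ)) := by
  refine le_of_forall_nat_mul_le_log (L := L + 1) (c := K + L * ∫ z, ψ z ∂ν) fun n hn => ?_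
  obtain ⟨κ, hκ, hcyl⟩ := href (n + L)
  have hsum : Integrable (fun z => ∑ i ∈ Finset.range (n + L), ψ (T^[i] z)) ν :=
    integrable_finsetSum _ fun i _ => (hT.iterate i).integrable_comp_of_integrable hψ
  have hwindow := partitionEntropy_le_of_window hT hζ (ξ := fun z => ξ (g z))
    (hξ.comp hg.measurable) le_rfl (k := k)
    (G := fun z => Real.log ((n + L : ℕ) + 1) + K + ∑ i ∈ Finset.range (n + L), ψ (T^[i] z))
    ((integrable_const _).add hsum) hcyl hΦ hδ₀ hδ₁
  rw [integral_add (integrable_const _) hsum, integral_sum_iterate hT hψ, integral_const,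
    probReal_univ, one_smul, Fintype.card_fin] at hwindow
  have hentropy := mul_entropyOfPartition_le (μ := μ) f ξ hn
  rw [← partitionEntropy_itinerary_of_factor hT hg hgT hf hξ n k] at hentropy
  push_cast at hwindow
  rw [add_assoc (n : ℝ)] at hwindow
  refine hentropy.trans (hwindow.trans_eq ?_)
  ring

lemma measureEntropy_le_of_labelSeq (hT : MeasurePreserving T ν ν) (hζ : Measurable ζ)
    (hf : Measurable f) (hg : MeasurePreserving g ν μ) (hgT : ∀ᵐ z ∂ν, g (T z) = f (g z))
    (happrox : ∀ E, MeasurableSet E → IsWindowApproximable T ζ ν E) (hψ : Integrable ψ ν)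
    (href : ∀ N : ℕ, ∃ κ : Measure (ℕ → ℕ), IsProbabilityMeasure κ ∧ ∀ᵐ z ∂ν,
      Real.exp (-(Real.log (N + 1) + K + ∑ i ∈ Finset.range N, ψ (T^[i] z))) ≤
        κ.real (PiNat.cylinder (labelSeq T ζ z) N)) :
    measureEntropy f μ ≤ ((∫ z, ψ z ∂ν : ℝ) : EReal) := by
  have : IsProbabilityMeasure μ := hg.map_eq ▸ Measure.isProbabilityMeasure_map hg.aemeasurable
  refine iSup_le fun r => iSup_le fun ξ => iSup_le fun hξ => EReal.coe_le_coe_iff.2 ?_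
  obtain ⟨y⟩ := nonempty_of_isProbabilityMeasure μ
  have : Nonempty (Fin r) := ⟨ξ y⟩
  have hr : (1 : ℝ) ≤ r := by exact_mod_cast Fin.pos (ξ y)
  -- The error rate of the window predictions and the parameter of the window weights are both `δ`.
  let b : ℝ → ℝ := fun δ => ∫ z, ψ z ∂ν + (-Real.log (1 - δ) +
    (δ * Real.log r + Real.negMulLog δ))
  have hb : Tendsto b (𝓝[>] 0) (𝓝 (∫ z, ψ z ∂ν)) := by
    have hcont : ContinuousAt b 0 := by
      have hlog : ContinuousAt (fun δ : ℝ => Real.log (1 - δ)) 0 :=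
        (continuousAt_const.sub continuousAt_id).log (by norm_num)
      fun_prop
    simpa [b] using hcont.tendsto.mono_left nhdsWithin_le_nhds
  refine ge_of_tendsto hb ?_
  filter_upwards [Ioo_mem_nhdsGT one_pos] with δ ⟨hδ₀, hδ₁⟩
  obtain ⟨k, L, Φ, hΦ, herr⟩ := exists_windowFunction hT hζ (ξ := fun z => ξ (g z))
    (fun a => happrox _ ((hξ.comp hg.measurable) (measurableSet_singleton a)))
    (ENNReal.ofReal_pos.2 hδ₀)
  have hlog : 0 ≤ Real.log (r / δ) := Real.log_nonneg ((one_le_div hδ₀).2 (hδ₁.le.trans hr))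
  calc entropyOfPartition f μ ξ
      ≤ ∫ z, ψ z ∂ν + (-Real.log (1 - δ) +
          ν.real {z | ξ (g (T^[k] z)) ≠ Φ (labelSeq T ζ z)} * Real.log (r / δ)) :=
        entropyOfPartition_le_of_window hT hζ hf hg hgT hξ hψ href hΦ hδ₀ hδ₁
    _ ≤ ∫ z, ψ z ∂ν + (-Real.log (1 - δ) + δ * Real.log (r / δ)) := by
        gcongr
        exact ENNReal.toReal_le_of_le_ofReal hδ₀.le herr
    _ = b δ := by
        simp only [b, Real.log_div (zero_lt_one.trans_le hr).ne' hδ₀.ne', Real.negMulLog]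
        ring

end FactorEntropy

/-! ### The projection of a tower to the phase space -/

section TowerProjection

variable {M : Type*} {F f : M → M} {R : M → ℕ}

/-- The projection of a tower over a map induced by `f` to the phase space of `f`: the point at
height `l` above `x` stands for `f^l x`. -/
def towerProj (f : M → M) (z : M × ℕ) : M := f^[z.2] z.1

lemma towerProj_towerMap {z : M × ℕ} (hF : F z.1 = f^[R z.1] z.1) (hz : z.2 < R z.1) :
    towerProj f (towerMap F R z) = f (towerProj f z) := by
  obtain ⟨x, l⟩ := z
  rcases hz.nat_succ_le.lt_or_eq with hlt | htop
  · rw [towerMap_of_lt hlt]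
    exact Function.iterate_succ_apply' f l x
  · rw [towerMap_of_le htop.ge]
    exact (hF.trans (congrArg (f^[·] x) htop.symm)).trans (Function.iterate_succ_apply' f l x)

variable [MeasurableSpace M] {ν₀ μ : Measure M} {c : ℝ≥0∞}

lemma measurable_towerProj (hf : Measurable f) : Measurable (towerProj f) :=
  measurable_from_prod_countable_left fun l => hf.iterate l

lemma map_towerProj_towerMeasure (hf : Measurable f) :
    (towerMeasure R ν₀).map (towerProj f) =
      Measure.sum fun l => (ν₀.restrict {x | l < R x}).map f^[l] := by
  rw [towerMeasure, Measure.map_sum (measurable_towerProj hf).aemeasurable]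
  congr 1
  funext l
  rw [Measure.map_map (measurable_towerProj hf) measurable_prodMk_right]
  rfl

lemma ae_of_towerProj (hR : Measurable R) (hμ : MeasurePreserving (towerProj f)
    (c • towerMeasure R ν₀) μ) {p : M → Prop} (hp : MeasurableSet {y | p y})
    (h : ∀ᵐ x ∂ν₀, ∀ l < R x, p (f^[l] x)) : ∀ᵐ y ∂μ, p y := by
  rw [← hμ.map_eq, ae_map_iff hμ.aemeasurable hp]
  exact Measure.smul_absolutelyContinuous.ae_le
    ((ae_towerMeasure_iff hR (hμ.measurable hp)).2 h)

lemma isFiniteMeasure_towerMeasure [IsFiniteMeasure μ] (hc : c ≠ 0)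
    (hμ : MeasurePreserving (towerProj f) (c • towerMeasure R ν₀) μ) :
    IsFiniteMeasure (towerMeasure R ν₀) := by
  refine ⟨lt_top_iff_ne_top.2 fun htop => measure_ne_top μ univ ?_⟩
  rw [← hμ.measure_preimage MeasurableSet.univ.nullMeasurableSet, preimage_univ, Measure.smul_apply,
    htop, smul_eq_mul, ENNReal.mul_top hc]

lemma integral_towerProj (hR : Measurable R)
    (hμ : MeasurePreserving (towerProj f) (c • towerMeasure R ν₀) μ) {φ : M → ℝ}
    (hφ : Measurable φ) (hφi : Integrable (fun z => φ (towerProj f z)) (towerMeasure R ν₀)) :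
    ∫ y, φ y ∂μ = c.toReal * ∫ x, ∑ l ∈ Finset.range (R x), φ (f^[l] x) ∂ν₀ := by
  rw [← integral_comp_of_measurePreserving hμ hφ.aestronglyMeasurable, integral_smul_measure,
    integral_towerMeasure hR (g := fun z => φ (towerProj f z)) (hφ.comp hμ.measurable) hφi,
    smul_eq_mul]
  rfl

lemma measureEntropy_le_of_tower {m : Measure M} [IsProbabilityMeasure m] [IsProbabilityMeasure μ]
    {idx : M → ℕ} (hRm : Measurable R) (hR : R.FactorsThrough idx) (hR₀ : ∀ x, 0 < R x)
    (hidx : Measurable idx) (hf : Measurable f) (hF : MeasurePreserving F ν₀ ν₀)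
    (hFf : ∀ᵐ x ∂ν₀, F x = f^[R x] x) (hc : c ≠ ⊤)
    (hμ : MeasurePreserving (towerProj f) (c • towerMeasure R ν₀) μ) {ψ : M → ℝ}
    (hψ : Measurable ψ) (hψi : Integrable ψ ν₀) {K : ℝ}
    (hcyl : ∀ᵐ x ∂ν₀, ∀ j : ℕ, Real.exp (-K - ∑ i ∈ Finset.range j, ψ (F^[i] x)) ≤
      m.real (labelSeq F idx ⁻¹' PiNat.cylinder (labelSeq F idx x) j))
    (hgen : ∀ B, MeasurableSet B → ∃ S, MeasurableSet S ∧ B =ᵐ[ν₀] labelSeq F idx ⁻¹' S) :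
    measureEntropy f μ ≤ ((c.toReal * ∫ x, ψ x ∂ν₀ : ℝ) : EReal) := by
  set ν := c • towerMeasure R ν₀
  have hνac : ν ≪ towerMeasure R ν₀ := Measure.smul_absolutelyContinuous
  have hT : MeasurePreserving (towerMap F R) ν ν :=
    (measurePreserving_towerMap hF hRm hR₀).smul_measure c
  have : IsProbabilityMeasure (ν.map (towerProj f)) := hμ.map_eq ▸ ‹_›
  have : IsProbabilityMeasure ν := Measure.isProbabilityMeasure_of_map (towerProj f)
  have hsemi : ∀ᵐ z ∂ν, towerProj f (towerMap F R z) = f (towerProj f z) := by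
    filter_upwards [hνac.ae_le (ae_towerMeasure_of_ae hRm hFf)] with z hz
    exact towerProj_towerMap hz.1 hz.2
  have hint : ∫ z, towerLift ψ z ∂ν = c.toReal * ∫ x, ψ x ∂ν₀ := by
    rw [integral_smul_measure, integral_towerLift hRm hR₀ hψ hψi, smul_eq_mul]
  rw [← hint]
  exact measureEntropy_le_of_labelSeq hT (measurable_towerLabel hidx) hf hμ hsemi
    (fun E hE => isWindowApproximable_tower hRm hR hR₀ hidx hT hνac hgen hE)
    ((integrable_towerLift hRm hR₀ hψ hψi).smul_measure hc) fun N =>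
      ⟨_, isProbabilityMeasure_delayedLabelMeasure hF.measurable hRm hidx N,
        hνac.ae_le (ae_exp_neg_le_delayedLabelMeasure hRm hR hR₀ hidx hF hcyl N)⟩

end TowerProjection

section TowerJacobian

variable {M : Type*} [MeasurableSpace M] {f : M → M} {R : M → ℕ} {ν₀ μ : Measure M} {c : ℝ≥0∞}
  {D J : M → ℝ}

lemma ae_forall_pos_of_prod_pos (hD₀ : ∀ x, 0 ≤ D x) (hJ : ∀ᵐ x ∂ν₀, 0 < J x)
    (hprod : ∀ᵐ x ∂ν₀, J x = ∏ l ∈ Finset.range (R x), D (f^[l] x)) :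
    ∀ᵐ x ∂ν₀, ∀ l < R x, 0 < D (f^[l] x) := by
  filter_upwards [hprod, hJ] with x hx hJx l hl
  refine (hD₀ _).lt_of_ne' fun hzero => hJx.ne' ?_
  rw [hx, Finset.prod_eq_zero (Finset.mem_range.2 hl) hzero]

lemma ae_log_eq_sum_log (hD : ∀ᵐ x ∂ν₀, ∀ l < R x, 0 < D (f^[l] x))
    (hprod : ∀ᵐ x ∂ν₀, J x = ∏ l ∈ Finset.range (R x), D (f^[l] x)) :
    ∀ᵐ x ∂ν₀, Real.log (J x) = ∑ l ∈ Finset.range (R x), Real.log (D (f^[l] x)) := by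
  filter_upwards [hprod, hD] with x hx hDx
  rw [hx, Real.log_prod fun l hl => (hDx l (Finset.mem_range.1 hl)).ne']

lemma integrable_log_towerProj [IsFiniteMeasure ν₀] [IsFiniteMeasure μ] (hR : Measurable R)
    (hc : c ≠ 0) (hμ : MeasurePreserving (towerProj f) (c • towerMeasure R ν₀) μ)
    (hDm : Measurable D) {C K : ℝ} (hDC : ∀ x, D x ≤ C)
    (hD : ∀ᵐ x ∂ν₀, ∀ l < R x, 0 < D (f^[l] x))
    (hlog : ∀ᵐ x ∂ν₀, Real.log (J x) = ∑ l ∈ Finset.range (R x), Real.log (D (f^[l] x)))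
    (hK : ∀ᵐ x ∂ν₀, K ≤ Real.log (J x)) :
    Integrable (fun z => Real.log (D (towerProj f z))) (towerMeasure R ν₀) := by
  have : IsFiniteMeasure (towerMeasure R ν₀) := isFiniteMeasure_towerMeasure hc hμ
  refine integrable_towerMeasure_of_le_of_le_sum (L := Real.log C) (K := K) hR
    ((hDm.comp hμ.measurable).log) ?_ ?_
  · filter_upwards [hD] with x hx l hl using Real.log_le_log (hx l hl) (hDC _)
  · filter_upwards [hlog, hK] with x hx hKx using hKx.trans_eq hx

end TowerJacobian

/-! ### Cylinders of Gibbs–Markov maps -/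

section Cylinders

variable {M : Type*} {F : M → M} {P : Set (Set M)} {w : ℕ → Set M} {n : ℕ} {x y : M}

/-- The points whose first `n` iterates under `F` visit `w 0, …, w (n - 1)` in this order. -/
def iterateCylinder (F : M → M) (w : ℕ → Set M) (n : ℕ) : Set M := {x | ∀ i < n, F^[i] x ∈ w i}

lemma iterateCylinder_succ (F : M → M) (w : ℕ → Set M) (n : ℕ) :
    iterateCylinder F w (n + 1) = w 0 ∩ F ⁻¹' iterateCylinder F (fun i => w (i + 1)) n := by
  ext x
  refine ⟨fun h => ⟨h 0 n.succ_pos, fun i hi => h (i + 1) (by lia)⟩, ?_⟩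
  rintro ⟨hzero, hsucc⟩ (_ | i) hi
  · exact hzero
  · exact hsucc i (by lia)

lemma measurableSet_iterateCylinder {_ : MeasurableSpace M} (hF : ∀ i, Measurable F^[i])
    (hw : ∀ i, MeasurableSet (w i)) (n : ℕ) : MeasurableSet (iterateCylinder F w n) :=
  measurableSet_setOfPred.2 <| Measurable.forall fun i => Measurable.forall fun _ =>
    measurableSet_setOfPred.1 (hF i (hw i))

/-- The orbits of `x` and `y` meet distinct elements of `P` at some common time; the separation
time of `x` and `y` is then the least such time. -/
def OrbitsSeparate (F : M → M) (P : Set (Set M)) (x y : M) : Prop :=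
  ∃ k, ∃ v ∈ P, ∃ v' ∈ P, v ≠ v' ∧ F^[k] x ∈ v ∧ F^[k] y ∈ v'

lemma orbitsSeparate_of_ne {Z : Set M} (hZ : ∀ A ∈ dynPartitionInfty F P, (A ∩ Z).Subsingleton)
    (hxZ : x ∈ Z) (hyZ : y ∈ Z) (hxP : ∀ i, F^[i] x ∈ ⋃₀ P) (hyP : ∀ i, F^[i] y ∈ ⋃₀ P)
    (hne : x ≠ y) : OrbitsSeparate F P x y := by
  choose v hv hxv using hxP
  choose v' hv' hyv' using hyP
  by_contra hsep
  have heq (k : ℕ) : v k = v' k := by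
    by_contra hk
    exact hsep ⟨k, v k, hv k, v' k, hv' k, hk, hxv k, hyv' k⟩
  exact hne <| hZ _ ⟨v, hv, rfl⟩ ⟨hxv, hxZ⟩ ⟨fun k => heq k ▸ hyv' k, hyZ⟩

lemma le_of_mem_of_mem_of_ne (hdisj : P.PairwiseDisjoint id) (hw : ∀ i, w i ∈ P)
    (hx : x ∈ iterateCylinder F w n) (hy : y ∈ iterateCylinder F w n) {k : ℕ} {v v' : Set M}
    (hv : v ∈ P) (hv' : v' ∈ P) (hne : v ≠ v') (hxv : F^[k] x ∈ v) (hyv' : F^[k] y ∈ v') :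
    n ≤ k := by
  by_contra! hk
  exact hne <| (hdisj.elim_set hv (hw k) _ hxv (hx k hk)).trans
    (hdisj.elim_set hv' (hw k) _ hyv' (hy k hk)).symm

lemma sub_le_separationTime_iterate (hdisj : P.PairwiseDisjoint id) (hw : ∀ i, w i ∈ P)
    (hx : x ∈ iterateCylinder F w n) (hy : y ∈ iterateCylinder F w n)
    (hsep : OrbitsSeparate F P x y) {i : ℕ} (hi : i ≤ n) :
    n - i ≤ separationTime F P (F^[i] x) (F^[i] y) := by
  refine le_csInf ?_ ?_
  · obtain ⟨k, v, hv, v', hv', hne, hxv, hyv'⟩ := hsep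
    obtain ⟨q, rfl⟩ : ∃ q, k = q + i := Nat.exists_eq_add_of_le' <|
      hi.trans (le_of_mem_of_mem_of_ne hdisj hw hx hy hv hv' hne hxv hyv')
    rw [Function.iterate_add_apply] at hxv hyv'
    exact ⟨q, v, hv, v', hv', hne, hxv, hyv'⟩
  · rintro q ⟨v, hv, v', hv', hne, hxv, hyv'⟩
    rw [← Function.iterate_add_apply] at hxv hyv'
    exact Nat.sub_le_of_le_add (le_of_mem_of_mem_of_ne hdisj hw hx hy hv hv' hne hxv hyv')

variable {J : M → ℝ} {C β : ℝ}

lemma log_sub_log_iterate_le (hdisj : P.PairwiseDisjoint id) (hJ₀ : ∀ v ∈ P, ∀ x ∈ v, 0 < J x)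
    (hC : 0 ≤ C) (hβ₀ : 0 ≤ β) (hβ₁ : β ≤ 1)
    (hJ : ∀ v ∈ P, ∀ x ∈ v, ∀ y ∈ v,
      Real.log (J x / J y) ≤ C * β ^ separationTime F P (F x) (F y))
    (hw : ∀ i, w i ∈ P) (hx : x ∈ iterateCylinder F w n) (hy : y ∈ iterateCylinder F w n)
    (hsep : OrbitsSeparate F P x y) {i : ℕ} (hi : i < n) :
    Real.log (J (F^[i] x)) - Real.log (J (F^[i] y)) ≤ C * β ^ (n - 1 - i) := by
  have htime : n - 1 - i ≤ separationTime F P (F (F^[i] x)) (F (F^[i] y)) := by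
    rw [← Function.iterate_succ_apply' F, ← Function.iterate_succ_apply' F, Nat.sub_sub, add_comm 1]
    exact sub_le_separationTime_iterate hdisj hw hx hy hsep hi
  calc Real.log (J (F^[i] x)) - Real.log (J (F^[i] y))
      = Real.log (J (F^[i] x) / J (F^[i] y)) :=
        (Real.log_div (hJ₀ _ (hw i) _ (hx i hi)).ne' (hJ₀ _ (hw i) _ (hy i hi)).ne').symm
    _ ≤ C * β ^ separationTime F P (F (F^[i] x)) (F (F^[i] y)) :=
        hJ _ (hw i) _ (hx i hi) _ (hy i hi)
    _ ≤ C * β ^ (n - 1 - i) :=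
        mul_le_mul_of_nonneg_left (pow_le_pow_of_le_one hβ₀ hβ₁ htime) hC

lemma sum_log_iterate_le_of_mem_cylinder (hdisj : P.PairwiseDisjoint id)
    (hJ₀ : ∀ v ∈ P, ∀ x ∈ v, 0 < J x) (hC : 0 ≤ C) (hβ₀ : 0 ≤ β) (hβ₁ : β < 1)
    (hJ : ∀ v ∈ P, ∀ x ∈ v, ∀ y ∈ v,
      Real.log (J x / J y) ≤ C * β ^ separationTime F P (F x) (F y))
    (hw : ∀ i, w i ∈ P) (hx : x ∈ iterateCylinder F w n) (hy : y ∈ iterateCylinder F w n)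
    (hsep : x ≠ y → OrbitsSeparate F P x y) :
    ∑ i ∈ Finset.range n, Real.log (J (F^[i] x)) ≤
      C / (1 - β) + ∑ i ∈ Finset.range n, Real.log (J (F^[i] y)) := by
  rcases eq_or_ne x y with rfl | hne
  · exact le_add_of_nonneg_left (div_nonneg hC (sub_nonneg.2 hβ₁.le))
  rw [← sub_le_iff_le_add, ← Finset.sum_sub_distrib]
  calc ∑ i ∈ Finset.range n, (Real.log (J (F^[i] x)) - Real.log (J (F^[i] y)))
      ≤ ∑ i ∈ Finset.range n, C * β ^ (n - 1 - i) := Finset.sum_le_sum fun i hi =>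
        log_sub_log_iterate_le hdisj hJ₀ hC hβ₀ hβ₁.le hJ hw hx hy (hsep hne)
          (Finset.mem_range.1 hi)
    _ = C * ∑ i ∈ Finset.range n, β ^ i := by
        rw [Finset.sum_range_reflect (fun i => C * β ^ i), Finset.mul_sum]
    _ ≤ C * (1 - β)⁻¹ := by
        gcongr
        rw [← tsum_geometric_of_lt_one hβ₀ hβ₁]
        exact (summable_geometric_of_lt_one hβ₀ hβ₁).sum_le_tsum _ fun i _ => pow_nonneg hβ₀ i

end Cylinders

section MarkovJacobian

variable {M : Type*} [MeasurableSpace M] {m : Measure M} {F : M → M} {Δ₀ : Set M} {P : Set (Set M)}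
  {J : M → ℝ}

lemma setLIntegral_mul_comp_of_measure_image_eq (hF : Measurable F) {A : Set M}
    (hA : MeasurableSet A) (hmaps : MapsTo F A Δ₀) (hcover : m (Δ₀ \ F '' A) = 0) {j : M → ℝ≥0∞}
    (hj : Measurable j) (himage : ∀ B ⊆ A, MeasurableSet B → m (F '' B) = ∫⁻ x in B, j x ∂m)
    {g : M → ℝ≥0∞} (hg : Measurable g) :
    ∫⁻ x in A, j x * g (F x) ∂m = ∫⁻ x in Δ₀, g x ∂m := by
  have hfull : F '' A =ᵐ[m] Δ₀ := hmaps.image_subset.eventuallyLE.antisymm (ae_le_set.2 hcover)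
  have hmap : ((m.restrict A).withDensity j).map F = m.restrict Δ₀ := by
    ext B hB
    rw [Measure.map_apply hF hB, withDensity_apply _ (hF hB), Measure.restrict_restrict (hF hB),
      inter_comm, ← himage _ inter_subset_left (hA.inter (hF hB)), image_inter_preimage,
      Measure.restrict_apply hB, inter_comm B]
    exact measure_congr (hfull.inter (ae_eq_refl B))
  rw [← hmap, lintegral_map hg hF]
  exact (lintegral_withDensity_eq_lintegral_mul _ hj (hg.comp hF)).symm

/-- `J` is the Jacobian of the Markov map `F` of `Δ₀` with the countable `m` mod 0 partition `P`:
every element of `P` is mapped onto `Δ₀`, and `J` is the factor of the change of variables. That `F`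
is injective and onto mod 0 on the elements of `P` is only recorded through this formula. -/
structure IsMarkovJacobian (m : Measure M) (F : M → M) (Δ₀ : Set M) (P : Set (Set M))
    (J : M → ℝ) : Prop where
  measurableSet_base : MeasurableSet Δ₀
  measurable_map : Measurable F
  countable : P.Countable
  measurableSet : ∀ w ∈ P, MeasurableSet w
  subset : ∀ w ∈ P, w ⊆ Δ₀
  cover : m (Δ₀ \ ⋃₀ P) = 0
  measurable : Measurable J
  pos : ∀ x ∈ Δ₀, 0 < J x
  setLIntegral_mul_comp : ∀ w ∈ P, ∀ g : M → ℝ≥0∞, Measurable g →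
    ∫⁻ x in w, ENNReal.ofReal (J x) * g (F x) ∂m = ∫⁻ x in Δ₀, g x ∂m

/-- One half of the Gibbs property of `m` on `Δ₀`: for almost every `x`, the cylinder of length `n`
around `x` has normalized measure at least `e^{-K} / ∏_{i < n} J (F^i x)`. -/
def HasGibbsLowerBound (m : Measure M) (F : M → M) (Δ₀ : Set M) (P : Set (Set M)) (J : M → ℝ)
    (K : ℝ) : Prop :=
  ∀ᵐ x ∂m.restrict Δ₀, ∀ w : ℕ → Set M, (∀ i, w i ∈ P) → ∀ n, x ∈ iterateCylinder F w n →
    Real.exp (-K - ∑ i ∈ Finset.range n, Real.log (J (F^[i] x))) ≤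
      (ProbabilityTheory.cond m Δ₀).real (iterateCylinder F w n)

namespace IsMarkovJacobian

lemma ae_mem_sUnion (h : IsMarkovJacobian m F Δ₀ P J) : ∀ᵐ x ∂m.restrict Δ₀, x ∈ ⋃₀ P :=
  (ae_restrict_iff' h.measurableSet_base).2 (ae_le_set.2 h.cover)

lemma pos_of_mem (h : IsMarkovJacobian m F Δ₀ P J) {w : Set M} (hw : w ∈ P) {x : M}
    (hx : x ∈ w) : 0 < J x :=
  h.pos x (h.subset w hw hx)

lemma measure_inter_preimage_eq_zero (h : IsMarkovJacobian m F Δ₀ P J) {w B : Set M} (hw : w ∈ P)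
    (hB : MeasurableSet B) (hB₀ : m.restrict Δ₀ B = 0) : m (F ⁻¹' B ∩ w) = 0 := by
  have hind : Measurable fun x => B.indicator (1 : M → ℝ≥0∞) (F x) :=
    (measurable_one.indicator hB).comp h.measurable_map
  have hzero := h.setLIntegral_mul_comp w hw _ (measurable_one.indicator hB)
  rw [lintegral_indicator_one hB, hB₀,
    lintegral_eq_zero_iff (h.measurable.ennreal_ofReal.fun_mul hind)] at hzero
  rw [← Measure.restrict_apply (h.measurable_map hB), measure_eq_zero_iff_ae_notMem]
  filter_upwards [hzero, ae_restrict_mem (h.measurableSet w hw)] with x hx hxw hxB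
  have hxpos : ENNReal.ofReal (J x) ≠ 0 := (ENNReal.ofReal_pos.2 (h.pos_of_mem hw hxw)).ne'
  rw [indicator_of_mem (mem_preimage.1 hxB), Pi.one_apply, mul_one] at hx
  exact hxpos hx

lemma quasiMeasurePreserving (h : IsMarkovJacobian m F Δ₀ P J) :
    Measure.QuasiMeasurePreserving F (m.restrict Δ₀) (m.restrict Δ₀) := by
  refine ⟨h.measurable_map, Measure.AbsolutelyContinuous.mk fun B hB hB₀ => ?_⟩
  have hnull : m (F ⁻¹' B ∩ ⋃₀ P) = 0 := by
    rw [sUnion_eq_biUnion, inter_iUnion₂, measure_biUnion_null_iff h.countable]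
    exact fun w hw => h.measure_inter_preimage_eq_zero hw hB hB₀
  rw [Measure.map_apply h.measurable_map hB, measure_eq_zero_iff_ae_notMem]
  filter_upwards [ae_restrict_of_ae (measure_eq_zero_iff_ae_notMem.1 hnull), h.ae_mem_sUnion]
    with x hx hxP hxB
  exact hx ⟨hxB, hxP⟩

lemma ae_iterate_mem (h : IsMarkovJacobian m F Δ₀ P J) :
    ∀ᵐ x ∂m.restrict Δ₀, ∀ i, F^[i] x ∈ ⋃₀ P :=
  ae_all_iff.2 fun i => (h.quasiMeasurePreserving.iterate i).ae h.ae_mem_sUnion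

lemma measurableSet_cylinder (h : IsMarkovJacobian m F Δ₀ P J) {w : ℕ → Set M}
    (hw : ∀ i, w i ∈ P) (n : ℕ) : MeasurableSet (iterateCylinder F w n) :=
  measurableSet_iterateCylinder h.measurable_map.iterate (fun i => h.measurableSet _ (hw i)) n

lemma setLIntegral_cylinder (h : IsMarkovJacobian m F Δ₀ P J) (n : ℕ) {w : ℕ → Set M}
    (hw : ∀ i, w i ∈ P) :
    ∫⁻ x in Δ₀ ∩ iterateCylinder F w n,
      ∏ i ∈ Finset.range n, ENNReal.ofReal (J (F^[i] x)) ∂m = m Δ₀ := by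
  induction n generalizing w with
  | zero => simp [iterateCylinder]
  | succ n ih =>
    set j : ℕ → M → ℝ≥0∞ := fun k x => ∏ i ∈ Finset.range k, ENNReal.ofReal (J (F^[i] x))
    have hj : Measurable (j n) := Finset.measurable_fun_prod _ fun i _ =>
      (h.measurable.comp (h.measurable_map.iterate i)).ennreal_ofReal
    set E := iterateCylinder F (fun i => w (i + 1)) n
    have hE : MeasurableSet E := h.measurableSet_cylinder (fun i => hw (i + 1)) n
    have hset : Δ₀ ∩ iterateCylinder F w (n + 1) = F ⁻¹' E ∩ w 0 := by
      rw [iterateCylinder_succ, ← inter_assoc, inter_eq_right.2 (h.subset _ (hw 0)), inter_comm]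
    calc ∫⁻ x in Δ₀ ∩ iterateCylinder F w (n + 1), j (n + 1) x ∂m
        = ∫⁻ x in w 0, (F ⁻¹' E).indicator (j (n + 1)) x ∂m := by
          rw [hset, lintegral_indicator (h.measurable_map hE),
            Measure.restrict_restrict (h.measurable_map hE)]
      _ = ∫⁻ x in w 0, ENNReal.ofReal (J x) * E.indicator (j n) (F x) ∂m := by
          refine lintegral_congr fun x => ?_
          by_cases hx : F x ∈ E
          · rw [indicator_of_mem hx, indicator_of_mem (mem_preimage.2 hx), mul_comm]
            exact Finset.prod_range_succ' _ n
          · rw [indicator_of_notMem hx, indicator_of_notMem (mt mem_preimage.1 hx), mul_zero]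
      _ = ∫⁻ x in Δ₀ ∩ E, j n x ∂m := by
          rw [h.setLIntegral_mul_comp _ (hw 0) _ (hj.indicator hE), lintegral_indicator hE,
            Measure.restrict_restrict hE, inter_comm]
      _ = m Δ₀ := ih fun i => hw (i + 1)

lemma prod_ofReal_iterate (h : IsMarkovJacobian m F Δ₀ P J) {w : ℕ → Set M} (hw : ∀ i, w i ∈ P)
    {n : ℕ} {x : M} (hx : x ∈ iterateCylinder F w n) :
    ∏ i ∈ Finset.range n, ENNReal.ofReal (J (F^[i] x)) =
      ENNReal.ofReal (Real.exp (∑ i ∈ Finset.range n, Real.log (J (F^[i] x)))) := by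
  rw [Real.exp_sum, ENNReal.ofReal_prod_of_nonneg fun i _ => (Real.exp_pos _).le]
  refine Finset.prod_congr rfl fun i hi => ?_
  rw [Real.exp_log (h.pos_of_mem (hw i) (hx i (Finset.mem_range.1 hi)))]

lemma exp_neg_le_cond_cylinder (h : IsMarkovJacobian m F Δ₀ P J) (hΔ₀ : m Δ₀ ≠ 0)
    (hfin : m Δ₀ ≠ ⊤) {w : ℕ → Set M} (hw : ∀ i, w i ∈ P) {n : ℕ} {B : ℝ}
    (hB : ∀ᵐ x ∂m.restrict Δ₀, x ∈ iterateCylinder F w n →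
      ∑ i ∈ Finset.range n, Real.log (J (F^[i] x)) ≤ B) :
    Real.exp (-B) ≤ (ProbabilityTheory.cond m Δ₀).real (iterateCylinder F w n) := by
  set E := iterateCylinder F w n
  have hE : MeasurableSet E := h.measurableSet_cylinder hw n
  have hle : m Δ₀ ≤ ENNReal.ofReal (Real.exp B) * m (Δ₀ ∩ E) := by
    calc m Δ₀ = ∫⁻ x in Δ₀ ∩ E, ∏ i ∈ Finset.range n, ENNReal.ofReal (J (F^[i] x)) ∂m :=
          (h.setLIntegral_cylinder n hw).symm
      _ ≤ ∫⁻ _ in Δ₀ ∩ E, ENNReal.ofReal (Real.exp B) ∂m := by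
          refine setLIntegral_mono_ae' (h.measurableSet_base.inter hE) ?_
          filter_upwards [(ae_restrict_iff' h.measurableSet_base).1 hB] with x hx hxE
          rw [h.prod_ofReal_iterate hw hxE.2]
          exact ENNReal.ofReal_le_ofReal (Real.exp_le_exp.2 (hx hxE.1 hxE.2))
      _ = ENNReal.ofReal (Real.exp B) * m (Δ₀ ∩ E) := setLIntegral_const _ _
  have hfinE : m (Δ₀ ∩ E) ≠ ⊤ := measure_ne_top_of_subset inter_subset_left hfin
  have hreal : m.real Δ₀ ≤ Real.exp B * m.real (Δ₀ ∩ E) := by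
    simpa only [measureReal_def, ENNReal.toReal_mul, ENNReal.toReal_ofReal (Real.exp_pos B).le]
      using ENNReal.toReal_mono (ENNReal.mul_ne_top ENNReal.ofReal_ne_top hfinE) hle
  have hpos : 0 < m.real Δ₀ := ENNReal.toReal_pos hΔ₀ hfin
  rw [measureReal_def, ProbabilityTheory.cond_apply h.measurableSet_base, ENNReal.toReal_mul,
    ENNReal.toReal_inv, ← measureReal_def, ← measureReal_def, Real.exp_neg, ← div_eq_inv_mul,
    le_div_iff₀ hpos, ← div_eq_inv_mul, div_le_iff₀' (Real.exp_pos B)]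
  exact hreal

lemma hasGibbsLowerBound (h : IsMarkovJacobian m F Δ₀ P J) (hΔ₀ : m Δ₀ ≠ 0)
    (hfin : m Δ₀ ≠ ⊤) (hdisj : P.PairwiseDisjoint id) {C β : ℝ} (hC : 0 ≤ C) (hβ₀ : 0 ≤ β)
    (hβ₁ : β < 1)
    (hJ : ∀ v ∈ P, ∀ x ∈ v, ∀ y ∈ v,
      Real.log (J x / J y) ≤ C * β ^ separationTime F P (F x) (F y)) {Z : Set M}
    (hZ₀ : m (Δ₀ \ Z) = 0) (hZ : ∀ A ∈ dynPartitionInfty F P, (A ∩ Z).Subsingleton) :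
    HasGibbsLowerBound m F Δ₀ P J (C / (1 - β)) := by
  have hZae : ∀ᵐ x ∂m.restrict Δ₀, x ∈ Z :=
    (ae_restrict_iff' h.measurableSet_base).2 (ae_le_set.2 hZ₀)
  filter_upwards [hZae, h.ae_iterate_mem] with x hxZ hxP w hw n hx
  rw [← neg_add']
  refine h.exp_neg_le_cond_cylinder hΔ₀ hfin hw ?_
  filter_upwards [hZae, h.ae_iterate_mem] with y hyZ hyP hy
  exact sum_log_iterate_le_of_mem_cylinder hdisj (fun v hv z hz => h.pos_of_mem hv hz) hC hβ₀ hβ₁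
    hJ hw hy hx (orbitsSeparate_of_ne hZ hyZ hxZ hyP hxP)

end IsMarkovJacobian

end MarkovJacobian

/-! ### Inducing schemes -/

lemma exists_measurable_index {X : Type*} [MeasurableSpace X] {ι : Type*} [Countable ι]
    {t : ι → Set X} (ht : ∀ i, MeasurableSet (t i)) (hdisj : Pairwise (Function.onFun Disjoint t)) :
    ∃ idx : X → ℕ, Measurable idx ∧ ∀ i, ∀ x ∈ t i, ∀ y, idx y = idx x ↔ y ∈ t i := by
  obtain ⟨e, he⟩ := Countable.exists_injective_nat ι
  let s : Option ι → Set X := fun o => o.elim (⋃ i, t i)ᶜ t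
  let g : Option ι → ℕ := fun o => o.elim 0 fun i => e i + 1
  have hs : ∀ o, MeasurableSet (s o)
    | none => (MeasurableSet.iUnion ht).compl
    | some i => ht i
  have hsdisj : Pairwise (Function.onFun Disjoint s)
    | none, none, hne => absurd rfl hne
    | none, some j, _ => disjoint_compl_left_iff_subset.2 (subset_iUnion t j)
    | some i, none, _ => disjoint_compl_right_iff_subset.2 (subset_iUnion t i)
    | some i, some j, hne => hdisj fun hij => hne (congrArg some hij)
  have hg : Function.Injective g
    | none, none, _ => rfl
    | some i, some j, hij => congrArg some (he (Nat.succ_injective hij))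
  obtain ⟨idx, hidxm, hidx⟩ := exists_measurable_piecewise s hs (fun o _ => g o)
    (fun _ => measurable_const) fun o o' hne x hx => ((hsdisj hne).le_bot hx).elim
  refine ⟨idx, hidxm, fun i x hx y => ⟨fun hxy => ?_, fun hy => ?_⟩⟩
  · obtain ⟨o, hyo⟩ : ∃ o, y ∈ s o := by
      by_cases hy : y ∈ ⋃ i, t i
      · obtain ⟨j, hj⟩ := mem_iUnion.1 hy
        exact ⟨some j, hj⟩
      · exact ⟨none, hy⟩
    obtain rfl : o = some i := hg ((hidx o hyo).symm.trans (hxy.trans (hidx (some i) hx)))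
    exact hyo
  · exact (hidx (some i) hy).trans (hidx (some i) hx).symm

section PartitionIndex

variable {M : Type*} {F : M → M} {P : Set (Set M)} {idx : M → ℕ}

lemma labelSeq_preimage_cylinder (hidx : ∀ w ∈ P, ∀ x ∈ w, ∀ y, idx y = idx x ↔ y ∈ w)
    {w : ℕ → Set M} (hw : ∀ i, w i ∈ P) {x : M} (hx : ∀ i, F^[i] x ∈ w i) (n : ℕ) :
    labelSeq F idx ⁻¹' PiNat.cylinder (labelSeq F idx x) n = iterateCylinder F w n := by
  ext y
  exact forall₂_congr fun i _ => hidx _ (hw i) _ (hx i) _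

lemma exists_preimage_labelSeq_eq (hidx : ∀ w ∈ P, ∀ x ∈ w, ∀ y, idx y = idx x ↔ y ∈ w)
    {B : Set M}
    (hB : MeasurableSet[MeasurableSpace.generateFrom (⋃ n ≥ 1, dynPartition F P n)] B) :
    ∃ S, MeasurableSet S ∧ labelSeq F idx ⁻¹' S = B := by
  suffices hle : MeasurableSpace.generateFrom (⋃ n ≥ 1, dynPartition F P n) ≤
      MeasurableSpace.comap (labelSeq F idx) inferInstance from hle B hB
  refine MeasurableSpace.generateFrom_le fun A hA => ?_
  obtain ⟨n, -, w, hw, rfl⟩ := mem_iUnion₂.1 hA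
  have hlabel (i : ℕ) : ∃ S : Set ℕ, ∀ x, idx x ∈ S ↔ x ∈ w i := by
    rcases (w i).eq_empty_or_nonempty with hempty | ⟨x₀, hx₀⟩
    · exact ⟨∅, fun x => by rw [hempty]; exact Iff.rfl⟩
    · exact ⟨{idx x₀}, hidx _ (hw i) _ hx₀⟩
  choose S hS using hlabel
  refine ⟨{a | ∀ i < n, a i ∈ S i}, ?_, ?_⟩
  · exact measurableSet_setOfPred.2 <| Measurable.forall fun i => Measurable.forall fun _ =>
      measurableSet_setOfPred.1 (measurable_pi_apply i (MeasurableSet.of_discrete (s := S i)))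
  · ext x
    exact forall₂_congr fun i _ => hS i _

variable {R : M → ℕ}

lemma inducedMap_of_mem {f : M → M} {x : M} (hx : x ∈ ⋃₀ P) : inducedMap f P R x = f^[R x] x :=
  if_pos hx

open Classical in
/-- The recurrence time `R` on the elements of `P`, extended by the value one so that it is positive
everywhere. -/
noncomputable def roof (P : Set (Set M)) (R : M → ℕ) (x : M) : ℕ := if x ∈ ⋃₀ P then R x else 1

lemma roof_of_mem {x : M} (hx : x ∈ ⋃₀ P) : roof P R x = R x := if_pos hx

lemma roof_factorsThrough (hR : ∀ w ∈ P, ∀ x ∈ w, ∀ y ∈ w, R x = R y)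
    (hidx : ∀ w ∈ P, ∀ x ∈ w, ∀ y, idx y = idx x ↔ y ∈ w) :
    (roof P R).FactorsThrough idx := by
  intro x y hxy
  by_cases hx : x ∈ ⋃₀ P
  · obtain ⟨w, hw, hxw⟩ := hx
    have hyw : y ∈ w := (hidx w hw x hxw y).1 hxy.symm
    rw [roof_of_mem ⟨w, hw, hxw⟩, roof_of_mem ⟨w, hw, hyw⟩, hR w hw x hxw y hyw]
  · have hy : y ∉ ⋃₀ P := fun ⟨w, hw, hyw⟩ => hx ⟨w, hw, (hidx w hw y hyw x).1 hxy⟩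
    rw [roof, roof, if_neg hx, if_neg hy]

lemma measurable_roof [MeasurableSpace M] (hidx : Measurable idx)
    (h : (roof P R).FactorsThrough idx) : Measurable (roof P R) := by
  obtain ⟨ρ, hρ⟩ := (Function.factorsThrough_iff _).1 h
  exact hρ ▸ measurable_from_top.comp hidx

end PartitionIndex

section InducingScheme

variable {M : Type*} [TopologicalSpace M] [MeasurableSpace M] {m : Measure M} {f : M → M}
  {S Δ₀ : Set M} {P : Set (Set M)} {R : M → ℕ}

namespace IsInducingScheme

lemma subset (h : IsInducingScheme m f S Δ₀ P R) {w : Set M} (hw : w ∈ P) : w ⊆ Δ₀ := by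
  obtain ⟨V, -, rfl⟩ := h.relOpen w hw
  exact inter_subset_left

lemma sUnion_subset (h : IsInducingScheme m f S Δ₀ P R) : ⋃₀ P ⊆ Δ₀ :=
  Set.sUnion_subset fun _ hw => h.subset hw

lemma measurableSet [OpensMeasurableSpace M] (h : IsInducingScheme m f S Δ₀ P R) {w : Set M}
    (hw : w ∈ P) : MeasurableSet w := by
  obtain ⟨V, hV, rfl⟩ := h.relOpen w hw
  exact h.measurableSet_base.inter hV.measurableSet

lemma roof_pos (h : IsInducingScheme m f S Δ₀ P R) (x : M) : 0 < roof P R x := by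
  rw [roof]
  split_ifs with hx
  · exact h.time_pos x (h.sUnion_subset hx)
  · exact one_pos

lemma iterate_notMem (h : IsInducingScheme m f S Δ₀ P R) {w : Set M} (hw : w ∈ P) {x : M}
    (hx : x ∈ w) {j : ℕ} (hj : j < R x) : f^[j] x ∉ S := by
  rcases Nat.eq_zero_or_pos j with rfl | hj₀
  · exact h.base_subset (h.subset hw hx)
  · exact h.avoids w hw x hx j hj₀ hj.le

lemma mapsTo_inducedMap (h : IsInducingScheme m f S Δ₀ P R) {w : Set M} (hw : w ∈ P) :
    MapsTo (inducedMap f P R) w Δ₀ := by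
  intro x hx
  rw [inducedMap_of_mem ⟨w, hw, hx⟩]
  exact h.returns w hw x hx

lemma measure_base_ne_top (h : IsInducingScheme m f S Δ₀ P R)
    (hR : ∫⁻ x in Δ₀, (R x : ℝ≥0∞) ∂m < ⊤) : m Δ₀ ≠ ⊤ := by
  refine ne_top_of_le_ne_top hR.ne ?_
  rw [← setLIntegral_one]
  exact setLIntegral_mono' h.measurableSet_base fun x hx => by exact_mod_cast h.time_pos x hx

lemma exists_measurable_index [OpensMeasurableSpace M] (h : IsInducingScheme m f S Δ₀ P R) :
    ∃ idx : M → ℕ, Measurable idx ∧ ∀ w ∈ P, ∀ x ∈ w, ∀ y, idx y = idx x ↔ y ∈ w := by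
  have := h.countable.to_subtype
  obtain ⟨idx, hidxm, hidx⟩ := _root_.exists_measurable_index (t := ((↑) : P → Set M))
    (fun w => h.measurableSet w.2) fun v w hvw =>
      h.disjoint v.2 w.2 (Subtype.coe_injective.ne hvw)
  exact ⟨idx, hidxm, fun w hw => hidx ⟨w, hw⟩⟩

lemma isMarkovJacobian [OpensMeasurableSpace M] (h : IsInducingScheme m f S Δ₀ P R)
    (hF : Measurable (inducedMap f P R)) (hGM : IsGibbsMarkov m (inducedMap f P R) Δ₀ P)
    {J : M → ℝ} (hJ : Measurable J) (hJ₀ : ∀ x ∈ Δ₀, 0 < J x)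
    (himage : ∀ w ∈ P, ∀ A ⊆ w, MeasurableSet A →
      m (inducedMap f P R '' A) = ∫⁻ x in A, ENNReal.ofReal (J x) ∂m) :
    IsMarkovJacobian m (inducedMap f P R) Δ₀ P J where
  measurableSet_base := h.measurableSet_base
  measurable_map := hF
  countable := h.countable
  measurableSet _ := h.measurableSet
  subset _ := h.subset
  cover := h.cover
  measurable := hJ
  pos := hJ₀
  setLIntegral_mul_comp w hw g hg := by
    obtain ⟨A, hAw, -, -, -, hcover⟩ := hGM.markov w hw
    exact setLIntegral_mul_comp_of_measure_image_eq hF (h.measurableSet hw)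
      (h.mapsTo_inducedMap hw)
      (measure_mono_null (sdiff_subset_sdiff_right (image_mono hAw)) hcover) hJ.ennreal_ofReal
      (himage w hw) hg

end IsInducingScheme

end InducingScheme

section InducedJacobian

variable {M : Type*} [TopologicalSpace M] [MeasurableSpace M] {m : Measure M} [SigmaFinite m]
  {f : M → M} {U Δ₀ : Set M} {P : Set (Set M)} {R : M → ℕ} {D J : M → ℝ}

namespace IsInducingScheme

lemma ae_mem_jacobian_eq_prod (h : IsInducingScheme m f Uᶜ Δ₀ P R) (hf : Measurable f)
    (hD : Measurable D) (hD₀ : ∀ x, 0 ≤ D x) (hDU : IsJacobianOn m f D U)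
    (hGM : IsGibbsMarkov m (inducedMap f P R) Δ₀ P) (hJ : Measurable J) (hJ₀ : ∀ x ∈ Δ₀, 0 < J x)
    {w : Set M} (hw : w ∈ P)
    (himage : ∀ A ⊆ w, MeasurableSet A →
      m (inducedMap f P R '' A) = ∫⁻ x in A, ENNReal.ofReal (J x) ∂m) :
    ∀ᵐ x ∂m, x ∈ w → J x = ∏ l ∈ Finset.range (R x), D (f^[l] x) := by
  rcases w.eq_empty_or_nonempty with rfl | ⟨x₀, hx₀⟩
  · simp
  obtain ⟨A, hAw, hA, hwA, hinj, -⟩ := hGM.markov w hw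
  have hR (x : M) (hx : x ∈ A) : R x = R x₀ := h.time_const w hw x (hAw hx) x₀ hx₀
  have hF : EqOn (inducedMap f P R) f^[R x₀] A := fun x hx => by
    rw [inducedMap_of_mem ⟨w, hw, hAw hx⟩, hR x hx]
  have hAU : ∀ x ∈ A, ∀ j < R x₀, f^[j] x ∈ U := fun x hx j hj =>
    notMem_compl_iff.1 (h.iterate_notMem hw (hAw hx) (hj.trans_eq (hR x hx).symm))
  have hae := hDU.ae_eq_prod_iterate hf hD (R x₀) hA hAU (hF.injOn_iff.1 hinj) hJ.ennreal_ofReal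
    fun B hBA hB => by rw [← (hF.mono hBA).image_eq, himage B (hBA.trans hAw) hB]
  filter_upwards [(ae_restrict_iff' hA).1 hae, measure_eq_zero_iff_ae_notMem.1 hwA]
    with x hx hxA hxw
  have hmem : x ∈ A := not_not.1 fun hnot => hxA ⟨hxw, hnot⟩
  have hprod := hx hmem
  rw [← ENNReal.ofReal_prod_of_nonneg fun i _ => hD₀ _] at hprod
  rw [hR x hmem]
  exact (ENNReal.ofReal_eq_ofReal_iff (hJ₀ x (h.subset hw hxw)).le
    (Finset.prod_nonneg fun i _ => hD₀ _)).1 hprod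

lemma ae_jacobian_eq_prod (h : IsInducingScheme m f Uᶜ Δ₀ P R) (hf : Measurable f)
    (hD : Measurable D) (hD₀ : ∀ x, 0 ≤ D x) (hDU : IsJacobianOn m f D U)
    (hGM : IsGibbsMarkov m (inducedMap f P R) Δ₀ P) (hJ : Measurable J) (hJ₀ : ∀ x ∈ Δ₀, 0 < J x)
    (himage : ∀ w ∈ P, ∀ A ⊆ w, MeasurableSet A →
      m (inducedMap f P R '' A) = ∫⁻ x in A, ENNReal.ofReal (J x) ∂m) :
    ∀ᵐ x ∂m, x ∈ ⋃₀ P → J x = ∏ l ∈ Finset.range (R x), D (f^[l] x) := by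
  have hall := (ae_ball_iff h.countable).2 fun w hw =>
    h.ae_mem_jacobian_eq_prod hf hD hD₀ hDU hGM hJ hJ₀ hw (himage w hw)
  filter_upwards [hall] with x hx
  rintro ⟨w, hw, hxw⟩
  exact hx w hw hxw

end IsInducingScheme

end InducedJacobian

section SpreadMeasure

variable {M : Type*} [MeasurableSpace M] {f : M → M} {Δ₀ : Set M} {P : Set (Set M)} {R : M → ℕ}
  {ν₀ μ : Measure M}

lemma spreadMeasure_eq_smul_map_towerMeasure (hf : Measurable f) (hP : ⋃₀ P ⊆ Δ₀)
    (hν₀ : ∀ᵐ x ∂ν₀, x ∈ ⋃₀ P) :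
    spreadMeasure f Δ₀ R ν₀ = (∑' j : ℕ, ν₀ {x ∈ Δ₀ | j < R x})⁻¹ •
      (towerMeasure (roof P R) ν₀).map (towerProj f) := by
  rw [spreadMeasure, map_towerProj_towerMeasure hf]
  congr 2
  funext j
  congr 1
  refine Measure.restrict_congr_set ?_
  filter_upwards [hν₀] with x hx
  change (x ∈ Δ₀ ∧ j < R x) = (j < roof P R x)
  rw [roof_of_mem hx]
  exact propext (and_iff_right (hP hx))

lemma exists_measurePreserving_towerProj [IsProbabilityMeasure μ] (hf : Measurable f)
    (hP : ⋃₀ P ⊆ Δ₀) (hν₀ : ∀ᵐ x ∂ν₀, x ∈ ⋃₀ P) (hμ : μ = spreadMeasure f Δ₀ R ν₀) :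
    ∃ c : ℝ≥0∞, c ≠ 0 ∧ c ≠ ⊤ ∧
      MeasurePreserving (towerProj f) (c • towerMeasure (roof P R) ν₀) μ := by
  rw [spreadMeasure_eq_smul_map_towerMeasure hf hP hν₀] at hμ
  set c := (∑' j : ℕ, ν₀ {x ∈ Δ₀ | j < R x})⁻¹
  have hmass : c * (towerMeasure (roof P R) ν₀).map (towerProj f) univ = 1 := by
    rw [← smul_eq_mul, ← Measure.smul_apply, ← hμ, measure_univ]
  refine ⟨c, left_ne_zero_of_mul_eq_one hmass, fun htop => ?_, measurable_towerProj hf, ?_⟩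
  · rw [htop, ENNReal.top_mul (right_ne_zero_of_mul_eq_one hmass)] at hmass
    exact ENNReal.top_ne_one hmass
  · rw [Measure.map_smul, hμ]

end SpreadMeasure

section EntropyFormula

variable {M : Type*} [MeasurableSpace M] {m ν₀ μ : Measure M} {f F : M → M} {U Δ₀ : Set M}
  {P : Set (Set M)} {R : M → ℕ} {D J : M → ℝ}

lemma IsMarkovJacobian.ae_neg_le_log (h : IsMarkovJacobian m F Δ₀ P J) {K : ℝ}
    (hGibbs : HasGibbsLowerBound m F Δ₀ P J K) :
    ∀ᵐ x ∂m.restrict Δ₀, -K ≤ Real.log (J x) := by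
  filter_upwards [hGibbs, h.ae_mem_sUnion] with x hx hxP
  obtain ⟨w, hw, hxw⟩ := hxP
  have hmem : x ∈ iterateCylinder F (fun _ => w) 1 := fun i hi => by
    obtain rfl := Nat.lt_one_iff.1 hi
    exact hxw
  have hexp := (hx (fun _ => w) (fun _ => hw) 1 hmem).trans measureReal_le_one
  rw [Real.exp_le_one_iff, Finset.sum_range_one] at hexp
  exact sub_nonpos.1 hexp

lemma IsGibbsMarkov.exists_ae_eq_labelSeq_preimage (h : IsGibbsMarkov m F Δ₀ P)
    (hΔ₀ : MeasurableSet Δ₀) (hac : ν₀ ≪ m.restrict Δ₀) {idx : M → ℕ}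
    (hidx : ∀ w ∈ P, ∀ x ∈ w, ∀ y, idx y = idx x ↔ y ∈ w) {B : Set M} (hB : MeasurableSet B) :
    ∃ S, MeasurableSet S ∧ B =ᵐ[ν₀] labelSeq F idx ⁻¹' S := by
  obtain ⟨B', hB', hBB'⟩ := h.generating.1 (B ∩ Δ₀) inter_subset_right (hB.inter hΔ₀)
  obtain ⟨S, hS, rfl⟩ := exists_preimage_labelSeq_eq hidx hB'
  have hinter : (B : Set M) =ᵐ[m.restrict Δ₀] (B ∩ Δ₀ : Set M) := by
    filter_upwards [ae_restrict_mem hΔ₀] with x hx using propext (and_iff_left hx).symm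
  exact ⟨S, hS, hac.ae_le (hinter.trans hBB')⟩

variable [TopologicalSpace M] [OpensMeasurableSpace M]

lemma IsInducingScheme.measureEntropy_le (h : IsInducingScheme m f Uᶜ Δ₀ P R)
    (hGM : IsGibbsMarkov m (inducedMap f P R) Δ₀ P) (hfin : m Δ₀ ≠ ⊤) (hf : Measurable f)
    (hJ : IsMarkovJacobian m (inducedMap f P R) Δ₀ P J) {K : ℝ}
    (hGibbs : HasGibbsLowerBound m (inducedMap f P R) Δ₀ P J K)
    (hF : MeasurePreserving (inducedMap f P R) ν₀ ν₀) (hac : ν₀ ≪ m.restrict Δ₀)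
    [IsProbabilityMeasure μ] {c : ℝ≥0∞} (hc : c ≠ ⊤)
    (hμ : MeasurePreserving (towerProj f) (c • towerMeasure (roof P R) ν₀) μ)
    (hlog : Integrable (fun x => Real.log (J x)) ν₀) :
    measureEntropy f μ ≤ ((c.toReal * ∫ x, Real.log (J x) ∂ν₀ : ℝ) : EReal) := by
  obtain ⟨idx, hidxm, hidx⟩ := h.exists_measurable_index
  have hroof := roof_factorsThrough h.time_const hidx
  have := ProbabilityTheory.cond_isProbabilityMeasure_of_finite h.base_pos.ne' hfin
  refine measureEntropy_le_of_tower (m := ProbabilityTheory.cond m Δ₀) (K := K)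
    (measurable_roof hidxm hroof) hroof h.roof_pos hidxm hf hF ?_ hc hμ hJ.measurable.log hlog ?_
    fun B hB => hGM.exists_ae_eq_labelSeq_preimage h.measurableSet_base hac hidx hB
  · filter_upwards [hac.ae_le hJ.ae_mem_sUnion] with x hx
    rw [roof_of_mem hx, inducedMap_of_mem hx]
  · filter_upwards [hac.ae_le hGibbs, hac.ae_le hJ.ae_iterate_mem] with x hx hxP n
    choose w hw hxw using hxP
    rw [labelSeq_preimage_cylinder hidx hw hxw n]
    exact hx w hw n fun i _ => hxw i

namespace IsErgodicSRBGivenBy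

variable [SigmaFinite m]

lemma exists_isMarkovJacobian (hμ : IsErgodicSRBGivenBy m f Uᶜ Δ₀ P R μ) (hD : Measurable D)
    (hD₀ : ∀ x, 0 ≤ D x) (hDU : IsJacobianOn m f D U) :
    ∃ (J : M → ℝ) (K : ℝ), IsMarkovJacobian m (inducedMap f P R) Δ₀ P J ∧
      (∀ᵐ x ∂m, x ∈ ⋃₀ P → J x = ∏ l ∈ Finset.range (R x), D (f^[l] x)) ∧
      HasGibbsLowerBound m (inducedMap f P R) Δ₀ P J K := by
  have h := hμ.scheme
  obtain ⟨ν₀, hν₀, -, -⟩ := hμ.exists_base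
  obtain ⟨J, hJ, hJ₀, himage, C, hC, β, hβ₀, hβ₁, hdist⟩ := hμ.gibbsMarkov.exists_jacobian
  obtain ⟨Z, hZ₀, hZ⟩ := hμ.gibbsMarkov.separating
  have hMJ := h.isMarkovJacobian hν₀.measurePreserving.measurable hμ.gibbsMarkov hJ hJ₀ himage
  exact ⟨J, C / (1 - β), hMJ,
    h.ae_jacobian_eq_prod hμ.isSRB.measurePreserving.measurable hD hD₀ hDU hμ.gibbsMarkov hJ hJ₀
      himage,
    hMJ.hasGibbsLowerBound h.base_pos.ne' (h.measure_base_ne_top hμ.integrable_time)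
      h.disjoint hC.le hβ₀.le hβ₁ hdist hZ₀ hZ⟩

theorem integrable_log_and_measureEntropy_le (hμ : IsErgodicSRBGivenBy m f Uᶜ Δ₀ P R μ)
    (hD : Measurable D) (hD₀ : ∀ x, 0 ≤ D x) {C : ℝ} (hDC : ∀ x, D x ≤ C)
    (hDU : IsJacobianOn m f D U) :
    (∀ᵐ x ∂μ, 0 < D x) ∧ Integrable (fun x => Real.log (D x)) μ ∧
      measureEntropy f μ ≤ ((∫ x, Real.log (D x) ∂μ : ℝ) : EReal) := by
  have h := hμ.scheme
  have hf := hμ.isSRB.measurePreserving.measurable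
  have := hμ.isSRB.isProbabilityMeasure
  obtain ⟨J, K, hJ, hprod, hGibbs⟩ := hμ.exists_isMarkovJacobian hD hD₀ hDU
  obtain ⟨ν₀, hν₀, -, hspread⟩ := hμ.exists_base
  have := hν₀.isProbabilityMeasure
  have hac := hν₀.absolutelyContinuous
  have hmem := hac.ae_le hJ.ae_mem_sUnion
  obtain ⟨c, hc₀, hc, htower⟩ :=
    exists_measurePreserving_towerProj hf h.sUnion_subset hmem hspread
  obtain ⟨idx, hidxm, hidx⟩ := h.exists_measurable_index
  have hroof := measurable_roof hidxm (roof_factorsThrough h.time_const hidx)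
  have hJprod : ∀ᵐ x ∂ν₀, J x = ∏ l ∈ Finset.range (roof P R x), D (f^[l] x) := by
    filter_upwards [hac.ae_le (ae_restrict_of_ae hprod), hmem] with x hx hxP
    rw [roof_of_mem hxP, hx hxP]
  have hJpos : ∀ᵐ x ∂ν₀, 0 < J x := by
    filter_upwards [hmem] with x hx using hJ.pos x (h.sUnion_subset hx)
  have hDpos := ae_forall_pos_of_prod_pos hD₀ hJpos hJprod
  have hlogJ := ae_log_eq_sum_log hDpos hJprod
  have hlogD := integrable_log_towerProj hroof hc₀ htower hD hDC hDpos hlogJ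
    (hac.ae_le (hJ.ae_neg_le_log hGibbs))
  have hlogJi : Integrable (fun x => Real.log (J x)) ν₀ :=
    (integrable_sum_towerMeasure hroof (hD.comp htower.measurable).log hlogD).congr
      (EventuallyEq.symm hlogJ)
  refine ⟨ae_of_towerProj hroof htower (measurableSet_lt measurable_const hD) hDpos,
    (htower.integrable_comp hD.log.aestronglyMeasurable).1 (hlogD.smul_measure hc), ?_⟩
  rw [integral_towerProj hroof htower hD.log hlogD, ← integral_congr_ae hlogJ]
  exact h.measureEntropy_le hμ.gibbsMarkov (h.measure_base_ne_top hμ.integrable_time) hf hJ hGibbs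
    hν₀.measurePreserving hac hc htower hlogJi

end IsErgodicSRBGivenBy

end EntropyFormula

/-! ### The entropy formula -/

theorem IsErgodicSRBGivenBy.measureEntropy_eq_integral_log {M : Type*} [TopologicalSpace M]
    [MeasurableSpace M] [OpensMeasurableSpace M] {m μ : Measure M} [SigmaFinite m] {f : M → M}
    {U Δ₀ : Set M} {P : Set (Set M)} {R : M → ℕ} {D : M → ℝ} {C : ℝ}
    (hμ : IsErgodicSRBGivenBy m f Uᶜ Δ₀ P R μ) (hU : MeasurableSet U) (hU₀ : m Uᶜ = 0)
    (hDU : IsJacobianOn m f D U) (hD : ∀ x ∈ U, D x ∈ Icc 0 C)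
    (hinj : ∀ A ⊆ U, MeasurableSet A → (∀ x ∈ A, 0 < D x) →
      ∃ L : M → ℕ, Measurable L ∧ ∀ n, InjOn f (A ∩ L ⁻¹' {n})) :
    (∀ᵐ x ∂μ, 0 < D x) ∧ Integrable (fun x => Real.log (D x)) μ ∧
      measureEntropy f μ = ((∫ x, Real.log (D x) ∂μ : ℝ) : EReal) := by
  have hf := hμ.isSRB.measurePreserving
  have hμm := hμ.isSRB.absolutelyContinuous
  have := hμ.isSRB.isProbabilityMeasure
  have hμU : ∀ᵐ x ∂μ, x ∈ U := mem_ae_iff.2 (hμm hU₀)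
  obtain ⟨x₀, hx₀⟩ := hμU.exists
  obtain ⟨D', hD'm, hD', hDD'⟩ := hDU.aemeasurable.exists_ae_eq_range_subset
    ((ae_restrict_mem hU).mono hD) ⟨D x₀, hD x₀ hx₀⟩
  obtain ⟨hpos', hint', hle⟩ := hμ.integrable_log_and_measureEntropy_le hD'm
    (fun x => (hD' (mem_range_self x)).1) (fun x => (hD' (mem_range_self x)).2)
    (hDU.congr_ae hDD')
  have hDD'μ : D =ᵐ[μ] D' := by
    filter_upwards [hμm.ae_le ((ae_restrict_iff' hU).1 hDD'), hμU] with x hx hxU using hx hxU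
  have hlog : (fun x => Real.log (D x)) =ᵐ[μ] fun x => Real.log (D' x) :=
    hDD'μ.fun_comp Real.log
  have hpos : ∀ᵐ x ∂μ, 0 < D x := by
    filter_upwards [hpos', hDD'μ] with x hx hxD using hxD ▸ hx
  have hint := hint'.congr hlog.symm
  rw [← integral_congr_ae hlog] at hle
  have hsupp : (U ∩ {x | 0 < D x} : Set M) =ᵐ[μ] univ := eventuallyEq_univ.2 (hμU.and hpos)
  obtain ⟨A, hAsub, hA, hAae⟩ :=
    (nullMeasurableSet_univ.congr hsupp.symm).exists_measurable_subset_ae_eq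
  have hμA : ∀ᵐ x ∂μ, x ∈ A := eventuallyEq_univ.1 (hAae.trans hsupp)
  have hAU : A ⊆ U := hAsub.trans inter_subset_left
  obtain ⟨L, hL, hLinj⟩ := hinj A hAU hA fun x hx => (hAsub hx).2
  exact ⟨hpos, hint, hle.antisymm (integral_log_jacobian_le_measureEntropy hμm hf hDU hAU hA hμA
    (fun x hx => (hAsub hx).2) hL hLinj hint)⟩

section Manifold

variable {d : ℕ} {H : Type*} [TopologicalSpace H]
  (I : ModelWithCorners ℝ (EuclideanSpace ℝ (Fin d)) H)
  {M : Type*} [TopologicalSpace M] [ChartedSpace H M] [IsManifold I 1 M]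
  [SecondCountableTopology M] [MeasurableSpace M] [BorelSpace M]
  [RiemannianBundle (fun x : M => TangentSpace I x)]

lemma exists_measurable_injOn_fibers_of_absDetDeriv_pos [Nonempty M] {f : M → M} {A : Set M}
    (hf : Measurable f) (hA : MeasurableSet A) (hd : ∀ x ∈ A, MDifferentiableAt I I f x)
    (hpos : ∀ x ∈ A, 0 < absDetDeriv I f x) :
    ∃ L : M → ℕ, Measurable L ∧ ∀ n, InjOn f (A ∩ L ⁻¹' {n}) := by
  obtain ⟨t, ht, rfl, hinj⟩ := exists_seq_cover_injOn_of_absDetDeriv_pos I hf hA hd hpos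
  obtain ⟨L, hL, hLt⟩ := exists_measurable_index (MeasurableSet.disjointed ht)
    (disjoint_disjointed t)
  refine ⟨L, hL, fun n x hx y hy hxy => ?_⟩
  obtain ⟨k, hxk⟩ := mem_iUnion.1 (iUnion_disjointed.superset hx.1)
  have hyk : y ∈ disjointed t k := (hLt k x hxk y).1 (hy.2.trans hx.2.symm)
  exact hinj k (disjointed_subset t k hxk) (disjointed_subset t k hyk) hxy

theorem corollaryB_general
    [IsContinuousRiemannianBundle (EuclideanSpace ℝ (Fin d)) (fun x : M => TangentSpace I x)]
    {f : M → M} {U : Set M} (hU : MeasurableSet U) (hU₀ : riemannianVolume I M Uᶜ = 0)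
    (hd : ∀ x ∈ U, MDifferentiableAt I I f x) {Δ₀ : Set M} {P : Set (Set M)} {R : M → ℕ}
    {μ : Measure M} (hμ : IsErgodicSRBGivenBy (riemannianVolume I M) f Uᶜ Δ₀ P R μ)
    (hdet : ∃ C : ℝ, ∀ x ∈ U, absDetDeriv I f x ≤ C) :
    (∀ᵐ x ∂μ, 0 < absDetDeriv I f x) ∧
      Integrable (fun x => Real.log (absDetDeriv I f x)) μ ∧
      measureEntropy f μ = ((∫ x, Real.log (absDetDeriv I f x) ∂μ : ℝ) : EReal) ∧
      measureEntropy f μ < ⊤ := by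
  have hf : Measurable f := hμ.isSRB.measurePreserving.measurable
  have := hμ.isSRB.isProbabilityMeasure
  have : Nonempty M := nonempty_of_isProbabilityMeasure μ
  have := sigmaFinite_riemannianVolume I (M := M)
  obtain ⟨C, hC⟩ := hdet
  obtain ⟨hpos, hint, heq⟩ := hμ.measureEntropy_eq_integral_log hU hU₀
    (isJacobianOn_absDetDeriv I hf hU hd) (fun x hx => ⟨absDetDeriv_nonneg I f x, hC x hx⟩)
    fun A hAU hA => exists_measurable_injOn_fibers_of_absDetDeriv_pos I hf hA fun x hx =>
      hd x (hAU hx)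
  exact ⟨hpos, hint, heq, heq ▸ EReal.coe_lt_top _⟩

end Manifold

theorem corollaryB {d : ℕ} {H : Type*} [TopologicalSpace H]
    (I : ModelWithCorners ℝ (EuclideanSpace ℝ (Fin d)) H)
    {M : Type*} [TopologicalSpace M] [ChartedSpace H M] [IsManifold I ∞ M]
    [T2Space M] [SecondCountableTopology M] [MeasurableSpace M] [BorelSpace M]
    [RiemannianBundle (fun x : M => TangentSpace I x)]
    [IsContMDiffRiemannianBundle I ∞ (EuclideanSpace ℝ (Fin d)) (fun x : M => TangentSpace I x)]
    (η : ℝ≥0) (hη₀ : 0 < η) (hη₁ : η ≤ 1) (f : M → M) (N : ℕ → Set M)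
    (hf : IsPiecewiseC1Holder I η f N)
    (Δ₀ : Set M) (P : Set (Set M)) (R : M → ℕ) (μ : Measure M)
    (hμ : IsErgodicSRBGivenBy (riemannianVolume I M) f (singularSet N) Δ₀ P R μ)
    (hdet : ∃ C : ℝ, ∀ x ∉ singularSet N, absDetDeriv I f x ≤ C)
    (hR : ∫⁻ x in Δ₀, (R x : ℝ≥0∞) ^ 2 ∂(riemannianVolume I M) < ⊤) :
    (∀ᵐ x ∂μ, 0 < absDetDeriv I f x) ∧
      Integrable (fun x => Real.log (absDetDeriv I f x)) μ ∧
      measureEntropy f μ = ((∫ x, Real.log (absDetDeriv I f x) ∂μ : ℝ) : EReal) ∧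
      measureEntropy f μ < ⊤ := by
  have : IsManifold I 1 M := IsManifold.of_le (n := ∞) (by simp)
  have : IsContinuousRiemannianBundle (EuclideanSpace ℝ (Fin d))
      (fun x : M => TangentSpace I x) := by
    obtain ⟨g, hg, hinner⟩ := IsContMDiffRiemannianBundle.exists_contMDiff (IB := I) (n := ∞)
      (F := EuclideanSpace ℝ (Fin d)) (E := fun x : M => TangentSpace I x)
    exact ⟨g, hg.continuous, hinner⟩
  have hopen : IsOpen (⋃ i, N i) := isOpen_iUnion hf.isOpen
  exact corollaryB_general I hopen.measurableSet hf.singularSet_null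
    (fun x hx => (hf.isC1HolderOn.1.contMDiffAt (hopen.mem_nhds hx)).mdifferentiableAt
      one_ne_zero) hμ (hdet.imp fun C hC x hx => hC x (notMem_compl_iff.2 hx))
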